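/- **Setting.** Let $(X,g)$ be a smooth oriented Riemannian $4$-manifold with a spin structure, $Spin(4)=SU(2)\times SU(2)$, where $(A,B)$ acts on $\mathbb R^4\cong\mathbb M=\Bigl\{\tfrac1{\sqrt2}\begin{pmatrix}x^0+ix^3&x^1+ix^2\\-x^1+ix^2&x^0-ix^3\end{pmatrix}\Bigr\}$ by $Y\mapsto AYB^{-1}$. Let $\mathbb S,\mathbb S'$ be the rank $2$ complex bundles associated with the representations $(A,B)\mapsto A$ and $(A,B)\mapsto{}^tB^{-1}$, so that $\mathbb CTX\cong\mathbb S\otimes\mathbb S'$ (row index $A$ for $\mathbb S$, column index $A'$ for $\mathbb S'$). Let $\varepsilon_{AB},\varepsilon_{A'B'}$ be the skew forms with $\varepsilon_{01}=1$ in spin frames, so that $g_{ab}=\varepsilon_{AB}\varepsilon_{A'B'}$; indices are lowered by $\eta_{B'}=\eta^{A'}\varepsilon_{A'B'}$. Let $\sigma$ be the antilinear map $\sigma(a,b)=(\bar b,-\bar a)$ of $\mathbb S'$, and $\|\pi\|^2=\varepsilon(\sigma\pi,\pi)=(\sigma\pi)_{A'}\pi^{A'}=|\pi^{0'}|^2+|\pi^{1'}|^2$.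 The orientation is the one for which $dx^1\wedge dx^2\wedge dx^3\wedge dx^0$ is positive on $\mathbb M$, that is, the self-dual $2$-forms are those of the form $\phi_{A'B'}\varepsilon_{AB}$ with $\phi$ symmetric. Let $R$ be the scalar curvature and $\Lambda=R/24$. Let $\nabla$ be the connection of $\mathbb S'$ induced by the Levi-Civita connection of $g$, $\delta\pi^{A'}=d\pi^{A'}+\Gamma_{cB'}{}^{A'}\pi^{B'}\theta^c$ its vertical forms on $\mathbb S'$, and $T_\pi\mathbb S'\cong T_xX\oplus\mathbb S'_x$ the decomposition into horizontal and vertical vectors. On $\mathbb S'\setminus\{0\}$ define $\mathbb I=I_\pi\oplus i$ and $\mathbb J=J_\pi\oplus\sigma$, where $I_\pi,J_\pi$ act on $T_xX$ by $v^{AA'}\mapsto v^{AB'}I_{B'}{}^{A'}$ and $v^{AA'}\mapsto v^{AB'}J_{B'}{}^{A'}$ with $$I_{B'}{}^{A'}=\frac{-i}{\|\pi\|^2}\bigl(\pi_{B'}(\sigma\pi)^{A'}+(\sigma\pi)_{B'}\pi^{A'}\bigr),\qquad J_{B'}{}^{A'}=\frac{-1}{\|\pi\|^2}\bigl(\pi_{B'}\pi^{A'}+(\sigma\pi)_{B'}(\sigma\pi)^{A'}\bigr).$$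 Put $\tilde\tau=\varepsilon_{A'B'}\pi^{A'}\delta\pi^{B'}$, $\tilde\omega=d\tilde\tau$ and $$\tilde\omega_{\mathbb J}(V,W)=\frac{-i}{2}\bigl(\tilde\omega(V,\mathbb JW)-\tilde\omega(W,\mathbb JV)\bigr).$$ **Theorem.** Suppose that $g$ is anti self-dual ($W^+=0$) and Einstein with $\Lambda\neq0$ everywhere. Then on $\mathbb S'\setminus\{0\}$ $$i\partial\bar\partial\|\pi\|^2=\tilde\omega_{\mathbb J},$$ where for a function $f$ one puts $\bar\partial f=\tfrac12(df+i\,df\circ\mathbb I)$, the $(0,1)$-part of $df$ with respect to $\mathbb I$, and $\partial\bar\partial f$ is the $(1,1)$-part of $d\bar\partial f$ with respect to $\mathbb I$. In particular, $\tilde\omega_{\mathbb J}$ is a (smooth) closed real $(1,1)$-form with respect to $\mathbb I$, with potential $\|\pi\|^2$. -/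

import Mathlib

open scoped Manifold ContDiff Matrix

noncomputable section

namespace SpinorPotential

/-! ### Complex differential forms on a real manifold without boundary -/

section Forms

variable {E : Type*} [NormedAddCommGroup E] [NormedSpace ℝ E]
  {H : Type*} [TopologicalSpace H] (I : ModelWithCorners ℝ E H)
  (M : Type*) [TopologicalSpace M] [ChartedSpace H M]

/-- Complex valued differential forms of degree `k` (pointwise, without smoothness). -/
abbrev DiffForm (k : ℕ) : Type _ := (p : M) → TangentSpace I p [⋀^Fin k]→L[ℝ] ℂ

/-- Fields of real endomorphisms of the tangent spaces. -/
abbrev EndoField : Type _ := (p : M) → TangentSpace I p →L[ℝ] TangentSpace I p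

variable {I M}

/-- The form `β` read in the preferred chart at `p`: the pull back of `β` under the inverse of the
chart. -/
def inChart {k : ℕ} (β : DiffForm I M k) (p : M) (y : E) : E [⋀^Fin k]→L[ℝ] ℂ :=
  (β ((extChartAt I p).symm y)).compContinuousLinearMap
    (mfderiv 𝓘(ℝ, E) I (extChartAt I p).symm y)

/-- Smoothness of a form near the point `p`. -/
def SmoothFormAt {k : ℕ} (β : DiffForm I M k) (p : M) : Prop :=
  ContDiffAt ℝ ∞ (inChart β p) (extChartAt I p p)

/-- The exterior derivative: at `p` it is computed in the chart at `p` and pulled back by this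
chart. The normalization is `dα(V, W) = V (α W) - W (α V) - α [V, W]`. -/
def extD {k : ℕ} (β : DiffForm I M k) : DiffForm I M (k + 1) := fun p =>
  (extDeriv (inChart β p) (extChartAt I p p)).compContinuousLinearMap
    (mfderiv I 𝓘(ℝ, E) (extChartAt I p) p)

/-- The differential of a complex valued function at a point. -/
def differential (f : M → ℂ) (p : M) : TangentSpace I p →L[ℝ] ℂ :=
  mfderiv I 𝓘(ℝ, ℂ) f p

/-- `∂̄ f = (df + i df ∘ 𝕀) / 2`, the part of `df` of type `(0, 1)` for the almost complex
structure `𝕀`. -/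
def dbar (𝕀 : EndoField I M) (f : M → ℂ) : DiffForm I M 1 := fun p =>
  ContinuousAlternatingMap.ofSubsingleton ℝ (TangentSpace I p) ℂ (0 : Fin 1)
    ((1 / 2 : ℂ) • (differential f p + Complex.I • (differential f p).comp (𝕀 p)))

/-- The part of type `(1, 1)` of a 2-form: `(β + β(𝕀 ·, 𝕀 ·)) / 2`. -/
def typeOneOne (𝕀 : EndoField I M) (β : DiffForm I M 2) : DiffForm I M 2 := fun p =>
  (1 / 2 : ℂ) • (β p + (β p).compContinuousLinearMap (𝕀 p))

/-- `∂ α` for a form `α` of type `(0, 1)`: the part of `dα` of type `(1, 1)`. -/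
def delZeroOne (𝕀 : EndoField I M) (α : DiffForm I M 1) : DiffForm I M 2 :=
  typeOneOne 𝕀 (extD α)

/-- `∂ ∂̄ f`. -/
def ddbar (𝕀 : EndoField I M) (f : M → ℂ) : DiffForm I M 2 :=
  delZeroOne 𝕀 (dbar 𝕀 f)

theorem upd0 {V : Type*} (a b c : V) : Function.update ![a, b] 0 c = ![c, b] := by
  ext j; fin_cases j <;> rfl

theorem upd1 {V : Type*} (a b c : V) : Function.update ![a, b] 1 c = ![a, c] := by
  ext j; fin_cases j <;> rfl

/-- For a 2-form `β` and an endomorphism field `J` the 2-form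
`(V, W) ↦ (-i / 2) (β(V, J W) - β(W, J V))`. -/
def twist (J : EndoField I M) (β : DiffForm I M 2) : DiffForm I M 2 := fun p =>
  { toFun := fun v => (-Complex.I / 2) * (β p ![v 0, J p (v 1)] - β p ![v 1, J p (v 0)])
    map_update_add' := by
      intro hdec v i x y
      obtain rfl : hdec = instDecidableEqFin 2 := Subsingleton.elim _ _
      have h1 : ∀ a b c : TangentSpace I p, β p ![a + b, c] = β p ![a, c] + β p ![b, c] :=
        fun a b c => by
          have := (β p).map_update_add ![a, c] 0 a b
          rwa [upd0, upd0, upd0] at this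
      have h2 : ∀ a b c : TangentSpace I p, β p ![c, a + b] = β p ![c, a] + β p ![c, b] :=
        fun a b c => by
          have := (β p).map_update_add ![c, a] 1 a b
          rwa [upd1, upd1, upd1] at this
      fin_cases i <;> simp [h1, h2] <;> ring
    map_update_smul' := by
      intro hdec v i r x
      obtain rfl : hdec = instDecidableEqFin 2 := Subsingleton.elim _ _
      have h1 : ∀ (a c : TangentSpace I p), β p ![r • a, c] = r • β p ![a, c] :=
        fun a c => by
          have := (β p).map_update_smul ![a, c] 0 r a
          rwa [upd0, upd0] at this
      have h2 : ∀ (a c : TangentSpace I p), β p ![c, r • a] = r • β p ![c, a] :=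
        fun a c => by
          have := (β p).map_update_smul ![c, a] 1 r a
          rwa [upd1, upd1] at this
      fin_cases i <;> simp [h1, h2] <;> ring
    cont := by
      have h : ∀ i j : Fin 2, Continuous fun v : Fin 2 → TangentSpace I p =>
          β p ![v i, J p (v j)] := fun i j =>
        (β p).cont.comp (continuous_pi fun k => by
          fin_cases k
          · exact continuous_apply i
          · exact (J p).continuous.comp (continuous_apply j))
      exact continuous_const.mul ((h 0 1).sub (h 1 0))
    map_eq_zero_of_eq' := by
      intro v i j hv hij
      have h : v 0 = v 1 := by
        fin_cases i <;> fin_cases j <;> simp_all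
      simp [h] }

/-- A form with real values on real tangent vectors. -/
def RealFormAt {k : ℕ} (β : DiffForm I M k) (p : M) : Prop :=
  ∀ v : Fin k → TangentSpace I p, (β p v).im = 0

/-- A 2-form of type `(1, 1)` with respect to `𝕀`: it is equal to its own `(1, 1)` part. -/
def OneOneFormAt (𝕀 : EndoField I M) (β : DiffForm I M 2) (p : M) : Prop :=
  typeOneOne 𝕀 β p = β p

end Forms

/-! ### Algebra of two component spinors -/

/-- The basis `E 0, …, E 3` of the real space `𝕄` of `2 × 2` matrices
`2^(-1/2) * !![x0 + i x3, x1 + i x2; -x1 + i x2, x0 - i x3]`, which is identified with `ℝ⁴`. -/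
def basisM : Fin 4 → Matrix (Fin 2) (Fin 2) ℂ :=
  ![((Real.sqrt 2 : ℂ)⁻¹) • !![1, 0; 0, 1],
    ((Real.sqrt 2 : ℂ)⁻¹) • !![0, 1; -1, 0],
    ((Real.sqrt 2 : ℂ)⁻¹) • !![0, Complex.I; Complex.I, 0],
    ((Real.sqrt 2 : ℂ)⁻¹) • !![Complex.I, 0; 0, -Complex.I]]

/-- The matrix with the coordinates `x` in the basis `basisM`. -/
def toM (x : Fin 4 → ℝ) : Matrix (Fin 2) (Fin 2) ℂ := ∑ a, (x a : ℂ) • basisM a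

/-- The coordinates of a matrix in the basis `basisM` (which is orthonormal for the trace form);
they are complex in general, and real on `𝕄`. -/
def coordM (Y : Matrix (Fin 2) (Fin 2) ℂ) (a : Fin 4) : ℂ := ((basisM a)ᴴ * Y).trace

/-- The skew form `ε(ξ, η) = ξ⁰ η¹ - ξ¹ η⁰`. -/
def eps (ξ η : Fin 2 → ℂ) : ℂ := ξ 0 * η 1 - ξ 1 * η 0

/-- Lowering an index: `η_B = η^A ε_{AB}`. -/
def lower (η : Fin 2 → ℂ) : Fin 2 → ℂ := ![-η 1, η 0]

/-- The antilinear quaternionic structure `σ (a, b) = (b̄, -ā)`. -/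
def sigma (η : Fin 2 → ℂ) : Fin 2 → ℂ := ![star (η 1), -star (η 0)]

/-- `σ` as a real linear map. -/
def sigmaL : (Fin 2 → ℂ) →L[ℝ] (Fin 2 → ℂ) :=
  LinearMap.toContinuousLinearMap
    { toFun := sigma
      map_add' := by
        intro x y
        ext i; fin_cases i <;> simp [sigma]; ring
      map_smul' := by
        intro c x
        ext i; fin_cases i <;> simp [sigma] }

/-- `‖π‖² = (σπ)_{A'} π^{A'} = ε(σπ, π)`. -/
def spinorNormSq (π : Fin 2 → ℂ) : ℂ := eps (sigma π) π

/-- The matrix `I_{B'}^{A'} = -i ‖π‖⁻² (π_{B'} (σπ)^{A'} + (σπ)_{B'} π^{A'})`, row index `B'`. -/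
def matI (π : Fin 2 → ℂ) : Matrix (Fin 2) (Fin 2) ℂ :=
  Matrix.of fun B A => (-Complex.I / spinorNormSq π) *
    (lower π B * sigma π A + lower (sigma π) B * π A)

/-- The matrix `J_{B'}^{A'} = -‖π‖⁻² (π_{B'} π^{A'} + (σπ)_{B'} (σπ)^{A'})`, row index `B'`. -/
def matJ (π : Fin 2 → ℂ) : Matrix (Fin 2) (Fin 2) ℂ :=
  Matrix.of fun B A => (-1 / spinorNormSq π) *
    (lower π B * π A + lower (sigma π) B * sigma π A)

/-- The real linear form `η ↦ ε(ξ, η)`. -/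
def epsL (ξ : Fin 2 → ℂ) : (Fin 2 → ℂ) →L[ℝ] ℂ :=
  LinearMap.toContinuousLinearMap
    { toFun := eps ξ
      map_add' := by intro x y; simp [eps]; ring
      map_smul' := by intro c x; simp [eps]; ring }

/-- The action on `ℂ²` (by the derivative of `(A, B) ↦ ᵗB⁻¹`) of the element of the Lie algebra of
`SU(2) × SU(2)` which lifts the skew symmetric matrix `w`; see `spinLift_spec`. -/
def spinLift (w : Matrix (Fin 4) (Fin 4) ℝ) : Matrix (Fin 2) (Fin 2) ℂ :=
  (1 / 2 : ℂ) • ∑ a, ∑ c, (w c a : ℂ) • ((basisM c)ᵀ * (basisM a).map star)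

theorem sqrt_two_inv_mul_self : ((Real.sqrt 2 : ℂ)⁻¹) * ((Real.sqrt 2 : ℂ)⁻¹) = 1 / 2 := by
  rw [← mul_inv, ← Complex.ofReal_mul, Real.mul_self_sqrt (by norm_num)]
  norm_num

theorem transpose_two (a b c d : ℂ) : !![a, b; c, d]ᵀ = !![a, c; b, d] := by
  ext r t; fin_cases r <;> fin_cases t <;> rfl

theorem spinLift_spec (w : Matrix (Fin 4) (Fin 4) ℝ) (hw : wᵀ = -w) :
    ∃ a b : Matrix (Fin 2) (Fin 2) ℂ, aᴴ = -a ∧ bᴴ = -b ∧ a.trace = 0 ∧ b.trace = 0 ∧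
      spinLift w = -bᵀ ∧ ∀ x : Fin 4 → ℝ, toM (w *ᵥ x) = a * toM x - toM x * b := by
  have hs := sqrt_two_inv_mul_self
  have hskew : ∀ i j, w j i = -w i j := fun i j => by
    have := congrFun (congrFun hw i) j
    simpa using this
  have hd : ∀ i, w i i = 0 := fun i => by linarith [hskew i i]
  have h01 := hskew 1 0
  have h02 := hskew 2 0
  have h03 := hskew 3 0
  have h12 := hskew 2 1
  have h13 := hskew 3 1
  have h23 := hskew 3 2
  have hconj : (starRingEnd ℂ) ((Real.sqrt 2 : ℂ)⁻¹) = (Real.sqrt 2 : ℂ)⁻¹ := by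
    rw [map_inv₀, Complex.conj_ofReal]
  have key : spinLift w = !![
      (((w 3 0 - w 2 1) / 2 : ℝ) : ℂ) * Complex.I,
      (((w 3 2 - w 1 0) / 2 : ℝ) : ℂ) + (((w 2 0 + w 3 1) / 2 : ℝ) : ℂ) * Complex.I;
      (((w 1 0 - w 3 2) / 2 : ℝ) : ℂ) + (((w 2 0 + w 3 1) / 2 : ℝ) : ℂ) * Complex.I,
      -(((w 3 0 - w 2 1) / 2 : ℝ) : ℂ) * Complex.I] := by
    unfold spinLift basisM
    generalize hsq : ((Real.sqrt 2 : ℂ)⁻¹) = s at hs hconj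
    ext r t
    fin_cases r <;> fin_cases t <;>
      simp [Fin.sum_univ_four, Matrix.mul_apply, Fin.sum_univ_two, hd, h01, h02, h03, h12, h13,
        h23, hconj]
    all_goals ring_nf
    all_goals simp only [pow_two, hs, Complex.I_mul_I]
    all_goals ring_nf
  refine ⟨!![
      (((w 3 0 + w 2 1) / 2 : ℝ) : ℂ) * Complex.I,
      (((w 1 0 + w 3 2) / 2 : ℝ) : ℂ) + (((w 2 0 - w 3 1) / 2 : ℝ) : ℂ) * Complex.I;
      -(((w 1 0 + w 3 2) / 2 : ℝ) : ℂ) + (((w 2 0 - w 3 1) / 2 : ℝ) : ℂ) * Complex.I,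
      -(((w 3 0 + w 2 1) / 2 : ℝ) : ℂ) * Complex.I], -(spinLift w)ᵀ, ?_, ?_, ?_, ?_, ?_, ?_⟩
  · ext r t
    fin_cases r <;> fin_cases t <;> simp <;> ring
  · rw [key]
    ext r t
    fin_cases r <;> fin_cases t <;> simp <;> ring
  · simp [Matrix.trace_fin_two]
  · rw [key]
    simp [Matrix.trace_fin_two]
  · simp
  · intro x
    have keyT := congrArg Matrix.transpose key
    rw [transpose_two] at keyT
    rw [keyT]
    unfold toM basisM
    generalize ((Real.sqrt 2 : ℂ)⁻¹) = s
    ext r t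
    fin_cases r <;> fin_cases t <;>
      simp [Fin.sum_univ_four, hd, h01, h02, h03, h12, h13, h23, Matrix.mulVec, dotProduct]
    all_goals ring_nf
    all_goals simp only [Complex.I_sq]
    all_goals ring_nf

theorem spinorNormSq_eq (π : Fin 2 → ℂ) :
    spinorNormSq π = ((‖π 0‖ ^ 2 + ‖π 1‖ ^ 2 : ℝ) : ℂ) := by
  simp only [spinorNormSq, eps, sigma, Complex.ofReal_add, Complex.ofReal_pow, ← Complex.mul_conj']
  simp
  ring

theorem coordM_mul_real (u v : ℂ) (a b : Fin 4) :
    (coordM (basisM b * !![u, v; -star v, star u]) a).im = 0 := by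
  simp only [coordM, Matrix.trace_fin_two, Matrix.mul_apply, Fin.sum_univ_two,
    Matrix.conjTranspose_apply]
  unfold basisM
  rw [← Complex.ofReal_inv]
  generalize (Real.sqrt 2)⁻¹ = s
  fin_cases a <;> fin_cases b <;> simp

/-- Right multiplication by `I_{B'}^{A'}` is a real operator. -/
theorem matI_real (π : Fin 2 → ℂ) (a b : Fin 4) : (coordM (basisM b * matI π) a).im = 0 := by
  have h : matI π = !![matI π 0 0, matI π 0 1; -star (matI π 0 1), star (matI π 0 0)] := by
    ext r t
    fin_cases r <;> fin_cases t <;> simp [matI, spinorNormSq_eq, lower, sigma] <;> ring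
  rw [h]
  exact coordM_mul_real _ _ a b

/-- Right multiplication by `J_{B'}^{A'}` is a real operator. -/
theorem matJ_real (π : Fin 2 → ℂ) (a b : Fin 4) : (coordM (basisM b * matJ π) a).im = 0 := by
  have h : matJ π = !![matJ π 0 0, matJ π 0 1; -star (matJ π 0 1), star (matJ π 0 0)] := by
    ext r t
    fin_cases r <;> fin_cases t <;> simp [matJ, spinorNormSq_eq, lower, sigma]
    all_goals ring_nf
    all_goals simp
  rw [h]
  exact coordM_mul_real _ _ a b

/-- The volume form `e_{abcd}` of `ℝ⁴ ≅ 𝕄` for the orientation `dx¹ ∧ dx² ∧ dx³ ∧ dx⁰`. This is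
the orientation for which
`e_{abcd} = ε_{AC} ε_{BD} ε_{A'D'} ε_{B'C'} - ε_{AD} ε_{BC} ε_{A'C'} ε_{B'D'}`,
so that the self dual 2-forms are those of the form `φ_{A'B'} ε_{AB}`, `φ` symmetric. -/
def volM (a b c d : Fin 4) : ℝ :=
  Matrix.det (Matrix.of fun r s : Fin 4 =>
    if (![a, b, c, d] : Fin 4 → Fin 4) r = (![1, 2, 3, 0] : Fin 4 → Fin 4) s then (1 : ℝ) else 0)

/-- The linear dependence of the action `η ↦ B̄ η` on the matrix `B`. -/
def conjActionL : (Fin 2 → Fin 2 → ℂ) →L[ℝ] ((Fin 2 → ℂ) →L[ℝ] (Fin 2 → ℂ)) :=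
  LinearMap.toContinuousLinearMap
    { toFun := fun B => LinearMap.toContinuousLinearMap
        { toFun := fun η => (Matrix.of B).map star *ᵥ η
          map_add' := fun x y => Matrix.mulVec_add _ x y
          map_smul' := fun c x => Matrix.mulVec_smul _ c x }
      map_add' := by
        intro x y
        refine ContinuousLinearMap.ext fun η => ?_
        ext k
        fin_cases k <;> simp <;> ring
      map_smul' := by
        intro c x
        refine ContinuousLinearMap.ext fun η => ?_
        ext k
        fin_cases k <;> simp <;> ring }

theorem conjActionL_apply (B : Matrix (Fin 2) (Fin 2) ℂ) (η : Fin 2 → ℂ) :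
    conjActionL B η = B.map star *ᵥ η := rfl

/-! ### Spin structures and the spinor bundle -/

variable {X : Type*} [TopologicalSpace X] [ChartedSpace (EuclideanSpace ℝ (Fin 4)) X]
  [IsManifold (𝓡 4) ∞ X]

variable (X) in
/-- Smooth Riemannian metrics on the 4-manifold `X`. -/
abbrev Metric4 : Type _ :=
  Bundle.ContMDiffRiemannianMetric (𝓡 4) ∞ (EuclideanSpace ℝ (Fin 4))
    (fun x : X => TangentSpace (𝓡 4) x)

/-- A spin structure of the Riemannian 4-manifold `(X, g)`, given by local spin frames: a cover of
`X` by open sets `U i`, smooth orthonormal frames over them (whose orientations agree, and which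
are the oriented frames of `X`), and smooth transition functions
`(A i j, B i j) : U i ∩ U j → SU(2) × SU(2) = Spin(4)`, which satisfy the cocycle condition and
lift the transition functions of the frames along `Spin(4) → SO(4)`, where `(A, B)` acts on
`ℝ⁴ ≅ 𝕄` by `Y ↦ A Y B⁻¹`. The pair `(A i j, B i j)` takes coordinates in the frame `i` to
coordinates in the frame `j`. -/
structure SpinStructure (g : Metric4 X) where
  /-- labels of the local spin frames -/
  ι : Type*
  /-- the domains of the frames -/
  U : ι → Set X
  isOpen_U : ∀ i, IsOpen (U i)
  /-- a frame that is defined near a given point -/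
  indexAt : X → ι
  mem_U : ∀ x, x ∈ U (indexAt x)
  /-- the frames -/
  frame : ι → Fin 4 → (x : X) → TangentSpace (𝓡 4) x
  frame_smooth : ∀ i a, ContMDiffOn (𝓡 4) (𝓡 4).tangent ∞
    (fun x => (⟨x, frame i a x⟩ : TangentBundle (𝓡 4) X)) (U i)
  frame_orthonormal : ∀ i, ∀ x ∈ U i, ∀ a b,
    g.inner x (frame i a x) (frame i b x) = if a = b then 1 else 0
  /-- the transition functions -/
  A : ι → ι → X → Matrix.specialUnitaryGroup (Fin 2) ℂ
  B : ι → ι → X → Matrix.specialUnitaryGroup (Fin 2) ℂ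
  A_smooth : ∀ i j r s, ContMDiffOn (𝓡 4) 𝓘(ℝ, ℂ) ∞
    (fun x => (A i j x : Matrix (Fin 2) (Fin 2) ℂ) r s) (U i ∩ U j)
  B_smooth : ∀ i j r s, ContMDiffOn (𝓡 4) 𝓘(ℝ, ℂ) ∞
    (fun x => (B i j x : Matrix (Fin 2) (Fin 2) ℂ) r s) (U i ∩ U j)
  A_cocycle : ∀ i j k, ∀ x ∈ U i ∩ U j ∩ U k, A j k x * A i j x = A i k x
  B_cocycle : ∀ i j k, ∀ x ∈ U i ∩ U j ∩ U k, B j k x * B i j x = B i k x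
  compat : ∀ i j, ∀ x ∈ U i ∩ U j, ∀ v : TangentSpace (𝓡 4) x,
    toM (fun a => g.inner x (frame j a x) v) =
      (A i j x : Matrix (Fin 2) (Fin 2) ℂ) * toM (fun a => g.inner x (frame i a x) v) *
        ((B i j x : Matrix (Fin 2) (Fin 2) ℂ))⁻¹

namespace SpinStructure

variable {g : Metric4 X} (S : SpinStructure g)

/-! #### Levi-Civita connection and curvature in the local frames

All indices refer to one of the orthonormal frames `e a = S.frame i a`. -/

/-- `C_{ab}^c = g([e_a, e_b], e_c)`. -/
def bracketCoeff (i : S.ι) (a b c : Fin 4) (x : X) : ℝ :=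
  g.inner x (VectorField.mlieBracket (𝓡 4) (S.frame i a) (S.frame i b) x) (S.frame i c x)

/-- The Levi-Civita connection: `Γ_{da}^c = g(∇_{e_d} e_a, e_c)`, by the Koszul formula. -/
def leviCivita (i : S.ι) (d a c : Fin 4) (x : X) : ℝ :=
  (1 / 2) * (S.bracketCoeff i d a c x - S.bracketCoeff i a c d x + S.bracketCoeff i c d a x)

/-- The derivative of a function in the direction of `e_a`. -/
def frameDeriv (i : S.ι) (a : Fin 4) (f : X → ℝ) (x : X) : ℝ :=
  (mfderiv (𝓡 4) 𝓘(ℝ, ℝ) f x : TangentSpace (𝓡 4) x →L[ℝ] ℝ) (S.frame i a x)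

/-- The curvature tensor `R_{abcd} = g(R(e_a, e_b) e_d, e_c)`, with
`R(V, W) = ∇_V ∇_W - ∇_W ∇_V - ∇_{[V, W]}`. -/
def riemann (i : S.ι) (a b c d : Fin 4) (x : X) : ℝ :=
  S.frameDeriv i a (S.leviCivita i b d c) x - S.frameDeriv i b (S.leviCivita i a d c) x
    + ∑ e, (S.leviCivita i a e c x * S.leviCivita i b d e x
      - S.leviCivita i b e c x * S.leviCivita i a d e x
      - S.bracketCoeff i a b e x * S.leviCivita i e d c x)

/-- The Ricci tensor `R_{ab} = R_{ca}^c_b`. -/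
def ricci (i : S.ι) (a b : Fin 4) (x : X) : ℝ := ∑ c, S.riemann i c a c b x

/-- The scalar curvature. -/
def scalar (i : S.ι) (x : X) : ℝ := ∑ a, S.ricci i a a x

/-- `P_{ab} = R_{ab} / 2 - R g_{ab} / 12`. -/
def schouten (i : S.ι) (a b : Fin 4) (x : X) : ℝ :=
  S.ricci i a b x / 2 - S.scalar i x / 12 * (if a = b then 1 else 0)

/-- The Weyl tensor `W_{abcd} = R_{abcd} - 2 P_{c[a} g_{b]d} + 2 P_{d[a} g_{b]c}`. -/
def weyl (i : S.ι) (a b c d : Fin 4) (x : X) : ℝ :=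
  S.riemann i a b c d x
    - (S.schouten i c a x * (if b = d then 1 else 0)
      - S.schouten i c b x * (if a = d then 1 else 0))
    + (S.schouten i d a x * (if b = c then 1 else 0)
      - S.schouten i d b x * (if a = c then 1 else 0))

/-- `g` is Einstein: the trace free part of the Ricci tensor vanishes. -/
def IsEinstein : Prop :=
  ∀ i, ∀ x ∈ S.U i, ∀ a b, S.ricci i a b x = S.scalar i x / 4 * (if a = b then 1 else 0)

/-- `g` is anti self-dual: `(1/2) e_{cd}^{pq} W_{abpq} = - W_{abcd}`, that is `W⁺ = 0`. -/
def IsAntiSelfDual : Prop :=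
  ∀ i, ∀ x ∈ S.U i, ∀ a b c d,
    (1 / 2) * ∑ p, ∑ q, volM c d p q * S.weyl i a b p q x = - S.weyl i a b c d x

/-- `Λ = R / 24`. -/
def Lam (x : X) : ℝ := S.scalar (S.indexAt x) x / 24

/-! #### The bundle `𝕊'` -/

/-- The vector bundle `𝕊'` with fibre `ℂ²` for the representation `η ↦ ᵗB⁻¹ η = B̄ η`. -/
def core : VectorBundleCore ℝ X (Fin 2 → ℂ) S.ι where
  baseSet := S.U
  isOpen_baseSet := S.isOpen_U
  indexAt := S.indexAt
  mem_baseSet_at := S.mem_U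
  coordChange i j x := conjActionL (S.B i j x : Matrix (Fin 2) (Fin 2) ℂ)
  coordChange_self := by
    intro i x hx v
    have h : S.B i i x = 1 := by
      have := S.B_cocycle i i i x ⟨⟨hx, hx⟩, hx⟩
      simpa using this
    rw [h, conjActionL_apply]
    simp [Matrix.map_one]
  continuousOn_coordChange := by
    intro i j
    refine conjActionL.continuous.comp_continuousOn ?_
    refine continuousOn_pi.2 fun r => continuousOn_pi.2 fun s => ?_
    exact (S.B_smooth i j r s).continuousOn
  coordChange_comp := by
    intro i j k x hx v
    rw [← S.B_cocycle i j k x hx]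
    simp only [conjActionL_apply, Matrix.mulVec_mulVec, Submonoid.coe_mul]
    congr 1
    ext r s
    simp [Matrix.mul_apply]

/-- The total space of `𝕊'`. -/
abbrev Total : Type _ := Bundle.TotalSpace (Fin 2 → ℂ) S.core.Fiber

/-- The model with corners of the total space, of real dimension 8. -/
abbrev modelTotal :
    ModelWithCorners ℝ (EuclideanSpace ℝ (Fin 4) × (Fin 2 → ℂ))
      (ModelProd (EuclideanSpace ℝ (Fin 4)) (Fin 2 → ℂ)) :=
  (𝓡 4).prod 𝓘(ℝ, Fin 2 → ℂ)

instance : S.core.IsContMDiff (𝓡 4) ∞ where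
  contMDiffOn_coordChange i j := by
    have h : ContMDiffOn (𝓡 4) 𝓘(ℝ, Fin 2 → Fin 2 → ℂ) ∞
        (fun x => fun r s => (S.B i j x : Matrix (Fin 2) (Fin 2) ℂ) r s) (S.U i ∩ S.U j) :=
      contMDiffOn_pi_space.2 fun r => contMDiffOn_pi_space.2 fun s => S.B_smooth i j r s
    exact conjActionL.contMDiff.comp_contMDiffOn h

/-- The fibre coordinates `π^{A'}` with respect to the spin frame `i`. -/
def fiberCoord (i : S.ι) (p : S.Total) : Fin 2 → ℂ := (S.core.localTriv i p).2

/-- The fibre coordinates of `p` in the preferred spin frame at its base point. -/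
def spinor (p : S.Total) : Fin 2 → ℂ := S.fiberCoord (S.indexAt p.proj) p

/-- The connection on `𝕊'` induced by the Levi-Civita connection, in the spin frame `i` and in the
direction `e_d`: the matrix `Γ_{dB'}^{A'}`, row index `A'`. If the Levi-Civita connection matrix
`(w^c_a)` acts on `𝕄` as `Y ↦ a Y - Y b` with `(a, b)` in the Lie algebra of `SU(2) × SU(2)`, then
this is the matrix `-ᵗb`. -/
def spinConn (i : S.ι) (d : Fin 4) (x : X) : Matrix (Fin 2) (Fin 2) ℂ :=
  spinLift (Matrix.of fun c a => S.leviCivita i d a c x)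

/-- The differential of the projection `𝕊' → X`. -/
def dProj (p : S.Total) : TangentSpace modelTotal p →L[ℝ] TangentSpace (𝓡 4) p.proj :=
  mfderiv modelTotal (𝓡 4) (fun q : S.Total => q.proj) p

/-- The differentials `dπ^{A'}` of the fibre coordinates in the preferred frame at `p`. -/
def dFiber (p : S.Total) : TangentSpace modelTotal p →L[ℝ] (Fin 2 → ℂ) :=
  mfderiv modelTotal 𝓘(ℝ, Fin 2 → ℂ) (S.fiberCoord (S.indexAt p.proj)) p

/-- The vertical part `δπ^{A'} = dπ^{A'} + Γ_{cB'}^{A'} π^{B'} θ^c` of a tangent vector. -/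
def deltaPi (p : S.Total) : TangentSpace modelTotal p →L[ℝ] (Fin 2 → ℂ) :=
  S.dFiber p + ∑ c, ((g.inner p.proj (S.frame (S.indexAt p.proj) c p.proj)).comp
    (S.dProj p)).smulRight (S.spinConn (S.indexAt p.proj) c p.proj *ᵥ S.spinor p)

/-- The decomposition `T_π 𝕊' ≅ T_x X ⊕ 𝕊'_x` into the horizontal and the vertical part. -/
def split (p : S.Total) :
    TangentSpace modelTotal p →L[ℝ] TangentSpace (𝓡 4) p.proj × (Fin 2 → ℂ) :=
  (S.dProj p).prod (S.deltaPi p)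

/-- The decomposition is an isomorphism. -/
theorem split_isInvertible (p : S.Total) : (S.split p).IsInvertible := by
  have hp : p ∈ (S.core.localTriv (S.indexAt p.proj)).source := by
    rw [S.core.mem_localTriv_source]
    exact S.mem_U _
  have : MemTrivializationAtlas (S.core.localTriv (S.indexAt p.proj)) := ⟨Set.mem_range_self _⟩
  have he := Bundle.Trivialization.mdifferentiable (I := 𝓡 4) S.core.Fiber
    (S.core.localTriv (S.indexAt p.proj))
  have hfun : (fun q : S.Total => (q.proj, S.fiberCoord (S.indexAt p.proj) q)) =ᶠ[nhds p]
      (S.core.localTriv (S.indexAt p.proj)).toOpenPartialHomeomorph := by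
    filter_upwards [(S.core.localTriv (S.indexAt p.proj)).open_source.mem_nhds hp] with q hq
    exact (S.core.localTriv (S.indexAt p.proj)).mk_proj_snd hq
  have h1 : MDifferentiableAt modelTotal (𝓡 4) (fun q : S.Total => q.proj) p :=
    ((Bundle.contMDiff_proj (n := 1) (IB := 𝓡 4) S.core.Fiber) p).mdifferentiableAt one_ne_zero
  have h2 : MDifferentiableAt modelTotal 𝓘(ℝ, Fin 2 → ℂ)
      (S.fiberCoord (S.indexAt p.proj)) p :=
    (mdifferentiableAt_snd (I := 𝓡 4) (I' := 𝓘(ℝ, Fin 2 → ℂ))).comp p (he.mdifferentiableAt hp)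
  have hprod := mfderiv_prodMk h1 h2
  have hinv : ((S.dProj p).prod (S.dFiber p)).IsInvertible :=
    ⟨he.mfderiv hp, (hfun.mfderiv_eq.symm.trans hprod : _)⟩
  have hsplit : S.split p = ((ContinuousLinearEquiv.skewProd
      (ContinuousLinearEquiv.refl ℝ (TangentSpace (𝓡 4) p.proj))
      (ContinuousLinearEquiv.refl ℝ (Fin 2 → ℂ))
      (∑ c, (g.inner p.proj (S.frame (S.indexAt p.proj) c p.proj)).smulRight
        (S.spinConn (S.indexAt p.proj) c p.proj *ᵥ S.spinor p)) :
        (TangentSpace (𝓡 4) p.proj × (Fin 2 → ℂ)) ≃L[ℝ] _) :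
        TangentSpace (𝓡 4) p.proj × (Fin 2 → ℂ) →L[ℝ] _).comp
      ((S.dProj p).prod (S.dFiber p)) := by
    refine ContinuousLinearMap.ext fun v => ?_
    simp [split, deltaPi]
  rw [hsplit]
  exact (ContinuousLinearMap.isInvertible_equiv).comp hinv

/-- The endomorphism `v^{AA'} ↦ v^{AB'} K_{B'}^{A'}` of `T_x X`. The components are real for those
`K` which are used below. -/
def baseEnd (i : S.ι) (x : X) (K : Matrix (Fin 2) (Fin 2) ℂ) :
    TangentSpace (𝓡 4) x →L[ℝ] TangentSpace (𝓡 4) x :=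
  ∑ a, ∑ b, (coordM (basisM b * K) a).re • (g.inner x (S.frame i b x)).smulRight (S.frame i a x)

/-- The almost complex structure `𝕀 = I_π ⊕ i` on the complement of the zero section. -/
def complexI : EndoField (modelTotal) S.Total := fun p =>
  (S.split p).inverse.comp
    (((S.baseEnd (S.indexAt p.proj) p.proj (matI (S.spinor p))).prodMap
      (Complex.I • ContinuousLinearMap.id ℝ (Fin 2 → ℂ))).comp (S.split p))

/-- The almost complex structure `𝕁 = J_π ⊕ σ` on the complement of the zero section. -/
def complexJ : EndoField (modelTotal) S.Total := fun p =>
  (S.split p).inverse.comp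
    (((S.baseEnd (S.indexAt p.proj) p.proj (matJ (S.spinor p))).prodMap sigmaL).comp (S.split p))

/-- The function `‖π‖²` on `𝕊'`. -/
def normSq (p : S.Total) : ℂ := spinorNormSq (S.spinor p)

/-- The 1-form `τ̃ = ε_{A'B'} π^{A'} δπ^{B'}`. -/
def tau : DiffForm (modelTotal) S.Total 1 := fun p =>
  ContinuousAlternatingMap.ofSubsingleton ℝ (TangentSpace modelTotal p) ℂ (0 : Fin 1)
    ((epsL (S.spinor p)).comp (S.deltaPi p))

/-- The 2-form `ω̃ = d τ̃`. -/
def omega : DiffForm (modelTotal) S.Total 2 := extD S.tau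

/-- The 2-form `ω̃_𝕁(V, W) = (-i / 2) (ω̃(V, 𝕁 W) - ω̃(W, 𝕁 V))`. -/
def omegaJ : DiffForm (modelTotal) S.Total 2 := twist S.complexJ S.omega

end SpinStructure

end SpinorPotential

end

/-!
# The potential `‖π‖²` of the twisted form `ω̃_𝕁`

Write `ζ = δπ` for the vertical part of a tangent vector of `𝕊'`, and `X ∈ 𝕄` for its horizontal
part. Both sides of the identity are exterior derivatives of forms `m(π, δπ)`, where `m` is a real
bilinear form on `ℂ²` which is invariant under `SU(2)`: `τ̃` belongs to the skew form `ε`, and, as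
the connection of `𝕊'` is Hermitian and `δπ` is of type `(1, 0)`, the form `∂̄‖π‖²` belongs to the
Hermitian form `h(ξ, η) = ε(ση, ξ)` (`dbar_normSq`). For every such `m`
`d (m(π, δπ)) (V, W) = m(ζ_V, ζ_W) - m(ζ_W, ζ_V) + m(π, F(V, W) π)` with the curvature `F` of `𝕊'`
(`extDeriv_connForm`, `extD_pairForm`).

The hypotheses on the metric enter through `F`. The Riemann tensor of an anti self-dual Einstein
metric is the sum of an anti self-dual Weyl tensor, which acts trivially on `𝕊'`, and of a multiple
of `g ∧ g`; hence `F(V, W) = Λ (Xᵗ Ȳ - Yᵗ X̄)` (`spinLift_riemann`, `curvature_connIn`). After this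
the theorem is pointwise algebra. Replacing `W` by `𝕁W` replaces `ζ_W` by `σ ζ_W` and `Y` by
`Y J_π`; on the vertical parts this turns `ε` into `h` directly, and on the curvature part by an
identity between quaternions (`eps_wedgeSD_matJ`). This gives `ω̃_𝕁 = i d∂̄‖π‖²` (`omegaJ_eq`).
A similar identity for `I_π` (`eps_wedgeSD_matI`) shows that `d∂̄‖π‖²` is already of type `(1, 1)`.
So `ω̃_𝕁` is `i` times an exact form, which gives smoothness and closedness.

Most of the work is to compute with the exterior derivative, which is defined in the preferred
charts. The connection is read in these charts in one spin frame, where the structure equations are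
identities between derivatives on `ℝ⁴` (`curvature_connIn_frameIn`). As `δπ` at a point refers to
the preferred frame at that point, its independence of the frame is needed (`deltaPiAt_change`). It
rests on the transformation of the Levi-Civita connection under a change of frame, lifted along
`SU(2) × SU(2) → SO(4)` (`leviCivita_change`, `spinConn_change`).
-/

noncomputable section

namespace SpinorPotential

/-! ### Algebra of the lift of `so(4)` to spinors -/

theorem star_sqrt_two_inv : (starRingEnd ℂ) ((Real.sqrt 2 : ℂ)⁻¹) = (Real.sqrt 2 : ℂ)⁻¹ := by
  rw [map_inv₀, Complex.conj_ofReal]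

theorem spinLift_add (v w : Matrix (Fin 4) (Fin 4) ℝ) :
    spinLift (v + w) = spinLift v + spinLift w := by
  simp only [spinLift, Matrix.add_apply, Complex.ofReal_add, add_smul, Finset.sum_add_distrib,
    smul_add]

theorem spinLift_smul (r : ℝ) (w : Matrix (Fin 4) (Fin 4) ℝ) :
    spinLift (r • w) = r • spinLift w := by
  have h : ∀ M : Matrix (Fin 2) (Fin 2) ℂ, r • M = (r : ℂ) • M := fun M => by
    ext i j; simp
  rw [h]
  simp only [spinLift, Matrix.smul_apply, smul_eq_mul, Complex.ofReal_mul, mul_smul,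
    Finset.smul_sum, smul_comm (r : ℂ) (1 / 2 : ℂ)]

/-- `spinLift` as a real linear map. -/
def spinLiftL : Matrix (Fin 4) (Fin 4) ℝ →ₗ[ℝ] Matrix (Fin 2) (Fin 2) ℂ where
  toFun := spinLift
  map_add' := spinLift_add
  map_smul' := spinLift_smul

@[simp] theorem spinLiftL_apply (w : Matrix (Fin 4) (Fin 4) ℝ) : spinLiftL w = spinLift w := rfl

theorem spinLift_of_skew (w : Matrix (Fin 4) (Fin 4) ℝ) (hskew : ∀ i j, w j i = -w i j) :
    spinLift w = !![
      (((w 3 0 - w 2 1) / 2 : ℝ) : ℂ) * Complex.I,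
      (((w 3 2 - w 1 0) / 2 : ℝ) : ℂ) + (((w 2 0 + w 3 1) / 2 : ℝ) : ℂ) * Complex.I;
      (((w 1 0 - w 3 2) / 2 : ℝ) : ℂ) + (((w 2 0 + w 3 1) / 2 : ℝ) : ℂ) * Complex.I,
      -(((w 3 0 - w 2 1) / 2 : ℝ) : ℂ) * Complex.I] := by
  have hs := sqrt_two_inv_mul_self
  have hd : ∀ i, w i i = 0 := fun i => by linarith [hskew i i]
  have hconj := star_sqrt_two_inv
  unfold spinLift basisM
  generalize hsq : ((Real.sqrt 2 : ℂ)⁻¹) = s at hs hconj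
  ext r t
  fin_cases r <;> fin_cases t <;>
    simp [Fin.sum_univ_four, Matrix.mul_apply, Fin.sum_univ_two, hd, hskew 1 0, hskew 2 0,
      hskew 3 0, hskew 2 1, hskew 3 1, hskew 3 2, hconj]
  all_goals ring_nf
  all_goals simp only [pow_two, hs, Complex.I_mul_I]
  all_goals ring_nf

/-- `spinLift` is a homomorphism of Lie algebras. -/
theorem spinLift_commutator (v w : Matrix (Fin 4) (Fin 4) ℝ) (hv : ∀ i j, v j i = -v i j)
    (hw : ∀ i j, w j i = -w i j) :
    spinLift (v * w - w * v) = spinLift v * spinLift w - spinLift w * spinLift v := by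
  have hvw : ∀ i j, (v * w - w * v) j i = -(v * w - w * v) i j := by
    intro i j
    simp only [Matrix.sub_apply, Matrix.mul_apply, ← Finset.sum_sub_distrib,
      ← Finset.sum_neg_distrib]
    refine Finset.sum_congr rfl fun k _ => ?_
    rw [hv k j, hv i k, hw k i, hw j k]
    ring
  rw [spinLift_of_skew _ hvw, spinLift_of_skew _ hv, spinLift_of_skew _ hw]
  have hd : ∀ i, v i i = 0 := fun i => by linarith [hv i i]
  have hd' : ∀ i, w i i = 0 := fun i => by linarith [hw i i]
  ext r t
  fin_cases r <;> fin_cases t <;>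
    simp [Fin.sum_univ_four, Matrix.mul_apply, hd, hd', hv 1 0, hv 2 0, hv 2 1, hv 3 1,
      hv 3 2, hw 1 0, hw 2 0, hw 2 1, hw 3 1, hw 3 2]
  all_goals ring_nf
  all_goals simp only [Complex.I_sq]
  all_goals ring_nf

/-- `volM` takes values in `ℤ`, where determinants can be evaluated. -/
theorem volM_eq (a b c d : Fin 4) : volM a b c d =
    (Matrix.det (Matrix.of fun r s : Fin 4 =>
      if (![a, b, c, d] : Fin 4 → Fin 4) r = (![1, 2, 3, 0] : Fin 4 → Fin 4) s then (1 : ℤ)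
      else 0) : ℤ) := by
  rw [volM, Int.cast_det]
  congr 1
  ext i j
  simp

/-- `spinLift` annihilates the anti self-dual matrices: its entries are the components
`w₃₀ - w₂₁`, `w₃₂ - w₁₀` and `w₂₀ + w₃₁` of the self dual part. -/
theorem spinLift_eq_zero_of_antiSelfDual (w : Matrix (Fin 4) (Fin 4) ℝ)
    (h : ∀ c d, (1 / 2) * ∑ p, ∑ q, volM c d p q * w p q = - w c d) : spinLift w = 0 := by
  -- the symbols `volM` are evaluated over `ℤ`
  have hvol : ∀ c d p q, volM d c p q = - volM c d p q := by
    intro c d p q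
    rw [volM_eq, volM_eq, ← Int.cast_neg]
    congr 1
    revert c d p q
    decide +kernel
  have hskew : ∀ i j, w j i = -w i j := by
    intro i j
    have h1 := h i j
    have h2 := h j i
    simp only [hvol i j, neg_mul, Finset.sum_neg_distrib] at h2
    linarith
  have hd : ∀ i, w i i = 0 := fun i => by linarith [hskew i i]
  have h30 := h 3 0
  have h32 := h 3 2
  have h20 := h 2 0
  have e : ∀ c d p q : Fin 4, ∀ z : ℤ, (Matrix.det (Matrix.of fun r s : Fin 4 =>
      if (![c, d, p, q] : Fin 4 → Fin 4) r = (![1, 2, 3, 0] : Fin 4 → Fin 4) s then (1 : ℤ)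
      else 0)) = z → volM c d p q = z := fun c d p q z hz => by rw [volM_eq, hz]
  simp only [Fin.sum_univ_four] at h30 h32 h20
  simp only [hd] at h30 h32 h20
  rw [e 3 0 0 1 0 (by decide +kernel), e 3 0 0 2 0 (by decide +kernel),
    e 3 0 0 3 0 (by decide +kernel), e 3 0 1 0 0 (by decide +kernel),
    e 3 0 1 2 1 (by decide +kernel), e 3 0 1 3 0 (by decide +kernel),
    e 3 0 2 0 0 (by decide +kernel), e 3 0 2 1 (-1) (by decide +kernel),
    e 3 0 2 3 0 (by decide +kernel), e 3 0 3 0 0 (by decide +kernel),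
    e 3 0 3 1 0 (by decide +kernel), e 3 0 3 2 0 (by decide +kernel),
    hskew 1 2] at h30
  rw [e 3 2 0 1 1 (by decide +kernel), e 3 2 0 2 0 (by decide +kernel),
    e 3 2 0 3 0 (by decide +kernel), e 3 2 1 0 (-1) (by decide +kernel),
    e 3 2 1 2 0 (by decide +kernel), e 3 2 1 3 0 (by decide +kernel),
    e 3 2 2 0 0 (by decide +kernel), e 3 2 2 1 0 (by decide +kernel),
    e 3 2 2 3 0 (by decide +kernel), e 3 2 3 0 0 (by decide +kernel),
    e 3 2 3 1 0 (by decide +kernel), e 3 2 3 2 0 (by decide +kernel),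
    hskew 1 0] at h32
  rw [e 2 0 0 1 0 (by decide +kernel), e 2 0 0 2 0 (by decide +kernel),
    e 2 0 0 3 0 (by decide +kernel), e 2 0 1 0 0 (by decide +kernel),
    e 2 0 1 2 0 (by decide +kernel), e 2 0 1 3 (-1) (by decide +kernel),
    e 2 0 2 0 0 (by decide +kernel), e 2 0 2 1 0 (by decide +kernel),
    e 2 0 2 3 0 (by decide +kernel), e 2 0 3 0 0 (by decide +kernel),
    e 2 0 3 1 1 (by decide +kernel), e 2 0 3 2 0 (by decide +kernel),
    hskew 3 1] at h20
  norm_num at h30 h32 h20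
  have e1 : w 3 0 - w 2 1 = 0 := by linarith [hskew 2 1]
  have e2 : w 3 2 - w 1 0 = 0 := by linarith [hskew 1 0]
  have e3 : w 2 0 + w 3 1 = 0 := by linarith [hskew 1 3]
  have e2' : w 1 0 - w 3 2 = 0 := by linarith
  rw [spinLift_of_skew _ hskew, e1, e2, e3, e2']
  ext i j
  fin_cases i <;> fin_cases j <;> simp

/-- `∑ₖ bₖᵗ Y b̄ₖ = tr Y` for the basis `b = basisM`. -/
theorem sum_basisM_transpose_mul (Y : Matrix (Fin 2) (Fin 2) ℂ) :
    ∑ k, (basisM k)ᵀ * Y * (basisM k).map star = Y.trace • (1 : Matrix (Fin 2) (Fin 2) ℂ) := by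
  have hs := sqrt_two_inv_mul_self
  have hconj := star_sqrt_two_inv
  unfold basisM
  generalize hsq : ((Real.sqrt 2 : ℂ)⁻¹) = s at hs hconj
  ext r t
  fin_cases r <;> fin_cases t <;>
    simp [Fin.sum_univ_four, Matrix.mul_apply, Fin.sum_univ_two, hconj, Matrix.trace_fin_two]
  all_goals ring_nf
  all_goals simp only [pow_two, hs, Complex.I_mul_I]
  all_goals ring_nf

theorem toM_smul (r : ℝ) (x : Fin 4 → ℝ) : toM (r • x) = (r : ℂ) • toM x := by
  simp [toM, mul_smul, Finset.smul_sum]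

/-- The lift of `x ⊗ y`. -/
theorem spinLift_vecMulVec (x y : Fin 4 → ℝ) :
    spinLift (Matrix.vecMulVec x y) = (1 / 2 : ℂ) • ((toM x)ᵀ * (toM y).map star) := by
  have hy : (toM y).map star = ∑ a, (y a : ℂ) • (basisM a).map star := by
    ext i j
    simp [toM, Fin.sum_univ_four]
  rw [spinLift, hy, toM]
  congr 1
  simp only [Matrix.transpose_sum, Finset.sum_mul, Finset.mul_sum, Matrix.transpose_smul,
    Matrix.vecMulVec_apply, Complex.ofReal_mul, Matrix.smul_mul, Matrix.mul_smul]
  simp only [mul_smul]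
  exact Finset.sum_congr rfl fun a _ => Finset.sum_congr rfl fun c _ => smul_comm _ _ _

theorem spinLift_sum_vecMulVec {ι : Type*} (s : Finset ι) (x y : ι → Fin 4 → ℝ) :
    spinLift (∑ k ∈ s, Matrix.vecMulVec (x k) (y k)) =
      (1 / 2 : ℂ) • ∑ k ∈ s, ((toM (x k))ᵀ * (toM (y k)).map star) := by
  rw [← spinLiftL_apply, map_sum, Finset.smul_sum]
  exact Finset.sum_congr rfl fun k _ => spinLift_vecMulVec _ _

theorem toM_single (k : Fin 4) : toM (Pi.single k 1) = basisM k := by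
  rw [toM, Finset.sum_eq_single k]
  · simp
  · intro b _ hb; simp [hb]
  · simp

theorem toM_col {L : Matrix (Fin 4) (Fin 4) ℝ} (k : Fin 4) :
    toM (fun c => L c k) = toM (L *ᵥ Pi.single k 1) := by
  rw [Matrix.mulVec_single_one]; rfl

theorem map_star_mul (M N : Matrix (Fin 2) (Fin 2) ℂ) :
    (M * N).map star = M.map star * N.map star := by
  ext i j; simp [Matrix.mul_apply]

/-- The lift of `so(4)` is equivariant: if `L` is the rotation covered by `(A, B)`, then
`spinLift (L w Lᵗ) = B̄ (spinLift w) Bᵗ`. -/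
theorem spinLift_conj {L : Matrix (Fin 4) (Fin 4) ℝ} {A B : Matrix (Fin 2) (Fin 2) ℂ}
    (hA : Aᴴ * A = 1) (hL : ∀ u, toM (L *ᵥ u) = A * toM u * Bᴴ) (w : Matrix (Fin 4) (Fin 4) ℝ) :
    spinLift (L * w * Lᵀ) = B.map star * spinLift w * Bᵀ := by
  have hA' : Aᵀ * A.map star = 1 := by
    have := congrArg Matrix.transpose hA
    rwa [Matrix.transpose_mul, Matrix.transpose_one, Matrix.conjTranspose, ← Matrix.transpose_map,
      Matrix.transpose_transpose] at this
  have hw : L * w * Lᵀ = ∑ kl : Fin 4 × Fin 4,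
      Matrix.vecMulVec (w kl.1 kl.2 • fun c => L c kl.1) (fun c => L c kl.2) := by
    ext c a
    simp only [Matrix.mul_apply, Matrix.transpose_apply, Matrix.sum_apply, Matrix.vecMulVec_apply,
      Fintype.sum_prod_type, Pi.smul_apply, smul_eq_mul, Finset.sum_mul]
    rw [Finset.sum_comm]
    refine Finset.sum_congr rfl fun k _ => Finset.sum_congr rfl fun l _ => ?_
    ring
  have hstar : (Bᴴ).map star = Bᵀ := by ext i j; simp
  have hstar' : (Bᴴ)ᵀ = B.map star := by ext i j; simp
  rw [hw, spinLift_sum_vecMulVec]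
  simp only [toM_smul, toM_col, hL, toM_single, map_star_mul, Matrix.transpose_mul, hstar, hstar',
    Matrix.transpose_smul, Matrix.smul_mul]
  have : ∀ k l, B.map star * ((basisM k)ᵀ * Aᵀ) * (A.map star * (basisM l).map star * Bᵀ) =
      B.map star * ((basisM k)ᵀ * (basisM l).map star) * Bᵀ := by
    intro k l
    calc _ = B.map star * ((basisM k)ᵀ * (Aᵀ * A.map star) * (basisM l).map star) * Bᵀ := by
          simp only [Matrix.mul_assoc]
      _ = _ := by rw [hA', Matrix.mul_one]
  simp only [this]
  rw [spinLift, Matrix.mul_smul, Matrix.smul_mul, Matrix.mul_sum, Finset.sum_mul,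
    Fintype.sum_prod_type, Finset.sum_comm]
  congr 1
  refine Finset.sum_congr rfl fun a _ => ?_
  rw [Matrix.mul_sum, Finset.sum_mul]
  refine Finset.sum_congr rfl fun c _ => ?_
  rw [Matrix.mul_smul, Matrix.smul_mul]

/-- The lift of the logarithmic derivative `L' Lᵗ` of a curve of rotations covered by a curve of
pairs `(A, B)` in `SU(2) × SU(2)` is `B̄' Bᵗ`; the factor `A` drops out because `A⁻¹ A'` has
trace zero. -/
theorem spinLift_deriv {L dL : Matrix (Fin 4) (Fin 4) ℝ} {A B dA dB : Matrix (Fin 2) (Fin 2) ℂ}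
    (hA : Aᴴ * A = 1) (hL : ∀ u, toM (L *ᵥ u) = A * toM u * Bᴴ)
    (hdL : ∀ u, toM (dL *ᵥ u) = dA * toM u * Bᴴ + A * toM u * dBᴴ)
    (hdA : (dAᵀ * A.map star).trace = 0) :
    spinLift (dL * Lᵀ) = dB.map star * Bᵀ := by
  have hA' : Aᵀ * A.map star = 1 := by
    have := congrArg Matrix.transpose hA
    rwa [Matrix.transpose_mul, Matrix.transpose_one, Matrix.conjTranspose, ← Matrix.transpose_map,
      Matrix.transpose_transpose] at this
  have hw : dL * Lᵀ = ∑ k, Matrix.vecMulVec (fun c => dL c k) (fun c => L c k) := by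
    ext c a
    simp only [Matrix.mul_apply, Matrix.transpose_apply, Matrix.sum_apply, Matrix.vecMulVec_apply]
  have hstar : (Bᴴ).map star = Bᵀ := by ext i j; simp
  have hstar' : ∀ B : Matrix (Fin 2) (Fin 2) ℂ, (Bᴴ)ᵀ = B.map star := fun B => by ext i j; simp
  rw [hw, spinLift_sum_vecMulVec]
  simp only [toM_col, hL, hdL, toM_single, map_star_mul, Matrix.transpose_mul, hstar, hstar',
    Matrix.transpose_add, Matrix.add_mul]
  have h1 : ∀ k, B.map star * ((basisM k)ᵀ * dAᵀ) * (A.map star * (basisM k).map star * Bᵀ) =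
      B.map star * ((basisM k)ᵀ * (dAᵀ * A.map star) * (basisM k).map star) * Bᵀ := by
    intro k
    simp only [Matrix.mul_assoc]
  have h2 : ∀ k, dB.map star * ((basisM k)ᵀ * Aᵀ) * (A.map star * (basisM k).map star * Bᵀ) =
      dB.map star * ((basisM k)ᵀ * 1 * (basisM k).map star) * Bᵀ := by
    intro k
    rw [← hA']
    simp only [Matrix.mul_assoc]
  simp only [h1, h2]
  rw [Finset.sum_add_distrib, ← Finset.sum_mul, ← Finset.sum_mul, ← Matrix.mul_sum,
    ← Matrix.mul_sum, sum_basisM_transpose_mul, sum_basisM_transpose_mul, hdA]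
  simp [smul_smul]

/-! ### The identities between the quaternionic structures -/

/-- `Xᵗ Ȳ - Yᵗ X̄`, the matrix on `𝕊'` of the self dual part of `X ∧ Y`, for `X, Y ∈ 𝕄`. -/
def wedgeSD (X Y : Matrix (Fin 2) (Fin 2) ℂ) : Matrix (Fin 2) (Fin 2) ℂ :=
  Xᵀ * Y.map star - Yᵀ * X.map star

theorem toM_quaternion (x : Fin 4 → ℝ) :
    toM x = !![toM x 0 0, toM x 0 1; -star (toM x 0 1), star (toM x 0 0)] := by
  have hconj := star_sqrt_two_inv
  unfold toM basisM
  generalize hsq : ((Real.sqrt 2 : ℂ)⁻¹) = s at hconj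
  ext r t
  fin_cases r <;> fin_cases t <;> simp [Fin.sum_univ_four, hconj] <;> ring

theorem spinorNormSq_ne_zero {π : Fin 2 → ℂ} (h : π ≠ 0) : spinorNormSq π ≠ 0 := by
  rw [spinorNormSq_eq]
  norm_cast
  intro h0
  apply h
  have h1 : ‖π 0‖ ^ 2 = 0 := by nlinarith [sq_nonneg ‖π 0‖, sq_nonneg ‖π 1‖]
  have h2 : ‖π 1‖ ^ 2 = 0 := by nlinarith [sq_nonneg ‖π 0‖, sq_nonneg ‖π 1‖]
  ext i
  fin_cases i
  · simpa using h1
  · simpa using h2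

theorem conj_spinorNormSq (π : Fin 2 → ℂ) :
    (starRingEnd ℂ) (spinorNormSq π) = spinorNormSq π := by
  rw [spinorNormSq_eq, Complex.conj_ofReal]

theorem spinorNormSq_eq_star_mul (π : Fin 2 → ℂ) :
    spinorNormSq π = star (π 1) * π 1 + star (π 0) * π 0 := by
  simp [spinorNormSq, eps, sigma]

theorem matI_eq (π : Fin 2 → ℂ) : matI π = (-Complex.I / spinorNormSq π) •
    !![-(π 1 * star (π 1)) + star (π 0) * π 0, 2 * (π 1 * star (π 0));
      2 * (π 0 * star (π 1)), -(π 0 * star (π 0)) + star (π 1) * π 1] := by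
  ext i j
  fin_cases i <;> fin_cases j <;> simp only [matI, lower, sigma] <;> simp <;> left <;> ring

theorem matJ_eq (π : Fin 2 → ℂ) : matJ π = (-1 / spinorNormSq π) •
    !![-π 1 * π 0 + star (π 0) * star (π 1), -π 1 * π 1 - star (π 0) * star (π 0);
      π 0 * π 0 + star (π 1) * star (π 1), π 0 * π 1 - star (π 1) * star (π 0)] := by
  ext i j
  fin_cases i <;> fin_cases j <;> simp only [matJ, lower, sigma] <;> simp <;> left <;> ring

/-- On the self dual forms, twisting `ε(π, · π)` by `J_π` gives `ε(σπ, · π)`. -/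
theorem eps_wedgeSD_matJ (x y : Fin 4 → ℝ) {π : Fin 2 → ℂ} (h : π ≠ 0) :
    eps π (wedgeSD (toM x) (toM y * matJ π) *ᵥ π) - eps π (wedgeSD (toM y) (toM x * matJ π) *ᵥ π)
      = -2 * eps (sigma (wedgeSD (toM x) (toM y) *ᵥ π)) π := by
  have hn := spinorNormSq_ne_zero h
  have hstar := conj_spinorNormSq π
  have hN := spinorNormSq_eq_star_mul π
  rw [toM_quaternion x, toM_quaternion y, matJ_eq]
  generalize spinorNormSq π = n at *
  generalize toM x 0 0 = p1
  generalize toM x 0 1 = q1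
  generalize toM y 0 0 = p2
  generalize toM y 0 1 = q2
  simp only [wedgeSD, Matrix.mulVec, dotProduct, Matrix.mul_apply, Fin.sum_univ_two, eps, sigma,
    Matrix.sub_apply, Matrix.transpose_apply, Matrix.map_apply, Matrix.smul_apply, Matrix.of_apply,
    Matrix.cons_val_zero, Matrix.cons_val_one, smul_eq_mul, star_add, star_sub, star_mul', star_neg,
    RCLike.star_def, hstar, Complex.conj_conj, map_mul, map_add, map_neg, map_sub, map_div₀,
    map_one] at hN ⊢
  field_simp
  rw [hN]
  ring

/-- The form `ε(σπ, · π)` on the self dual forms is of type `(1, 1)` with respect to `I_π`. -/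
theorem eps_wedgeSD_matI (x y : Fin 4 → ℝ) {π : Fin 2 → ℂ} (h : π ≠ 0) :
    eps (sigma (wedgeSD (toM x * matI π) (toM y * matI π) *ᵥ π)) π =
      eps (sigma (wedgeSD (toM x) (toM y) *ᵥ π)) π := by
  have hn := spinorNormSq_ne_zero h
  have hstar := conj_spinorNormSq π
  have hN := spinorNormSq_eq_star_mul π
  rw [toM_quaternion x, toM_quaternion y, matI_eq]
  generalize spinorNormSq π = n at *
  generalize toM x 0 0 = p1
  generalize toM x 0 1 = q1
  generalize toM y 0 0 = p2
  generalize toM y 0 1 = q2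
  simp only [wedgeSD, Matrix.mulVec, dotProduct, Matrix.mul_apply, Fin.sum_univ_two, eps, sigma,
    Matrix.sub_apply, Matrix.transpose_apply, Matrix.map_apply, Matrix.smul_apply, Matrix.of_apply,
    Matrix.cons_val_zero, Matrix.cons_val_one, smul_eq_mul, star_add, star_sub, star_mul', star_neg,
    RCLike.star_def, hstar, Complex.conj_conj, map_mul, map_add, map_neg, map_div₀,
    map_ofNat, Complex.conj_I] at hN ⊢
  field_simp
  simp only [Complex.I_sq]
  rw [hN]
  ring

theorem star_eps_wedgeSD (x y : Fin 4 → ℝ) (π : Fin 2 → ℂ) :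
    star (eps (sigma (wedgeSD (toM x) (toM y) *ᵥ π)) π) =
      - eps (sigma (wedgeSD (toM x) (toM y) *ᵥ π)) π := by
  rw [toM_quaternion x, toM_quaternion y]
  simp [wedgeSD, Matrix.mulVec, dotProduct, Matrix.mul_apply, Fin.sum_univ_two, eps, sigma]
  ring

/-- Right multiplication by a quaternion in the coordinates of `𝕄`. -/
theorem toM_coordM_re (x : Fin 4 → ℝ) (K : Matrix (Fin 2) (Fin 2) ℂ)
    (hK : ∀ a b, (coordM (basisM b * K) a).im = 0) :
    toM (fun a => ∑ b, (coordM (basisM b * K) a).re * x b) = toM x * K := by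
  have hre : ∀ a b, ((coordM (basisM b * K) a).re : ℂ) = coordM (basisM b * K) a := fun a b =>
    Complex.ext rfl (by simp [hK a b])
  have hcoord : ∀ Y : Matrix (Fin 2) (Fin 2) ℂ, ∑ a, coordM Y a • basisM a = Y := by
    intro Y
    have hs := sqrt_two_inv_mul_self
    have hconj := star_sqrt_two_inv
    unfold coordM basisM
    generalize ((Real.sqrt 2 : ℂ)⁻¹) = s at hs hconj
    ext r t
    fin_cases r <;> fin_cases t <;>
      simp [Fin.sum_univ_four, Matrix.mul_apply, Fin.sum_univ_two, hconj, Matrix.trace_fin_two]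
    all_goals ring_nf
    all_goals simp only [pow_two, hs, Complex.I_mul_I]
    all_goals ring_nf
  have : ∀ b, basisM b * K = ∑ a, coordM (basisM b * K) a • basisM a := fun b => (hcoord _).symm
  simp only [toM, Complex.ofReal_sum, Complex.ofReal_mul, hre, Finset.sum_smul, Finset.sum_mul,
    Matrix.smul_mul]
  rw [Finset.sum_comm]
  refine Finset.sum_congr rfl fun b _ => ?_
  conv_rhs => rw [this b]
  rw [Finset.smul_sum]
  refine Finset.sum_congr rfl fun a _ => ?_
  rw [smul_smul, mul_comm]

open Filter Topology

/-! ### Exterior derivatives of forms on a manifold -/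

theorem two_le_infty : (2 : WithTop ℕ∞) ≤ ∞ := ENat.LEInfty.out

theorem extDeriv_ofSubsingleton {E : Type*} [NormedAddCommGroup E] [NormedSpace ℝ E]
    (α : E → E →L[ℝ] ℂ) {z : E} (hα : DifferentiableAt ℝ α z) (v : Fin 2 → E) :
    extDeriv (fun z => ContinuousAlternatingMap.ofSubsingleton ℝ E ℂ (0 : Fin 1) (α z)) z v =
      fderiv ℝ α z (v 0) (v 1) - fderiv ℝ α z (v 1) (v 0) := by
  have hd : DifferentiableAt ℝ
      (fun z => ContinuousAlternatingMap.ofSubsingleton ℝ E ℂ (0 : Fin 1) (α z)) z :=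
    ((ContinuousAlternatingMap.ofSubsingletonLIE (𝕜 := ℝ) (E := E) (F := ℂ)
      (0 : Fin 1)).toContinuousLinearEquiv.differentiable _).comp z hα
  have h : ∀ u w : E, fderiv ℝ (fun z => α z w) z u = fderiv ℝ α z u w := fun u w => by
    rw [fderiv_clm_apply hα (differentiableAt_const _)]
    simp
  rw [extDeriv_apply hd]
  simp [Fin.sum_univ_two, Fin.removeNth, h, sub_eq_add_neg]

section Manifold

variable {E : Type*} [NormedAddCommGroup E] [NormedSpace ℝ E]
  {H : Type*} [TopologicalSpace H] {I : ModelWithCorners ℝ E H} [I.Boundaryless]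
  {M : Type*} [TopologicalSpace M] [ChartedSpace H M] [IsManifold I ∞ M]

theorem mdifferentiableAt_extChartAt_symm {p : M} {y : E} (hy : y ∈ (extChartAt I p).target) :
    MDifferentiableAt 𝓘(ℝ, E) I (extChartAt I p).symm y := by
  have : IsManifold I 1 M := IsManifold.of_le (n := ∞) (by simp)
  have := mdifferentiableWithinAt_extChartAt_symm (I := I) hy
  rwa [I.range_eq_univ, mdifferentiableWithinAt_univ] at this

omit [IsManifold I ∞ M] in
theorem eventually_mem_target (p : M) :
    ∀ᶠ y in 𝓝 (extChartAt I p p), y ∈ (extChartAt I p).target :=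
  extChartAt_target_mem_nhds (I := I) p

omit [IsManifold I ∞ M] in
theorem inChart_congr {k : ℕ} {β β' : DiffForm I M k} {p : M} {y : E}
    (hy : y ∈ (extChartAt I p).target) (h : ∀ᶠ q in 𝓝 ((extChartAt I p).symm y), β q = β' q) :
    inChart β p =ᶠ[𝓝 y] inChart β' p := by
  have hc : ContinuousAt (extChartAt I p).symm y :=
    (continuousOn_extChartAt_symm p).continuousAt
      ((isOpen_extChartAt_target p).mem_nhds hy)
  filter_upwards [hc.eventually h] with z hz
  simp only [inChart, hz]

omit [IsManifold I ∞ M] in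
theorem extD_congr {k : ℕ} {β β' : DiffForm I M k} {p : M} (h : ∀ᶠ q in 𝓝 p, β q = β' q) :
    extD β p = extD β' p := by
  have := inChart_congr (I := I) (y := extChartAt I p p) (mem_extChartAt_target p)
    (by rwa [extChartAt_to_inv])
  rw [extD, extD, this.extDeriv_eq]

omit [IsManifold I ∞ M] in
theorem smoothFormAt_congr {k : ℕ} {β β' : DiffForm I M k} {p : M} (h : ∀ᶠ q in 𝓝 p, β q = β' q)
    (hβ : SmoothFormAt β p) : SmoothFormAt β' p :=
  hβ.congr_of_eventuallyEq (inChart_congr (I := I) (mem_extChartAt_target p)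
    (by rwa [extChartAt_to_inv])).symm

/-- The exterior derivative does not depend on the chart in which it is computed. -/
theorem inChart_extD {k : ℕ} {β : DiffForm I M k} {p q : M}
    (hq : q ∈ (extChartAt I p).source) (hβ : SmoothFormAt β q) :
    inChart (extD β) p (extChartAt I p q) = extDeriv (inChart β p) (extChartAt I p q) := by
  have h1 : IsManifold I 1 M := IsManifold.of_le (n := ∞) (by simp)
  set f : E → E := fun y => extChartAt I q ((extChartAt I p).symm y) with hf
  set y0 := extChartAt I p q with hy0
  have hy0t : y0 ∈ (extChartAt I p).target := (extChartAt I p).map_source hq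
  have hinv : (extChartAt I p).symm y0 = q := (extChartAt I p).left_inv hq
  have hf0 : f y0 = extChartAt I q q := by rw [hf]; simp only [hinv]
  have hc : ContinuousAt (extChartAt I p).symm y0 :=
    (continuousOn_extChartAt_symm p).continuousAt ((isOpen_extChartAt_target p).mem_nhds hy0t)
  have hsmooth : ContDiffAt ℝ ∞ f y0 := by
    have a : ContMDiffAt 𝓘(ℝ, E) I ∞ (extChartAt I p).symm y0 :=
      (contMDiffOn_extChartAt_symm (n := ∞) p).contMDiffAt
        ((isOpen_extChartAt_target p).mem_nhds hy0t)
    have b : ContMDiffAt I 𝓘(ℝ, E) ∞ (extChartAt I q) ((extChartAt I p).symm y0) := by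
      rw [hinv]; exact contMDiffAt_extChartAt
    exact (b.comp y0 a).contDiffAt
  have hsrc : ∀ᶠ y in 𝓝 y0, (extChartAt I p).symm y ∈ (extChartAt I q).source := by
    apply hc.eventually
    rw [hinv]
    exact extChartAt_source_mem_nhds (I := I) q
  -- the transition map relates the two coordinate expressions of the form
  have hpull : inChart β p =ᶠ[𝓝 y0]
      fun y => (inChart β q (f y)).compContinuousLinearMap (fderiv ℝ f y) := by
    filter_upwards [hsrc, (isOpen_extChartAt_target p).mem_nhds hy0t] with y hy hyt
    have hfy : (extChartAt I q).symm (f y) = (extChartAt I p).symm y := (extChartAt I q).left_inv hy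
    have hd1 := mdifferentiableAt_extChartAt_symm (I := I) hyt
    have hd2 : MDifferentiableAt I 𝓘(ℝ, E) (extChartAt I q) ((extChartAt I p).symm y) :=
      mdifferentiableAt_extChartAt (by rwa [extChartAt_source] at hy)
    have hd3 : MDifferentiableAt 𝓘(ℝ, E) I (extChartAt I q).symm (f y) :=
      mdifferentiableAt_extChartAt_symm (I := I) ((extChartAt I q).map_source hy)
    have hcomp : (extChartAt I q).symm ∘ f =ᶠ[𝓝 y] (extChartAt I p).symm := by
      have hcy : ContinuousAt (extChartAt I p).symm y :=
        (continuousOn_extChartAt_symm p).continuousAt ((isOpen_extChartAt_target p).mem_nhds hyt)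
      filter_upwards [hcy.eventually ((isOpen_extChartAt_source q).mem_nhds hy)] with z hz
      exact (extChartAt I q).left_inv hz
    have hchain : mfderiv 𝓘(ℝ, E) I (extChartAt I p).symm y =
        (mfderiv 𝓘(ℝ, E) I (extChartAt I q).symm (f y)).comp (mfderiv 𝓘(ℝ, E) 𝓘(ℝ, E) f y) := by
      rw [← hcomp.mfderiv_eq]
      exact mfderiv_comp y hd3 (hd2.comp y hd1)
    ext v
    simp only [inChart, ContinuousAlternatingMap.compContinuousLinearMap_apply]
    rw [hchain, mfderiv_eq_fderiv]
    -- all tangent spaces are `E`, so that forms at equal points can be compared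
    have key : ∀ (a b : M) (_ : a = b) (w : Fin k → E),
        (β a : (Fin k → E) → ℂ) w = (β b : (Fin k → E) → ℂ) w := by
      rintro a _ rfl w; rfl
    exact key _ _ hfy.symm _
  rw [hpull.extDeriv_eq, extDeriv_pullback (r := 2)
    (by rw [hf0]; exact hβ.differentiableAt (by simp))
    (hsmooth.of_le two_le_infty) (by simp)]
  have hd1 := mdifferentiableAt_extChartAt_symm (I := I) hy0t
  have hd2 : MDifferentiableAt I 𝓘(ℝ, E) (extChartAt I q) ((extChartAt I p).symm y0) :=
    mdifferentiableAt_extChartAt (by rw [hinv]; exact mem_chart_source _ _)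
  have hchain : fderiv ℝ f y0 = (mfderiv I 𝓘(ℝ, E) (extChartAt I q) ((extChartAt I p).symm y0)).comp
      (mfderiv 𝓘(ℝ, E) I (extChartAt I p).symm y0) := by
    rw [← mfderiv_eq_fderiv]
    exact mfderiv_comp y0 hd2 hd1
  rw [hchain, hf0]
  ext v
  simp only [inChart, extD]
  have key : ∀ (a b : M) (_ : a = b) (w : Fin (k + 1) → E),
      (extDeriv (inChart β a) (extChartAt I a a))
        (fun i => (mfderiv I 𝓘(ℝ, E) (extChartAt I a) a : E → E) (w i)) =
      (extDeriv (inChart β b) (extChartAt I b b))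
        (fun i => (mfderiv I 𝓘(ℝ, E) (extChartAt I b) a : E → E) (w i)) := by
    rintro a _ rfl w; rfl
  exact key _ _ hinv _

/-- Where `β` is smooth, the coordinate expression of `dβ` in a chart is the exterior derivative of
the coordinate expression of `β`. -/
theorem eventually_inChart_extD {k : ℕ} {β : DiffForm I M k} {p : M}
    (hβ : ∀ᶠ q in 𝓝 p, SmoothFormAt β q) :
    inChart (extD β) p =ᶠ[𝓝 (extChartAt I p p)] extDeriv (inChart β p) := by
  have hc : ContinuousAt (extChartAt I p).symm (extChartAt I p p) :=
    (continuousOn_extChartAt_symm p).continuousAt (extChartAt_target_mem_nhds p)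
  filter_upwards [hc.eventually (by rwa [extChartAt_to_inv]), eventually_mem_target (I := I) p]
    with y hy hyt
  have := inChart_extD (I := I) ((extChartAt I p).map_target hyt) hy
  rwa [(extChartAt I p).right_inv hyt] at this

theorem smoothFormAt_extD {k : ℕ} {β : DiffForm I M k} {p : M}
    (hβ : ∀ᶠ q in 𝓝 p, SmoothFormAt β q) : SmoothFormAt (extD β) p := by
  refine ContDiffAt.congr_of_eventuallyEq ?_ (eventually_inChart_extD hβ)
  have h : ContDiffAt ℝ ∞ (fderiv ℝ (inChart β p)) (extChartAt I p p) :=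
    hβ.self_of_nhds.fderiv_right (by simp)
  exact (ContinuousAlternatingMap.alternatizeUncurryFinCLM ℝ E ℂ).contDiff.contDiffAt.comp _ h

theorem extD_extD {k : ℕ} {β : DiffForm I M k} {p : M}
    (hβ : ∀ᶠ q in 𝓝 p, SmoothFormAt β q) : extD (extD β) p = 0 := by
  rw [extD, (eventually_inChart_extD hβ).extDeriv_eq,
    extDeriv_extDeriv_apply (r := 2) (hβ.self_of_nhds.of_le two_le_infty) (by simp)]
  rfl

omit [I.Boundaryless] [IsManifold I ∞ M] in
theorem extD_const_smul {k : ℕ} (c : ℂ) {β : DiffForm I M k} {p : M}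
    (hβ : SmoothFormAt β p) :
    extD (fun q => c • β q) p = c • extD β p := by
  have h : inChart (fun q => c • β q) p = fun y => c • inChart β p y := rfl
  have h2 : fderiv ℝ (fun y => c • inChart β p y) (extChartAt I p p) =
    c • fderiv ℝ (inChart β p) (extChartAt I p p) := 
    fderiv_const_smul (hβ.differentiableAt (by simp)) c
  have hA : ∀ f : E →L[ℝ] E [⋀^Fin k]→L[ℝ] ℂ,
      ContinuousAlternatingMap.alternatizeUncurryFin (c • f) =
        c • ContinuousAlternatingMap.alternatizeUncurryFin f := by
    intro f
    ext v
    simp [ContinuousAlternatingMap.alternatizeUncurryFin_apply, Finset.mul_sum]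
  rw [extD, h, extDeriv, h2, hA]
  rfl

omit [I.Boundaryless] [IsManifold I ∞ M] in
theorem smoothFormAt_const_smul {k : ℕ} (c : ℂ) {β : DiffForm I M k} {p : M}
    (hβ : SmoothFormAt β p) : SmoothFormAt (fun q => c • β q) p :=
  ContDiffAt.const_smul c hβ

end Manifold

/-! ### Connection forms on a trivial bundle -/

section Connection

variable {E P : Type*} [NormedAddCommGroup E] [NormedSpace ℝ E]
  [NormedAddCommGroup P] [NormedSpace ℝ P]

theorem contDiffAt_clm_comp_fst {V W : Type*} [NormedAddCommGroup V] [NormedSpace ℝ V]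
    [NormedAddCommGroup W] [NormedSpace ℝ W] (φ : V →L[ℝ] W) {n : WithTop ℕ∞} {G : E → V}
    {z : E × P} (hG : ContDiffAt ℝ n G z.1) : ContDiffAt ℝ n (fun z : E × P => φ (G z.1)) z :=
  φ.contDiff.contDiffAt.comp z (hG.comp z contDiffAt_fst)

theorem differentiableAt_clm_comp_fst {V W : Type*} [NormedAddCommGroup V] [NormedSpace ℝ V]
    [NormedAddCommGroup W] [NormedSpace ℝ W] (φ : V →L[ℝ] W) {G : E → V} {z : E × P}
    (hG : DifferentiableAt ℝ G z.1) : DifferentiableAt ℝ (fun z : E × P => φ (G z.1)) z :=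
  φ.differentiableAt.comp z (hG.comp z differentiableAt_fst)

/-- For a bilinear form `m` on the fibre `P` and a connection matrix `G` on `E` the 1-form
`m(η, dη + G η)` on the trivial bundle `E × P`. -/
def connForm (m : P →L[ℝ] P →L[ℝ] ℂ) (G : E → E →L[ℝ] P →L[ℝ] P) (z : E × P) : E × P →L[ℝ] ℂ :=
  (m z.2).comp (ContinuousLinearMap.snd ℝ E P +
    ((G z.1).flip z.2).comp (ContinuousLinearMap.fst ℝ E P))

theorem contDiffAt_connForm (m : P →L[ℝ] P →L[ℝ] ℂ) {G : E → E →L[ℝ] P →L[ℝ] P} {z : E × P}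
    (hG : ContDiffAt ℝ ∞ G z.1) : ContDiffAt ℝ ∞ (connForm m G) z := by
  have h1 : ContDiffAt ℝ ∞ (fun z : E × P => m z.2) z :=
    m.contDiff.contDiffAt.comp z contDiffAt_snd
  let φ : (E →L[ℝ] P →L[ℝ] P) →L[ℝ] (P →L[ℝ] E →L[ℝ] P) :=
    (ContinuousLinearMap.flipₗᵢ ℝ E P P).toContinuousLinearEquiv.toContinuousLinearMap
  have h2 : ContDiffAt ℝ ∞ (fun z : E × P => φ (G z.1)) z :=
    contDiffAt_clm_comp_fst (V := E →L[ℝ] P →L[ℝ] P) (W := P →L[ℝ] E →L[ℝ] P) φ hG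
  exact h1.clm_comp (contDiffAt_const.add ((h2.clm_apply contDiffAt_snd).clm_comp contDiffAt_const))

/-- The curvature `dG + [G, G]` of the connection matrix `G`. -/
def curvature (G : E → E →L[ℝ] P →L[ℝ] P) (y u v : E) : P →L[ℝ] P :=
  fderiv ℝ G y u v - fderiv ℝ G y v u + ((G y u).comp (G y v) - (G y v).comp (G y u))

/-- The exterior derivative of `m(η, δη)`, where `δη = dη + G η` and `m` is invariant under the
connection, is `m(δη ∧ δη) + m(η, F η)` with the curvature `F`. -/
theorem extDeriv_connForm (m : P →L[ℝ] P →L[ℝ] ℂ) {G : E → E →L[ℝ] P →L[ℝ] P} {z : E × P}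
    (hG : DifferentiableAt ℝ G z.1) (hm : ∀ u ξ η, m (G z.1 u ξ) η = - m ξ (G z.1 u η))
    (v : Fin 2 → E × P) :
    extDeriv (fun z => ContinuousAlternatingMap.ofSubsingleton ℝ (E × P) ℂ (0 : Fin 1)
        (connForm m G z)) z v =
      m ((v 0).2 + G z.1 (v 0).1 z.2) ((v 1).2 + G z.1 (v 1).1 z.2)
        - m ((v 1).2 + G z.1 (v 1).1 z.2) ((v 0).2 + G z.1 (v 0).1 z.2)
        + m z.2 (curvature G z.1 (v 0).1 (v 1).1 z.2) := by
  have hGd : HasFDerivAt (fun z : E × P => G z.1)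
      ((fderiv ℝ G z.1).comp (ContinuousLinearMap.fst ℝ E P)) z :=
    HasFDerivAt.comp (G := E →L[ℝ] P →L[ℝ] P) z hG.hasFDerivAt
      (hasFDerivAt_fst (𝕜 := ℝ) (E := E) (F := P) (p := z))
  have hmd : HasFDerivAt (fun z : E × P => m z.2) (m.comp (ContinuousLinearMap.snd ℝ E P)) z :=
    m.hasFDerivAt.comp z hasFDerivAt_snd
  have hap : ∀ w : E × P, HasFDerivAt (fun z => connForm m G z w) _ z := fun w =>
    hmd.clm_apply ((((hGd.clm_apply (hasFDerivAt_const w.1 z)).clm_apply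
      hasFDerivAt_snd)).const_add w.2)
  have hd : DifferentiableAt ℝ (connForm m G) z := by
    let φ : (E →L[ℝ] P →L[ℝ] P) →L[ℝ] (P →L[ℝ] E →L[ℝ] P) :=
      (ContinuousLinearMap.flipₗᵢ ℝ E P P).toContinuousLinearEquiv.toContinuousLinearMap
    have h2 : DifferentiableAt ℝ (fun z : E × P => φ (G z.1)) z :=
      differentiableAt_clm_comp_fst (V := E →L[ℝ] P →L[ℝ] P) (W := P →L[ℝ] E →L[ℝ] P) φ hG
    exact hmd.differentiableAt.clm_comp ((differentiableAt_const _).add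
      ((h2.clm_apply differentiableAt_snd).clm_comp (differentiableAt_const _)))
  have hval : ∀ u w : E × P, fderiv ℝ (connForm m G) z u w =
      m u.2 (w.2 + G z.1 w.1 z.2) + m z.2 (fderiv ℝ G z.1 u.1 w.1 z.2 + G z.1 w.1 u.2) := by
    intro u w
    have h1 : fderiv ℝ (fun z => connForm m G z w) z u = fderiv ℝ (connForm m G) z u w := by
      rw [fderiv_clm_apply hd (differentiableAt_const _)]
      simp
    rw [← h1, (hap w).fderiv]
    simp
    ring
  rw [extDeriv_ofSubsingleton _ hd, hval, hval]
  simp only [curvature, map_add, map_sub, add_apply, sub_apply,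
    ContinuousLinearMap.comp_apply, hm]
  ring

end Connection

open VectorField

variable {X : Type*} [TopologicalSpace X] [ChartedSpace (EuclideanSpace ℝ (Fin 4)) X]
  [IsManifold (𝓡 4) ∞ X]

/-! ### Orthonormal frames in a chart -/

namespace SpinStructure

variable {g : Metric4 X} (S : SpinStructure g)

/-- The coordinates of a tangent vector in the frame `i`. -/
def coords (i : S.ι) (x : X) (v : TangentSpace (𝓡 4) x) : Fin 4 → ℝ :=
  fun a => g.inner x (S.frame i a x) v

theorem coords_add (i : S.ι) (x : X) (v w : TangentSpace (𝓡 4) x) :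
    S.coords i x (v + w) = S.coords i x v + S.coords i x w := by
  ext a; simp [coords]

theorem coords_smul (i : S.ι) (x : X) (r : ℝ) (v : TangentSpace (𝓡 4) x) :
    S.coords i x (r • v) = r • S.coords i x v := by
  ext a; simp [coords]

theorem sum_coords_smul_frame {i : S.ι} {x : X} (hx : x ∈ S.U i) (v : TangentSpace (𝓡 4) x) :
    ∑ a, S.coords i x v a • S.frame i a x = v := by
  let T : EuclideanSpace ℝ (Fin 4) →ₗ[ℝ] (Fin 4 → ℝ) :=
    { toFun := S.coords i x
      map_add' := S.coords_add i x
      map_smul' := S.coords_smul i x }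
  have hsurj : Function.Surjective T := by
    intro t
    let e : Fin 4 → EuclideanSpace ℝ (Fin 4) := fun b => S.frame i b x
    refine ⟨∑ b, t b • e b, ?_⟩
    ext a
    rw [map_sum]
    simp only [map_smul, Finset.sum_apply, Pi.smul_apply, smul_eq_mul]
    have : ∀ b, T (e b) a = if a = b then 1 else 0 := fun b =>
      S.frame_orthonormal i x hx a b
    simp [this]
  have hinj : Function.Injective T :=
    (LinearMap.injective_iff_surjective_of_finrank_eq_finrank (by simp)).2 hsurj
  apply hinj
  change S.coords i x _ = S.coords i x v
  ext b
  have h : ∀ a, g.inner x (S.frame i b x) (S.frame i a x) = if b = a then 1 else 0 := fun a =>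
    S.frame_orthonormal i x hx b a
  simp only [coords]
  rw [map_sum]
  simp only [map_smul, h]
  simp

/-- The frame vector fields `e_a` read in the chart at `x₀`. -/
def frameIn (i : S.ι) (x₀ : X) (a : Fin 4) (y : EuclideanSpace ℝ (Fin 4)) :
    EuclideanSpace ℝ (Fin 4) :=
  mpullback 𝓘(ℝ, EuclideanSpace ℝ (Fin 4)) (𝓡 4) (extChartAt (𝓡 4) x₀).symm (S.frame i a) y

/-- The dual coframe `θ^c` read in the chart at `x₀`. -/
def coframeIn (i : S.ι) (x₀ : X) (c : Fin 4) (y : EuclideanSpace ℝ (Fin 4)) :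
    EuclideanSpace ℝ (Fin 4) →L[ℝ] ℝ :=
  (g.inner ((extChartAt (𝓡 4) x₀).symm y) (S.frame i c ((extChartAt (𝓡 4) x₀).symm y))).comp
    (mfderiv 𝓘(ℝ, EuclideanSpace ℝ (Fin 4)) (𝓡 4) (extChartAt (𝓡 4) x₀).symm y)

/-- The points of the chart at `x₀` which belong to the domain of the frame `i`. -/
def domIn (i : S.ι) (x₀ : X) : Set (EuclideanSpace ℝ (Fin 4)) :=
  (extChartAt (𝓡 4) x₀).target ∩ (extChartAt (𝓡 4) x₀).symm ⁻¹' S.U i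

theorem isOpen_domIn (i : S.ι) (x₀ : X) : IsOpen (S.domIn i x₀) :=
  (continuousOn_extChartAt_symm x₀).isOpen_inter_preimage (isOpen_extChartAt_target x₀)
    (S.isOpen_U i)

theorem mem_domIn {i : S.ι} {x₀ : X} (h : x₀ ∈ S.U i) : extChartAt (𝓡 4) x₀ x₀ ∈ S.domIn i x₀ :=
  ⟨mem_extChartAt_target x₀, by simpa using h⟩

theorem isInvertible_mfderiv_symm {x₀ : X} {y : EuclideanSpace ℝ (Fin 4)}
    (hy : y ∈ (extChartAt (𝓡 4) x₀).target) :
    (mfderiv 𝓘(ℝ, EuclideanSpace ℝ (Fin 4)) (𝓡 4) (extChartAt (𝓡 4) x₀).symm y).IsInvertible := by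
  have : IsManifold (𝓡 4) 1 X := IsManifold.of_le (n := ∞) (by simp)
  have := isInvertible_mfderivWithin_extChartAt_symm (I := 𝓡 4) hy
  rwa [(𝓡 4).range_eq_univ, mfderivWithin_univ] at this

theorem mfderiv_mpullback {x₀ : X} {y : EuclideanSpace ℝ (Fin 4)}
    (hy : y ∈ (extChartAt (𝓡 4) x₀).target) (V : (x : X) → TangentSpace (𝓡 4) x) :
    mfderiv 𝓘(ℝ, EuclideanSpace ℝ (Fin 4)) (𝓡 4) (extChartAt (𝓡 4) x₀).symm y
      (mpullback 𝓘(ℝ, EuclideanSpace ℝ (Fin 4)) (𝓡 4) (extChartAt (𝓡 4) x₀).symm V y) =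
      V ((extChartAt (𝓡 4) x₀).symm y) := by
  rw [mpullback_apply]
  exact (isInvertible_mfderiv_symm hy).self_apply_inverse _

variable {S}

theorem coframeIn_mpullback {i : S.ι} {x₀ : X} {y : EuclideanSpace ℝ (Fin 4)}
    (hy : y ∈ S.domIn i x₀) (c : Fin 4) (V : (x : X) → TangentSpace (𝓡 4) x) :
    S.coframeIn i x₀ c y
      (mpullback 𝓘(ℝ, EuclideanSpace ℝ (Fin 4)) (𝓡 4) (extChartAt (𝓡 4) x₀).symm V y) =
      g.inner _ (S.frame i c ((extChartAt (𝓡 4) x₀).symm y))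
        (V ((extChartAt (𝓡 4) x₀).symm y)) := by
  exact congrArg (g.inner _ (S.frame i c ((extChartAt (𝓡 4) x₀).symm y)))
    (mfderiv_mpullback hy.1 V)

theorem coframeIn_frameIn {i : S.ι} {x₀ : X} {y : EuclideanSpace ℝ (Fin 4)}
    (hy : y ∈ S.domIn i x₀) (a c : Fin 4) :
    S.coframeIn i x₀ c y (S.frameIn i x₀ a y) = if c = a then 1 else 0 := by
  rw [frameIn, coframeIn_mpullback hy]
  exact S.frame_orthonormal i _ hy.2 c a

theorem sum_coframeIn_smul_frameIn {i : S.ι} {x₀ : X} {y : EuclideanSpace ℝ (Fin 4)}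
    (hy : y ∈ S.domIn i x₀) (v : EuclideanSpace ℝ (Fin 4)) :
    ∑ a, S.coframeIn i x₀ a y v • S.frameIn i x₀ a y = v := by
  let D : EuclideanSpace ℝ (Fin 4) →L[ℝ] EuclideanSpace ℝ (Fin 4) :=
    mfderiv 𝓘(ℝ, EuclideanSpace ℝ (Fin 4)) (𝓡 4) (extChartAt (𝓡 4) x₀).symm y
  have hinj : Function.Injective D := (isInvertible_mfderiv_symm hy.1).injective
  apply hinj
  rw [map_sum]
  simp only [map_smul]
  have h : ∀ a, D (S.frameIn i x₀ a y) = S.frame i a ((extChartAt (𝓡 4) x₀).symm y) := fun a =>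
    mfderiv_mpullback hy.1 _
  simp only [h]
  exact S.sum_coords_smul_frame hy.2 _

theorem mdifferentiableAt_frame {i : S.ι} {x : X} (hx : x ∈ S.U i) (a : Fin 4) :
    MDifferentiableAt (𝓡 4) (𝓡 4).tangent
      (fun x => (⟨x, S.frame i a x⟩ : TangentBundle (𝓡 4) X)) x :=
  ((S.frame_smooth i a).contMDiffAt ((S.isOpen_U i).mem_nhds hx)).mdifferentiableAt (by simp)

theorem contMDiffAt_symm {x₀ : X} {y : EuclideanSpace ℝ (Fin 4)}
    (hy : y ∈ (extChartAt (𝓡 4) x₀).target) :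
    ContMDiffAt 𝓘(ℝ, EuclideanSpace ℝ (Fin 4)) (𝓡 4) ∞ (extChartAt (𝓡 4) x₀).symm y :=
  (contMDiffOn_extChartAt_symm (n := ∞) x₀).contMDiffAt ((isOpen_extChartAt_target x₀).mem_nhds hy)

theorem contDiffAt_frameIn {i : S.ι} {x₀ : X} {y : EuclideanSpace ℝ (Fin 4)}
    (hy : y ∈ S.domIn i x₀) (a : Fin 4) : ContDiffAt ℝ ∞ (S.frameIn i x₀ a) y := by
  have h := ContMDiffAt.mpullback_vectorField_preimage (m := ∞) (n := ∞)
    ((S.frame_smooth i a).contMDiffAt ((S.isOpen_U i).mem_nhds hy.2))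
    (contMDiffAt_symm hy.1) (isInvertible_mfderiv_symm hy.1) (by simp)
  exact contMDiffAt_vectorSpace_iff_contDiffAt.1 h

theorem contDiffAt_coframeIn {i : S.ι} {x₀ : X} {y : EuclideanSpace ℝ (Fin 4)}
    (hy : y ∈ S.domIn i x₀) (c : Fin 4) : ContDiffAt ℝ ∞ (S.coframeIn i x₀ c) y := by
  -- the coframe is obtained by inverting the linear isomorphism given by the frame
  let Φ : EuclideanSpace ℝ (Fin 4) → ((Fin 4 → ℝ) →L[ℝ] EuclideanSpace ℝ (Fin 4)) := fun y =>
    ∑ a, (ContinuousLinearMap.proj a : (Fin 4 → ℝ) →L[ℝ] ℝ).smulRight (S.frameIn i x₀ a y)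
  have hΦs : ContDiffAt ℝ ∞ Φ y := by
    refine ContDiffAt.sum fun a _ => ?_
    exact contDiffAt_const.smulRight (contDiffAt_frameIn hy a)
  have hinv : ∀ z ∈ S.domIn i x₀, ∃ e : (Fin 4 → ℝ) ≃L[ℝ] EuclideanSpace ℝ (Fin 4),
      (e : (Fin 4 → ℝ) →L[ℝ] EuclideanSpace ℝ (Fin 4)) = Φ z ∧
      ∀ c v, e.symm v c = S.coframeIn i x₀ c z v := by
    intro z hz
    refine ⟨ContinuousLinearEquiv.equivOfInverse (Φ z)
      (ContinuousLinearMap.pi fun c => S.coframeIn i x₀ c z) ?_ ?_, ?_, ?_⟩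
    · intro t
      ext c
      simp [Φ, coframeIn_frameIn hz]
    · intro v
      simpa [Φ] using sum_coframeIn_smul_frameIn hz v
    · ext; rfl
    · intro c v; rfl
  obtain ⟨e, he, _⟩ := hinv y hy
  have hI : ContDiffAt ℝ ∞ (fun z => (Φ z).inverse) y :=
    ContDiffAt.comp (F := (Fin 4 → ℝ) →L[ℝ] EuclideanSpace ℝ (Fin 4))
      (G := EuclideanSpace ℝ (Fin 4) →L[ℝ] (Fin 4 → ℝ)) (g := ContinuousLinearMap.inverse) y
      (by rw [← he]; exact contDiffAt_map_inverse e) hΦs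
  have hc : ContDiffAt ℝ ∞
      (fun z => (ContinuousLinearMap.proj c : (Fin 4 → ℝ) →L[ℝ] ℝ).comp (Φ z).inverse) y :=
    contDiffAt_const.clm_comp hI
  refine hc.congr_of_eventuallyEq ?_
  filter_upwards [(S.isOpen_domIn i x₀).mem_nhds hy] with z hz
  obtain ⟨e, he, he'⟩ := hinv z hz
  rw [← he, ContinuousLinearMap.inverse_equiv]
  ext v
  exact (he' c v).symm

theorem bracketCoeff_symm {i : S.ι} {x₀ : X} {y : EuclideanSpace ℝ (Fin 4)}
    (hy : y ∈ S.domIn i x₀) (a b c : Fin 4) :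
    S.bracketCoeff i a b c ((extChartAt (𝓡 4) x₀).symm y) =
      S.coframeIn i x₀ c y (lieBracket ℝ (S.frameIn i x₀ a) (S.frameIn i x₀ b) y) := by
  have : IsManifold (𝓡 4) (minSmoothness ℝ 2) X :=
    IsManifold.of_le (n := ∞) (by simpa using two_le_infty)
  have h := mpullback_mlieBracket (I := 𝓘(ℝ, EuclideanSpace ℝ (Fin 4))) (I' := 𝓡 4)
    (mdifferentiableAt_frame hy.2 a) (mdifferentiableAt_frame hy.2 b)
    (n := ∞) (contMDiffAt_symm hy.1) (by simpa using two_le_infty)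
  have h2 : mlieBracket 𝓘(ℝ, EuclideanSpace ℝ (Fin 4)) (S.frameIn i x₀ a) (S.frameIn i x₀ b) y =
      lieBracket ℝ (S.frameIn i x₀ a) (S.frameIn i x₀ b) y := by
    have := congrFun (mlieBracketWithin_eq_lieBracketWithin (𝕜 := ℝ) (V := S.frameIn i x₀ a)
      (W := S.frameIn i x₀ b) (s := Set.univ)) y
    rw [lieBracketWithin_univ] at this
    exact this
  rw [← h2]
  change _ = S.coframeIn i x₀ c y (mlieBracket 𝓘(ℝ, EuclideanSpace ℝ (Fin 4))
    (mpullback 𝓘(ℝ, EuclideanSpace ℝ (Fin 4)) (𝓡 4) (extChartAt (𝓡 4) x₀).symm (S.frame i a))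
    (mpullback 𝓘(ℝ, EuclideanSpace ℝ (Fin 4)) (𝓡 4) (extChartAt (𝓡 4) x₀).symm (S.frame i b)) y)
  rw [← h, coframeIn_mpullback hy]
  exact g.symm _ _ _

theorem contDiffAt_bracketCoeff_symm {i : S.ι} {x₀ : X} {y : EuclideanSpace ℝ (Fin 4)}
    (hy : y ∈ S.domIn i x₀) (a b c : Fin 4) :
    ContDiffAt ℝ ∞ (fun y => S.bracketCoeff i a b c ((extChartAt (𝓡 4) x₀).symm y)) y := by
  have h : ContDiffAt ℝ ∞ (fun y => S.coframeIn i x₀ c y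
      (lieBracket ℝ (S.frameIn i x₀ a) (S.frameIn i x₀ b) y)) y :=
    (contDiffAt_coframeIn hy c).clm_apply
      ((contDiffAt_frameIn hy a).lieBracket_vectorField (contDiffAt_frameIn hy b) (by simp))
  refine h.congr_of_eventuallyEq ?_
  filter_upwards [(S.isOpen_domIn i x₀).mem_nhds hy] with z hz
  exact bracketCoeff_symm hz a b c

theorem contDiffAt_leviCivita_symm {i : S.ι} {x₀ : X} {y : EuclideanSpace ℝ (Fin 4)}
    (hy : y ∈ S.domIn i x₀) (d a c : Fin 4) :
    ContDiffAt ℝ ∞ (fun y => S.leviCivita i d a c ((extChartAt (𝓡 4) x₀).symm y)) y := by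
  unfold leviCivita
  exact contDiffAt_const.mul (((contDiffAt_bracketCoeff_symm hy d a c).sub
    (contDiffAt_bracketCoeff_symm hy a c d)).add (contDiffAt_bracketCoeff_symm hy c d a))

theorem mdifferentiableAt_of_symm {F : Type*} [NormedAddCommGroup F] [NormedSpace ℝ F]
    {x₀ : X} {f : X → F} {y : EuclideanSpace ℝ (Fin 4)}
    (hy : y ∈ (extChartAt (𝓡 4) x₀).target)
    (hf : DifferentiableAt ℝ (fun y => f ((extChartAt (𝓡 4) x₀).symm y)) y) :
    MDifferentiableAt (𝓡 4) 𝓘(ℝ, F) f ((extChartAt (𝓡 4) x₀).symm y) := by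
  have hs := (extChartAt (𝓡 4) x₀).map_target hy
  have h1 : MDifferentiableAt (𝓡 4) 𝓘(ℝ, F)
      ((fun y => f ((extChartAt (𝓡 4) x₀).symm y)) ∘ extChartAt (𝓡 4) x₀)
      ((extChartAt (𝓡 4) x₀).symm y) := by
    have : IsManifold (𝓡 4) 1 X := IsManifold.of_le (n := ∞) (by simp)
    refine MDifferentiableAt.comp (I' := 𝓘(ℝ, EuclideanSpace ℝ (Fin 4))) _ ?_
      (mdifferentiableAt_extChartAt (by rwa [extChartAt_source] at hs))
    rw [(extChartAt (𝓡 4) x₀).right_inv hy]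
    exact hf.mdifferentiableAt
  refine h1.congr_of_eventuallyEq ?_
  filter_upwards [(isOpen_extChartAt_source x₀).mem_nhds hs] with z hz
  simp only [Function.comp]
  rw [(extChartAt (𝓡 4) x₀).left_inv hz]

theorem fderiv_symm_apply {F : Type*} [NormedAddCommGroup F] [NormedSpace ℝ F]
    {x₀ : X} {f : X → F} {y : EuclideanSpace ℝ (Fin 4)}
    (hy : y ∈ (extChartAt (𝓡 4) x₀).target)
    (hf : MDifferentiableAt (𝓡 4) 𝓘(ℝ, F) f ((extChartAt (𝓡 4) x₀).symm y))
    (v : EuclideanSpace ℝ (Fin 4)) :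
    fderiv ℝ (fun y => f ((extChartAt (𝓡 4) x₀).symm y)) y v =
      (mfderiv (𝓡 4) 𝓘(ℝ, F) f ((extChartAt (𝓡 4) x₀).symm y) :
        TangentSpace (𝓡 4) ((extChartAt (𝓡 4) x₀).symm y) →L[ℝ] F)
        (mfderiv 𝓘(ℝ, EuclideanSpace ℝ (Fin 4)) (𝓡 4) (extChartAt (𝓡 4) x₀).symm y v) := by
  have h := mfderiv_comp y hf (mdifferentiableAt_extChartAt_symm (I := 𝓡 4) hy)
  rw [mfderiv_eq_fderiv] at h
  exact congrArg (fun T : EuclideanSpace ℝ (Fin 4) →L[ℝ] F => T v) h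

theorem frameDeriv_symm {i : S.ι} {x₀ : X} {f : X → ℝ} {y : EuclideanSpace ℝ (Fin 4)}
    (hy : y ∈ S.domIn i x₀)
    (hf : DifferentiableAt ℝ (fun y => f ((extChartAt (𝓡 4) x₀).symm y)) y) (a : Fin 4) :
    S.frameDeriv i a f ((extChartAt (𝓡 4) x₀).symm y) =
      fderiv ℝ (fun y => f ((extChartAt (𝓡 4) x₀).symm y)) y (S.frameIn i x₀ a y) := by
  rw [fderiv_symm_apply hy.1 (mdifferentiableAt_of_symm hy.1 hf), frameIn, mfderiv_mpullback hy.1]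
  rfl

/-- The first structure equation `dθ^c(e_a, e_b) = -θ^c([e_a, e_b])`. -/
theorem fderiv_coframeIn {i : S.ι} {x₀ : X} {y : EuclideanSpace ℝ (Fin 4)}
    (hy : y ∈ S.domIn i x₀) (a b c : Fin 4) :
    fderiv ℝ (S.coframeIn i x₀ c) y (S.frameIn i x₀ a y) (S.frameIn i x₀ b y)
      - fderiv ℝ (S.coframeIn i x₀ c) y (S.frameIn i x₀ b y) (S.frameIn i x₀ a y) =
      - S.bracketCoeff i a b c ((extChartAt (𝓡 4) x₀).symm y) := by
  have h : ∀ a u, fderiv ℝ (S.coframeIn i x₀ c) y u (S.frameIn i x₀ a y)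
      + S.coframeIn i x₀ c y (fderiv ℝ (S.frameIn i x₀ a) y u) = 0 := by
    intro a u
    have h1 : (fun y => S.coframeIn i x₀ c y (S.frameIn i x₀ a y)) =ᶠ[𝓝 y]
        fun _ => if c = a then 1 else 0 := by
      filter_upwards [(S.isOpen_domIn i x₀).mem_nhds hy] with z hz
      exact coframeIn_frameIn hz a c
    have h2 := h1.fderiv_eq (𝕜 := ℝ)
    rw [fderiv_clm_apply ((contDiffAt_coframeIn hy c).differentiableAt (by simp))
      ((contDiffAt_frameIn hy a).differentiableAt (by simp))] at h2
    have h3 := congrArg (fun T : EuclideanSpace ℝ (Fin 4) →L[ℝ] ℝ => T u) h2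
    simpa [add_comm] using h3
  rw [bracketCoeff_symm hy, lieBracket, map_sub]
  linarith [h a (S.frameIn i x₀ b y), h b (S.frameIn i x₀ a y)]

end SpinStructure

/-! ### The connection of `𝕊'` and its curvature -/

/-- The action of `spinLift w` on `ℂ²`, as a real linear map in `w`. -/
def spinLiftCLM : (Fin 4 → Fin 4 → ℝ) →L[ℝ] ((Fin 2 → ℂ) →L[ℝ] (Fin 2 → ℂ)) :=
  LinearMap.toContinuousLinearMap
    { toFun := fun w => LinearMap.toContinuousLinearMap
        { toFun := fun η => spinLift (Matrix.of w) *ᵥ η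
          map_add' := fun x y => Matrix.mulVec_add _ x y
          map_smul' := fun c x => Matrix.mulVec_smul _ c x }
      map_add' := by
        intro v w
        refine ContinuousLinearMap.ext fun η => ?_
        change spinLift (Matrix.of v + Matrix.of w) *ᵥ η = _
        rw [spinLift_add, Matrix.add_mulVec]
        rfl
      map_smul' := by
        intro r w
        refine ContinuousLinearMap.ext fun η => ?_
        change spinLift (r • Matrix.of w) *ᵥ η = _
        rw [spinLift_smul, Matrix.smul_mulVec]
        rfl }

theorem spinLiftCLM_apply (w : Fin 4 → Fin 4 → ℝ) (η : Fin 2 → ℂ) :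
    spinLiftCLM w η = spinLift (Matrix.of w) *ᵥ η := rfl

namespace SpinStructure

variable {g : Metric4 X} {S : SpinStructure g}

theorem bracketCoeff_swap (i : S.ι) (a b c : Fin 4) (x : X) :
    S.bracketCoeff i b a c x = - S.bracketCoeff i a b c x := by
  rw [bracketCoeff, VectorField.mlieBracket_swap_apply, map_neg]
  rfl

theorem leviCivita_skew (i : S.ι) (d a c : Fin 4) (x : X) :
    S.leviCivita i d a c x = - S.leviCivita i d c a x := by
  simp only [leviCivita]
  rw [bracketCoeff_swap i a c d, bracketCoeff_swap i d a c, bracketCoeff_swap i d c a]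
  ring

theorem leviCivita_torsion (i : S.ι) (d a c : Fin 4) (x : X) :
    S.leviCivita i d a c x - S.leviCivita i a d c x = S.bracketCoeff i d a c x := by
  simp only [leviCivita]
  rw [bracketCoeff_swap i d a c, bracketCoeff_swap i d c a, bracketCoeff_swap i a c d]
  ring

/-- The Levi-Civita connection is determined by the brackets: it is the unique metric connection
without torsion. -/
theorem eq_leviCivita (i : S.ι) (x : X) (T : Fin 4 → Fin 4 → Fin 4 → ℝ)
    (hskew : ∀ d a c, T d a c = - T d c a)
    (htor : ∀ d a c, T d a c - T a d c = S.bracketCoeff i d a c x) (d a c : Fin 4) :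
    T d a c = S.leviCivita i d a c x := by
  simp only [leviCivita]
  linarith [htor d a c, htor a c d, htor c d a, hskew d a c, hskew a d c, hskew c a d]

/-- The connection matrices `(w_d)^c_a = Γ_{da}^c`. -/
def connMatrix (i : S.ι) (d : Fin 4) (x : X) : Fin 4 → Fin 4 → ℝ :=
  fun c a => S.leviCivita i d a c x

variable (S) in
/-- The connection form of `𝕊'` in the frame `i`, read in the chart at `x₀`. -/
def connIn (i : S.ι) (x₀ : X) (y : EuclideanSpace ℝ (Fin 4)) :
    EuclideanSpace ℝ (Fin 4) →L[ℝ] ((Fin 2 → ℂ) →L[ℝ] (Fin 2 → ℂ)) :=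
  ∑ c, (S.coframeIn i x₀ c y).smulRight
    (spinLiftCLM (S.connMatrix i c ((extChartAt (𝓡 4) x₀).symm y)))

theorem contDiffAt_connMatrix {i : S.ι} {x₀ : X} {y : EuclideanSpace ℝ (Fin 4)}
    (hy : y ∈ S.domIn i x₀) (d : Fin 4) :
    ContDiffAt ℝ ∞ (fun y => S.connMatrix i d ((extChartAt (𝓡 4) x₀).symm y)) y :=
  contDiffAt_pi.2 fun c => contDiffAt_pi.2 fun a => contDiffAt_leviCivita_symm hy d a c

theorem contDiffAt_spinLiftCLM {i : S.ι} {x₀ : X} {y : EuclideanSpace ℝ (Fin 4)}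
    (hy : y ∈ S.domIn i x₀) (d : Fin 4) :
    ContDiffAt ℝ ∞
      (fun y => spinLiftCLM (S.connMatrix i d ((extChartAt (𝓡 4) x₀).symm y))) y :=
  ContDiffAt.comp (F := Fin 4 → Fin 4 → ℝ) (G := (Fin 2 → ℂ) →L[ℝ] (Fin 2 → ℂ)) (g := spinLiftCLM)
    y spinLiftCLM.contDiff.contDiffAt (contDiffAt_connMatrix hy d)

theorem contDiffAt_connIn {i : S.ι} {x₀ : X} {y : EuclideanSpace ℝ (Fin 4)}
    (hy : y ∈ S.domIn i x₀) : ContDiffAt ℝ ∞ (S.connIn i x₀) y :=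
  ContDiffAt.sum fun c _ => (contDiffAt_coframeIn hy c).smulRight (contDiffAt_spinLiftCLM hy c)

theorem connIn_frameIn {i : S.ι} {x₀ : X} {y : EuclideanSpace ℝ (Fin 4)}
    (hy : y ∈ S.domIn i x₀) (a : Fin 4) : S.connIn i x₀ y (S.frameIn i x₀ a y) =
      spinLiftCLM (S.connMatrix i a ((extChartAt (𝓡 4) x₀).symm y)) := by
  rw [connIn, sum_apply, Finset.sum_eq_single a]
  · rw [ContinuousLinearMap.smulRight_apply, coframeIn_frameIn hy]; simp
  · intro b _ hb
    rw [ContinuousLinearMap.smulRight_apply, coframeIn_frameIn hy]; simp [hb]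
  · simp

/-- The derivative of the connection form on the vectors of the frame. -/
theorem fderiv_connIn_frameIn {i : S.ι} {x₀ : X} {y : EuclideanSpace ℝ (Fin 4)}
    (hy : y ∈ S.domIn i x₀) (u : EuclideanSpace ℝ (Fin 4)) (b : Fin 4) :
    fderiv ℝ (S.connIn i x₀) y u (S.frameIn i x₀ b y) =
      spinLiftCLM (∑ c, fderiv ℝ (S.coframeIn i x₀ c) y u (S.frameIn i x₀ b y) •
        S.connMatrix i c ((extChartAt (𝓡 4) x₀).symm y)
      + fun c a =>
        fderiv ℝ (fun y => S.leviCivita i b a c ((extChartAt (𝓡 4) x₀).symm y)) y u) := by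
  set v := S.frameIn i x₀ b y with hv
  have hd : DifferentiableAt ℝ (S.connIn i x₀) y :=
    (contDiffAt_connIn hy).differentiableAt (by simp)
  have h1 : fderiv ℝ (fun z => S.connIn i x₀ z v) y u = fderiv ℝ (S.connIn i x₀) y u v := by
    rw [fderiv_clm_apply hd (differentiableAt_const _)]
    simp
  have h2 : (fun z => S.connIn i x₀ z v) = fun z => spinLiftCLM (∑ c, S.coframeIn i x₀ c z v •
      S.connMatrix i c ((extChartAt (𝓡 4) x₀).symm z)) := by
    funext z
    rw [connIn, sum_apply, map_sum]
    refine Finset.sum_congr rfl fun c _ => ?_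
    rw [ContinuousLinearMap.smulRight_apply]
    exact (spinLiftCLM.map_smul (S.coframeIn i x₀ c z v) _).symm
  have hθ : ∀ c, HasFDerivAt (fun z => S.coframeIn i x₀ c z v)
      ((fderiv ℝ (S.coframeIn i x₀ c) y).flip v) y := by
    intro c
    have := (((contDiffAt_coframeIn hy c).differentiableAt (by simp)).hasFDerivAt).clm_apply
      (hasFDerivAt_const v y)
    simpa using this
  let W' : Fin 4 → EuclideanSpace ℝ (Fin 4) →L[ℝ] (Fin 4 → Fin 4 → ℝ) := fun b =>
    ContinuousLinearMap.pi fun c => ContinuousLinearMap.pi fun a =>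
      fderiv ℝ (fun z => S.leviCivita i b a c ((extChartAt (𝓡 4) x₀).symm z)) y
  have hw : ∀ c, HasFDerivAt (fun z => S.connMatrix i c ((extChartAt (𝓡 4) x₀).symm z)) (W' c) y :=
    fun b => hasFDerivAt_pi.2 fun c => hasFDerivAt_pi.2 fun a =>
      ((contDiffAt_leviCivita_symm hy b a c).differentiableAt (by simp)).hasFDerivAt
  have hsum : HasFDerivAt (fun z => ∑ c, S.coframeIn i x₀ c z v •
      S.connMatrix i c ((extChartAt (𝓡 4) x₀).symm z)) _ y :=
    HasFDerivAt.fun_sum (u := Finset.univ) fun c _ => (hθ c).smul (hw c)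
  have h3 := HasFDerivAt.comp (F := Fin 4 → Fin 4 → ℝ) (G := (Fin 2 → ℂ) →L[ℝ] (Fin 2 → ℂ)) y
    spinLiftCLM.hasFDerivAt hsum
  have h4 : fderiv ℝ (fun z => S.connIn i x₀ z v) y = spinLiftCLM.comp
      (∑ c, (S.coframeIn i x₀ c y v • W' c + ((fderiv ℝ (S.coframeIn i x₀ c) y).flip v).smulRight
        (S.connMatrix i c ((extChartAt (𝓡 4) x₀).symm y)))) := by
    rw [h2]; exact h3.fderiv
  rw [← h1, h4, ContinuousLinearMap.comp_apply]
  congr 1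
  rw [sum_apply]
  simp only [add_apply, smul_apply, ContinuousLinearMap.smulRight_apply,
    ContinuousLinearMap.flip_apply, Finset.sum_add_distrib]
  rw [add_comm]
  congr 1
  rw [Finset.sum_eq_single b]
  · rw [hv, coframeIn_frameIn hy, if_pos rfl, one_smul]
    rfl
  · intro c _ hc
    rw [hv, coframeIn_frameIn hy, if_neg hc, zero_smul]
  · simp

/-- The matrix `R(e_a, e_b)` of the curvature tensor. -/
def riemannMatrix (i : S.ι) (a b : Fin 4) (x : X) : Matrix (Fin 4) (Fin 4) ℝ :=
  Matrix.of fun c d => S.riemann i a b c d x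

/-- The second structure equation: the curvature of `𝕊'` is the lift of the Riemann tensor. -/
theorem curvature_connIn_frameIn {i : S.ι} {x₀ : X} {y : EuclideanSpace ℝ (Fin 4)}
    (hy : y ∈ S.domIn i x₀) (a b : Fin 4) :
    curvature (S.connIn i x₀) y (S.frameIn i x₀ a y) (S.frameIn i x₀ b y) =
      spinLiftCLM (S.riemannMatrix i a b ((extChartAt (𝓡 4) x₀).symm y)) := by
  set x := (extChartAt (𝓡 4) x₀).symm y with hx
  have hcomm : (spinLiftCLM (S.connMatrix i a x)).comp (spinLiftCLM (S.connMatrix i b x))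
      - (spinLiftCLM (S.connMatrix i b x)).comp (spinLiftCLM (S.connMatrix i a x)) =
      spinLiftCLM (fun c d => (Matrix.of (S.connMatrix i a x) * Matrix.of (S.connMatrix i b x)
        - Matrix.of (S.connMatrix i b x) * Matrix.of (S.connMatrix i a x)) c d) := by
    refine ContinuousLinearMap.ext fun η => ?_
    simp only [sub_apply, ContinuousLinearMap.comp_apply, spinLiftCLM_apply]
    rw [Matrix.mulVec_mulVec, Matrix.mulVec_mulVec, ← Matrix.sub_mulVec]
    congr 1
    exact (spinLift_commutator _ _ (fun _ _ => leviCivita_skew _ _ _ _ _)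
      (fun _ _ => leviCivita_skew _ _ _ _ _)).symm
  rw [curvature, fderiv_connIn_frameIn hy, fderiv_connIn_frameIn hy, connIn_frameIn hy,
    connIn_frameIn hy, hcomm, ← map_sub, ← map_add]
  congr 1
  funext c d
  have hfd : ∀ a b, fderiv ℝ (fun y => S.leviCivita i b d c ((extChartAt (𝓡 4) x₀).symm y)) y
      (S.frameIn i x₀ a y) = S.frameDeriv i a (S.leviCivita i b d c) x := fun a b =>
    (frameDeriv_symm hy ((contDiffAt_leviCivita_symm hy b d c).differentiableAt (by simp)) a).symm
  have hθ := fun e => fderiv_coframeIn hy a b e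
  simp only [← hx] at hθ
  simp only [Pi.add_apply, Pi.sub_apply, Finset.sum_apply, Pi.smul_apply, smul_eq_mul, hfd,
    riemannMatrix, Matrix.of_apply, riemann, Matrix.sub_apply, Matrix.mul_apply, connMatrix,
    Finset.sum_sub_distrib]
  have h1 : ∀ e, S.bracketCoeff i a b e x * S.leviCivita i e d c x =
    - (fderiv ℝ (S.coframeIn i x₀ e) y (S.frameIn i x₀ a y) (S.frameIn i x₀ b y)
        * S.leviCivita i e d c x)
      + fderiv ℝ (S.coframeIn i x₀ e) y (S.frameIn i x₀ b y) (S.frameIn i x₀ a y)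
        * S.leviCivita i e d c x := by
    intro e
    rw [← neg_neg (S.bracketCoeff i a b e x), ← hθ e]
    ring
  simp only [h1, Finset.sum_add_distrib, Finset.sum_neg_distrib]
  ring

end SpinStructure

theorem curvature_add_left {E P : Type*} [NormedAddCommGroup E] [NormedSpace ℝ E]
    [NormedAddCommGroup P] [NormedSpace ℝ P] (G : E → E →L[ℝ] P →L[ℝ] P) (y u u' v : E) :
    curvature G y (u + u') v = curvature G y u v + curvature G y u' v := by
  simp only [curvature, map_add, add_apply, ContinuousLinearMap.add_comp,
    ContinuousLinearMap.comp_add]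
  abel

theorem curvature_smul_left {E P : Type*} [NormedAddCommGroup E] [NormedSpace ℝ E]
    [NormedAddCommGroup P] [NormedSpace ℝ P] (G : E → E →L[ℝ] P →L[ℝ] P) (r : ℝ) (y u v : E) :
    curvature G y (r • u) v = r • curvature G y u v := by
  simp only [curvature, map_smul, smul_apply, ContinuousLinearMap.smul_comp,
    ContinuousLinearMap.comp_smul, smul_add, smul_sub]

theorem curvature_swap {E P : Type*} [NormedAddCommGroup E] [NormedSpace ℝ E]
    [NormedAddCommGroup P] [NormedSpace ℝ P] (G : E → E →L[ℝ] P →L[ℝ] P) (y u v : E) :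
    curvature G y v u = - curvature G y u v := by
  simp only [curvature]
  abel

theorem curvature_sum_left {E P : Type*} [NormedAddCommGroup E] [NormedSpace ℝ E]
    [NormedAddCommGroup P] [NormedSpace ℝ P] (G : E → E →L[ℝ] P →L[ℝ] P) (y v : E)
    {ι : Type*} (s : Finset ι) (r : ι → ℝ) (u : ι → E) :
    curvature G y (∑ a ∈ s, r a • u a) v = ∑ a ∈ s, r a • curvature G y (u a) v := by
  let φ : E →ₗ[ℝ] (P →L[ℝ] P) :=
    { toFun := fun u => curvature G y u v
      map_add' := fun u u' => curvature_add_left G y u u' v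
      map_smul' := fun r u => curvature_smul_left G r y u v }
  change φ _ = _
  rw [map_sum]
  simp only [map_smul]
  rfl

theorem curvature_sum_right {E P : Type*} [NormedAddCommGroup E] [NormedSpace ℝ E]
    [NormedAddCommGroup P] [NormedSpace ℝ P] (G : E → E →L[ℝ] P →L[ℝ] P) (y u : E)
    {ι : Type*} (s : Finset ι) (r : ι → ℝ) (v : ι → E) :
    curvature G y u (∑ a ∈ s, r a • v a) = ∑ a ∈ s, r a • curvature G y u (v a) := by
  rw [curvature_swap, curvature_sum_left, ← Finset.sum_neg_distrib]
  refine Finset.sum_congr rfl fun a _ => ?_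
  rw [curvature_swap, smul_neg, neg_neg]

namespace SpinStructure

variable {g : Metric4 X} {S : SpinStructure g}

/-- For an anti self-dual Einstein metric the lift of the Riemann tensor to `𝕊'` is determined by
the scalar curvature. -/
theorem spinLift_riemann (hE : S.IsEinstein) (hA : S.IsAntiSelfDual) {i : S.ι} {x : X}
    (hx : x ∈ S.U i) (s t : Fin 4 → ℝ) :
    ∑ a, ∑ b, (s a * t b) • spinLift (S.riemannMatrix i a b x) =
      ((S.scalar i x / 24 : ℝ) : ℂ) • wedgeSD (toM s) (toM t) := by
  set Λ : ℝ := S.scalar i x / 24 with hΛ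
  have hP : ∀ a b, S.schouten i a b x = Λ * (if a = b then 1 else 0) := by
    intro a b
    rw [schouten, hE i x hx, hΛ]
    ring
  have hW : ∀ a b, spinLift (Matrix.of fun c d => S.weyl i a b c d x) = 0 := fun a b =>
    spinLift_eq_zero_of_antiSelfDual _ fun c d => hA i x hx a b c d
  have hR : ∀ a b, S.riemannMatrix i a b x = (Matrix.of fun c d => S.weyl i a b c d x) +
      (2 * Λ) • (Matrix.vecMulVec (Pi.single a 1) (Pi.single b 1)
        - Matrix.vecMulVec (Pi.single b 1) (Pi.single a 1)) := by
    intro a b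
    ext c d
    simp only [riemannMatrix, Matrix.of_apply, Matrix.add_apply, Matrix.smul_apply,
      Matrix.sub_apply, Matrix.vecMulVec_apply, weyl, hP, Pi.single_apply, smul_eq_mul,
      eq_comm (a := b) (b := d), eq_comm (a := b) (b := c), eq_comm (a := a) (b := c),
      eq_comm (a := a) (b := d)]
    ring
  have hR2 : ∀ a b, spinLiftL (S.riemannMatrix i a b x) = spinLiftL
      ((2 * Λ) • (Matrix.vecMulVec (Pi.single a 1) (Pi.single b 1)
        - Matrix.vecMulVec (Pi.single b 1) (Pi.single a 1))) := by
    intro a b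
    rw [hR a b, map_add, spinLiftL_apply, hW, zero_add]
  have hsum : ∑ a, ∑ b, (s a * t b) • ((2 * Λ) • (Matrix.vecMulVec (Pi.single a 1) (Pi.single b 1)
        - Matrix.vecMulVec (Pi.single b 1) (Pi.single a 1) : Matrix (Fin 4) (Fin 4) ℝ)) =
      (2 * Λ) • (Matrix.vecMulVec s t - Matrix.vecMulVec t s) := by
    ext c d
    simp only [Matrix.sum_apply, Matrix.smul_apply, Matrix.sub_apply, Matrix.vecMulVec_apply,
      Pi.single_apply, smul_eq_mul, mul_sub, Finset.sum_sub_distrib, mul_ite, mul_one, mul_zero,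
      Finset.sum_ite_irrel, Finset.sum_const_zero, Finset.sum_ite_eq, Finset.mem_univ, if_true]
    ring
  calc ∑ a, ∑ b, (s a * t b) • spinLift (S.riemannMatrix i a b x)
      = spinLiftL (∑ a, ∑ b, (s a * t b) • ((2 * Λ) •
        (Matrix.vecMulVec (Pi.single a 1) (Pi.single b 1)
        - Matrix.vecMulVec (Pi.single b 1) (Pi.single a 1) : Matrix (Fin 4) (Fin 4) ℝ))) := by
        simp only [map_sum]
        refine Finset.sum_congr rfl fun a _ => Finset.sum_congr rfl fun b _ => ?_
        rw [map_smul, ← hR2, spinLiftL_apply]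
    _ = _ := by
        rw [hsum, map_smul, map_sub, spinLiftL_apply, spinLiftL_apply, spinLift_vecMulVec,
          spinLift_vecMulVec, wedgeSD, ← smul_sub]
        ext r q
        simp
        ring

/-- The curvature of `𝕊'` for an anti self-dual Einstein metric. -/
theorem curvature_connIn (hE : S.IsEinstein) (hA : S.IsAntiSelfDual) {i : S.ι} {x₀ : X}
    {y : EuclideanSpace ℝ (Fin 4)} (hy : y ∈ S.domIn i x₀) (u v : EuclideanSpace ℝ (Fin 4))
    (η : Fin 2 → ℂ) :
    curvature (S.connIn i x₀) y u v η =
      ((S.scalar i ((extChartAt (𝓡 4) x₀).symm y) / 24 : ℝ) : ℂ) •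
      (wedgeSD (toM fun a => S.coframeIn i x₀ a y u)
        (toM fun a => S.coframeIn i x₀ a y v) *ᵥ η) := by
  conv_lhs => rw [← sum_coframeIn_smul_frameIn hy u, ← sum_coframeIn_smul_frameIn hy v]
  rw [curvature_sum_left]
  simp only [curvature_sum_right, curvature_connIn_frameIn hy]
  rw [← Matrix.smul_mulVec, ← spinLift_riemann hE hA hy.2, Matrix.sum_mulVec, sum_apply]
  refine Finset.sum_congr rfl fun a _ => ?_
  rw [Matrix.sum_mulVec, smul_apply, sum_apply, Finset.smul_sum]
  refine Finset.sum_congr rfl fun b _ => ?_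
  rw [smul_apply, smul_smul, Matrix.smul_mulVec]
  rfl

end SpinStructure

/-! ### Change of the spin frame -/

/-- The derivative of a curve of rotations which is covered by a curve in `SU(2) × SU(2)`. -/
theorem toM_deriv {L : ℝ → Matrix (Fin 4) (Fin 4) ℝ} {A B : ℝ → Matrix (Fin 2) (Fin 2) ℂ}
    {dL : Matrix (Fin 4) (Fin 4) ℝ} {dA dB : Matrix (Fin 2) (Fin 2) ℂ}
    (hL : ∀ a k, HasDerivAt (fun s => L s a k) (dL a k) 0)
    (hA : ∀ r q, HasDerivAt (fun s => A s r q) (dA r q) 0)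
    (hB : ∀ r q, HasDerivAt (fun s => B s r q) (dB r q) 0)
    (h : ∀ᶠ s in 𝓝 (0 : ℝ), ∀ u, toM (L s *ᵥ u) = A s * toM u * (B s)ᴴ) (u : Fin 4 → ℝ) :
    toM (dL *ᵥ u) = dA * toM u * (B 0)ᴴ + A 0 * toM u * dBᴴ := by
  ext r q
  have h1 : HasDerivAt (fun s => toM (L s *ᵥ u) r q) (toM (dL *ᵥ u) r q) 0 := by
    simp only [toM, Matrix.sum_apply, Matrix.smul_apply, smul_eq_mul, Matrix.mulVec, dotProduct]
    refine HasDerivAt.fun_sum fun a _ => HasDerivAt.mul_const ?_ _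
    exact (HasDerivAt.fun_sum fun k _ => (hL a k).mul_const _).ofReal_comp
  have hBs : ∀ r q, HasDerivAt (fun s => (B s)ᴴ r q) (dBᴴ r q) 0 := fun r q => (hB q r).star
  have h2 : HasDerivAt (fun s => (A s * toM u * (B s)ᴴ) r q)
      ((dA * toM u * (B 0)ᴴ + A 0 * toM u * dBᴴ) r q) 0 := by
    have e : (dA * toM u * (B 0)ᴴ + A 0 * toM u * dBᴴ) r q =
        ∑ j, ((∑ k, dA r k * toM u k j) * (B 0)ᴴ j q + (∑ k, A 0 r k * toM u k j) * dBᴴ j q) := by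
      simp only [Matrix.add_apply, Matrix.mul_apply, Finset.sum_add_distrib]
    rw [e]
    simp only [Matrix.mul_apply]
    exact HasDerivAt.fun_sum fun j _ =>
      (HasDerivAt.fun_sum fun k _ => (hA r k).mul_const _).mul (hBs j q)
  refine h1.unique (h2.congr_of_eventuallyEq ?_)
  filter_upwards [h] with s hs
  rw [hs]

/-- The logarithmic derivative of a curve in `SU(2)` has trace zero. -/
theorem trace_deriv_specialUnitary {A : ℝ → Matrix (Fin 2) (Fin 2) ℂ}
    {dA : Matrix (Fin 2) (Fin 2) ℂ} (hA : ∀ r q, HasDerivAt (fun s => A s r q) (dA r q) 0)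
    (h : ∀ᶠ s in 𝓝 (0 : ℝ), (A s).det = 1) (hu : (A 0)ᴴ * A 0 = 1) :
    (dAᵀ * (A 0).map star).trace = 0 := by
  have h0 : (A 0).det = 1 := h.self_of_nhds
  have hadj : (A 0)ᴴ = (A 0).adjugate := by
    have h1 : (A 0) * (A 0).adjugate = 1 := by rw [Matrix.mul_adjugate, h0, one_smul]
    calc (A 0)ᴴ = (A 0)ᴴ * (A 0 * (A 0).adjugate) := by rw [h1, Matrix.mul_one]
      _ = _ := by rw [← Matrix.mul_assoc, hu, Matrix.one_mul]
  rw [Matrix.adjugate_fin_two] at hadj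
  have e : ∀ r q, star (A 0 q r) = !![A 0 1 1, -A 0 0 1; -A 0 1 0, A 0 0 0] r q := fun r q => by
    rw [← hadj, Matrix.conjTranspose_apply]
  have e00 := e 0 0
  have e01 := e 0 1
  have e10 := e 1 0
  have e11 := e 1 1
  have hd := (((hA 0 0).mul (hA 1 1)).sub ((hA 0 1).mul (hA 1 0)))
  have hd0 : HasDerivAt (fun s => A s 0 0 * A s 1 1 - A s 0 1 * A s 1 0) 0 0 := by
    refine (hasDerivAt_const (0 : ℝ) (1 : ℂ)).congr_of_eventuallyEq ?_
    filter_upwards [h] with s hs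
    rw [← Matrix.det_fin_two, hs]
  have := hd.unique hd0
  simp only [Matrix.trace_fin_two, Matrix.mul_apply, Fin.sum_univ_two, Matrix.transpose_apply,
    Matrix.map_apply, e00, e01, e10, e11]
  simp
  linear_combination this

/-- The identity behind the transformation of the Levi-Civita connection under the change of frame
`L`: here `Γ` and `D` have the same torsion, and `dL k` is the derivative of `L` along `e_k`. -/
theorem torsion_change (L : Matrix (Fin 4) (Fin 4) ℝ) (dL : Fin 4 → Matrix (Fin 4) (Fin 4) ℝ)
    (Γ D : Fin 4 → Fin 4 → Fin 4 → ℝ)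
    (h : ∀ k m l, Γ k m l - Γ m k l = D k m l - D m k l) (d a c : Fin 4) :
    (∑ l, L c l * (∑ k, ∑ m, L d k * L a m * Γ k m l + ∑ k, L d k * dL k a l))
      - (∑ l, L c l * (∑ k, ∑ m, L a k * L d m * Γ k m l + ∑ k, L a k * dL k d l)) =
    ∑ l, L c l * ((∑ k, L d k * dL k a l + ∑ m, ∑ k, L a m * L d k * D k m l) -
      (∑ k, L a k * dL k d l + ∑ m, ∑ k, L d m * L a k * D k m l)) := by
  rw [← Finset.sum_sub_distrib]
  refine Finset.sum_congr rfl fun l _ => ?_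
  rw [← mul_sub]
  congr 1
  have e1 : ∑ k, ∑ m, L a k * L d m * Γ k m l = ∑ k, ∑ m, L d k * L a m * Γ m k l := by
    rw [Finset.sum_comm]
    exact Finset.sum_congr rfl fun k _ => Finset.sum_congr rfl fun m _ => by ring
  have e2 : ∑ m, ∑ k, L a m * L d k * D k m l = ∑ k, ∑ m, L d k * L a m * D k m l := by
    rw [Finset.sum_comm]
    exact Finset.sum_congr rfl fun k _ => Finset.sum_congr rfl fun m _ => by ring
  have e3 : ∑ m, ∑ k, L d m * L a k * D k m l = ∑ k, ∑ m, L d k * L a m * D m k l := rfl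
  have e4 : ∑ k, ∑ m, L d k * L a m * Γ k m l - ∑ k, ∑ m, L d k * L a m * Γ m k l =
      ∑ k, ∑ m, L d k * L a m * D k m l - ∑ k, ∑ m, L d k * L a m * D m k l := by
    simp only [← Finset.sum_sub_distrib, ← mul_sub, h]
  rw [e1, e2, e3]
  linarith

namespace SpinStructure

variable {g : Metric4 X} {S : SpinStructure g}

variable (S) in
/-- The transition matrix from the frame `i` to the frame `j`. -/
def transition (i j : S.ι) (x : X) : Matrix (Fin 4) (Fin 4) ℝ :=
  Matrix.of fun c k => g.inner x (S.frame j c x) (S.frame i k x)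

theorem transition_mulVec_coords {i : S.ι} (j : S.ι) {x : X} (hi : x ∈ S.U i)
    (v : TangentSpace (𝓡 4) x) : S.transition i j x *ᵥ S.coords i x v = S.coords j x v := by
  ext c
  conv_rhs => rw [← S.sum_coords_smul_frame hi v]
  simp only [Matrix.mulVec, dotProduct, transition, Matrix.of_apply, coords]
  rw [map_sum]
  simp only [map_smul, smul_eq_mul]
  exact Finset.sum_congr rfl fun a _ => mul_comm _ _

theorem coords_frame {i : S.ι} (j : S.ι) {x : X} (c k : Fin 4) :
    S.coords i x (S.frame j c x) k = S.transition i j x c k := g.symm _ _ _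

theorem frame_eq_sum {i : S.ι} (j : S.ι) {x : X} (hi : x ∈ S.U i) (c : Fin 4) :
    S.frame j c x = ∑ k, S.transition i j x c k • S.frame i k x := by
  conv_lhs => rw [← S.sum_coords_smul_frame hi (S.frame j c x)]
  simp only [coords_frame]

theorem transition_mul_transpose {i j : S.ι} {x : X} (hi : x ∈ S.U i) (hj : x ∈ S.U j) :
    S.transition i j x * (S.transition i j x)ᵀ = 1 := by
  ext c a
  have h := congrFun (transition_mulVec_coords j hi (S.frame j a x)) c
  have h2 : S.coords j x (S.frame j a x) c = (1 : Matrix (Fin 4) (Fin 4) ℝ) c a := by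
    rw [Matrix.one_apply]; exact S.frame_orthonormal j x hj c a
  rw [← h2, ← h]
  simp only [Matrix.mul_apply, Matrix.mulVec, dotProduct, coords_frame, Matrix.transpose_apply]

theorem transition_transpose_mul {i j : S.ι} {x : X} (hi : x ∈ S.U i) (hj : x ∈ S.U j) :
    (S.transition i j x)ᵀ * S.transition i j x = 1 :=
  mul_eq_one_comm.1 (transition_mul_transpose hi hj)

theorem conjTranspose_mul_self (A : Matrix.specialUnitaryGroup (Fin 2) ℂ) :
    (A : Matrix (Fin 2) (Fin 2) ℂ)ᴴ * (A : Matrix (Fin 2) (Fin 2) ℂ) = 1 :=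
  Matrix.mem_unitaryGroup_iff'.1 (Matrix.mem_specialUnitaryGroup_iff.1 A.2).1

theorem inv_eq_conjTranspose (A : Matrix.specialUnitaryGroup (Fin 2) ℂ) :
    (A : Matrix (Fin 2) (Fin 2) ℂ)⁻¹ = (A : Matrix (Fin 2) (Fin 2) ℂ)ᴴ :=
  Matrix.inv_eq_left_inv (conjTranspose_mul_self A)

theorem toM_transition {i j : S.ι} {x : X} (hi : x ∈ S.U i) (hj : x ∈ S.U j) (u : Fin 4 → ℝ) :
    toM (S.transition i j x *ᵥ u) =
      (S.A i j x : Matrix (Fin 2) (Fin 2) ℂ) * toM u * (S.B i j x : Matrix (Fin 2) (Fin 2) ℂ)ᴴ := by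
  have hu : S.coords i x (∑ a, u a • S.frame i a x) = u := by
    ext b
    simp only [coords]
    rw [map_sum]
    have h : ∀ a, g.inner x (S.frame i b x) (S.frame i a x) = if b = a then 1 else 0 := fun a =>
      S.frame_orthonormal i x hi b a
    simp only [map_smul, h]
    simp
  have := S.compat i j x ⟨hi, hj⟩ (∑ a, u a • S.frame i a x)
  rw [inv_eq_conjTranspose] at this
  change toM (S.coords j x _) = _ * toM (S.coords i x _) * _ at this
  rwa [← transition_mulVec_coords j hi, hu] at this

section InChart

variable {i j : S.ι} {x₀ : X} {y : EuclideanSpace ℝ (Fin 4)}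

theorem transition_symm (hj : y ∈ S.domIn j x₀) (c k : Fin 4) :
    S.transition i j ((extChartAt (𝓡 4) x₀).symm y) c k =
      S.coframeIn j x₀ c y (S.frameIn i x₀ k y) := by
  rw [frameIn, coframeIn_mpullback hj]
  rfl

theorem contDiffAt_transition (hi : y ∈ S.domIn i x₀) (hj : y ∈ S.domIn j x₀) (c k : Fin 4) :
    ContDiffAt ℝ ∞ (fun y => S.transition i j ((extChartAt (𝓡 4) x₀).symm y) c k) y := by
  refine ((contDiffAt_coframeIn hj c).clm_apply (contDiffAt_frameIn hi k)).congr_of_eventuallyEq ?_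
  filter_upwards [(S.isOpen_domIn j x₀).mem_nhds hj] with z hz
  exact transition_symm hz c k

theorem frameIn_eq_sum (hi : y ∈ S.domIn i x₀) (c : Fin 4) :
    S.frameIn j x₀ c y =
      ∑ k, S.transition i j ((extChartAt (𝓡 4) x₀).symm y) c k • S.frameIn i x₀ k y := by
  conv_lhs => rw [frameIn, mpullback_apply, frame_eq_sum j hi.2, map_sum]
  refine Finset.sum_congr rfl fun k _ => ?_
  rw [map_smul]
  rfl

theorem coframeIn_eq_sum (hi : y ∈ S.domIn i x₀) (c : Fin 4) (v : EuclideanSpace ℝ (Fin 4)) :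
    S.coframeIn j x₀ c y v =
      ∑ k, S.transition i j ((extChartAt (𝓡 4) x₀).symm y) c k * S.coframeIn i x₀ k y v :=
  (congrFun (transition_mulVec_coords j hi.2
    (mfderiv 𝓘(ℝ, EuclideanSpace ℝ (Fin 4)) (𝓡 4) (extChartAt (𝓡 4) x₀).symm y v)) c).symm

variable (S i j x₀ y) in
/-- The derivative of the transition matrix along the frame vector `e_k`. -/
def dTransition (k : Fin 4) : Matrix (Fin 4) (Fin 4) ℝ := Matrix.of fun a l =>
  fderiv ℝ (fun y => S.transition i j ((extChartAt (𝓡 4) x₀).symm y) a l) y (S.frameIn i x₀ k y)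

/-- The rows of the transition matrix `L` are orthonormal, so that `dL Lᵗ` is skew. -/
theorem sum_transition_mul_dTransition (hi : y ∈ S.domIn i x₀) (hj : y ∈ S.domIn j x₀)
    (k a c : Fin 4) :
    ∑ l, (S.transition i j ((extChartAt (𝓡 4) x₀).symm y) c l * S.dTransition i j x₀ y k a l
      + S.transition i j ((extChartAt (𝓡 4) x₀).symm y) a l * S.dTransition i j x₀ y k c l) =
      0 := by
  have hLd : ∀ a l, DifferentiableAt ℝ
      (fun y => S.transition i j ((extChartAt (𝓡 4) x₀).symm y) a l) y := fun a l =>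
    (contDiffAt_transition hi hj a l).differentiableAt (by simp)
  have h1 : HasFDerivAt (fun y => ∑ l, S.transition i j ((extChartAt (𝓡 4) x₀).symm y) c l *
    S.transition i j ((extChartAt (𝓡 4) x₀).symm y) a l) _ y :=
    HasFDerivAt.fun_sum (u := Finset.univ) fun l _ =>
      (hLd c l).hasFDerivAt.mul (hLd a l).hasFDerivAt
  have h2 : HasFDerivAt (fun y => ∑ l, S.transition i j ((extChartAt (𝓡 4) x₀).symm y) c l *
    S.transition i j ((extChartAt (𝓡 4) x₀).symm y) a l)
    (0 : EuclideanSpace ℝ (Fin 4) →L[ℝ] ℝ) y := by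
    refine (hasFDerivAt_const ((1 : Matrix (Fin 4) (Fin 4) ℝ) c a) y).congr_of_eventuallyEq ?_
    filter_upwards [(S.isOpen_domIn i x₀).mem_nhds hi, (S.isOpen_domIn j x₀).mem_nhds hj]
      with z hz hz'
    rw [← transition_mul_transpose hz.2 hz'.2, Matrix.mul_apply]
    rfl
  have h3 := congrArg (fun T : EuclideanSpace ℝ (Fin 4) →L[ℝ] ℝ => T (S.frameIn i x₀ k y))
    (h1.unique h2)
  simp only [sum_apply, add_apply, smul_apply, smul_eq_mul, zero_apply] at h3
  exact h3

/-- The transformation of the Levi-Civita connection under a change of frame. -/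
theorem leviCivita_change (hi : y ∈ S.domIn i x₀) (hj : y ∈ S.domIn j x₀) (d a c : Fin 4) :
    S.leviCivita j d a c ((extChartAt (𝓡 4) x₀).symm y) =
      ∑ l, S.transition i j ((extChartAt (𝓡 4) x₀).symm y) c l *
      (∑ k, ∑ m, S.transition i j ((extChartAt (𝓡 4) x₀).symm y) d k *
        S.transition i j ((extChartAt (𝓡 4) x₀).symm y) a m *
          S.leviCivita i k m l ((extChartAt (𝓡 4) x₀).symm y)
        + ∑ k, S.transition i j ((extChartAt (𝓡 4) x₀).symm y) d k *
          S.dTransition i j x₀ y k a l) := by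
  set x := (extChartAt (𝓡 4) x₀).symm y with hx
  set L := S.transition i j x with hL
  set dL := S.dTransition i j x₀ y with hdL
  symm
  have hLd : ∀ a l, DifferentiableAt ℝ
      (fun y => S.transition i j ((extChartAt (𝓡 4) x₀).symm y) a l) y := fun a l =>
    (contDiffAt_transition hi hj a l).differentiableAt (by simp)
  have hfd : ∀ m, DifferentiableAt ℝ (S.frameIn i x₀ m) y := fun m =>
    (contDiffAt_frameIn hi m).differentiableAt (by simp)
  have hskewL : ∀ k a c, ∑ l, (L c l * dL k a l + L a l * dL k c l) = 0 := fun k a c =>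
    sum_transition_mul_dTransition hi hj k a c
  -- the derivative of the second frame
  have hfder : ∀ a u, fderiv ℝ (S.frameIn j x₀ a) y u =
      ∑ m, (fderiv ℝ (fun y => S.transition i j ((extChartAt (𝓡 4) x₀).symm y) a m) y u •
        S.frameIn i x₀ m y + L a m • fderiv ℝ (S.frameIn i x₀ m) y u) := by
    intro a u
    have h1 : S.frameIn j x₀ a =ᶠ[𝓝 y] fun y =>
        ∑ m, S.transition i j ((extChartAt (𝓡 4) x₀).symm y) a m • S.frameIn i x₀ m y := by
      filter_upwards [(S.isOpen_domIn i x₀).mem_nhds hi] with z hz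
      exact frameIn_eq_sum hz a
    have h2 : HasFDerivAt (fun y =>
        ∑ m, S.transition i j ((extChartAt (𝓡 4) x₀).symm y) a m • S.frameIn i x₀ m y) _ y :=
      HasFDerivAt.fun_sum (u := Finset.univ) fun m _ =>
        (hLd a m).hasFDerivAt.smul (hfd m).hasFDerivAt
    rw [(h2.congr_of_eventuallyEq h1).fderiv, sum_apply]
    refine Finset.sum_congr rfl fun m _ => ?_
    rw [add_comm]
    rfl
  let D : Fin 4 → Fin 4 → Fin 4 → ℝ := fun k m l =>
    S.coframeIn i x₀ l y (fderiv ℝ (S.frameIn i x₀ m) y (S.frameIn i x₀ k y))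
  have hD : ∀ k m l, S.leviCivita i k m l x - S.leviCivita i m k l x = D k m l - D m k l := by
    intro k m l
    rw [leviCivita_torsion, hx, bracketCoeff_symm hi, lieBracket, map_sub]
  have hDj : ∀ d a l, S.coframeIn i x₀ l y (fderiv ℝ (S.frameIn j x₀ a) y (S.frameIn j x₀ d y)) =
      ∑ k, L d k * dL k a l + ∑ m, ∑ k, L a m * L d k * D k m l := by
    intro d a l
    rw [hfder, frameIn_eq_sum hi d]
    simp only [map_sum, map_add, map_smul, smul_eq_mul, coframeIn_frameIn hi,
      Finset.sum_add_distrib]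
    congr 1
    · simp only [mul_ite, mul_one, mul_zero, Finset.sum_ite_eq, Finset.mem_univ, if_true]
      rfl
    · simp only [Finset.mul_sum, mul_assoc]
      rfl
  refine eq_leviCivita j x (fun d a c => ∑ l, L c l *
      (∑ k, ∑ m, L d k * L a m * S.leviCivita i k m l x + ∑ k, L d k * dL k a l)) ?_ ?_ d a c
  · intro d a c
    have e1 : ∀ a c, ∑ l, L c l * (∑ k, ∑ m, L d k * L a m * S.leviCivita i k m l x
        + ∑ k, L d k * dL k a l) = ∑ k, L d k * (∑ l, ∑ m, L c l * L a m * S.leviCivita i k m l x)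
          + ∑ k, L d k * ∑ l, L c l * dL k a l := by
      intro a c
      simp only [mul_add, Finset.sum_add_distrib, Finset.mul_sum]
      congr 1
      · rw [Finset.sum_comm]
        refine Finset.sum_congr rfl fun k _ => Finset.sum_congr rfl fun l _ =>
          Finset.sum_congr rfl fun m _ => ?_
        ring
      · rw [Finset.sum_comm]
        refine Finset.sum_congr rfl fun k _ => Finset.sum_congr rfl fun l _ => ?_
        ring
    have e2 : ∀ k, ∑ l, ∑ m, L c l * L a m * S.leviCivita i k m l x =
        - ∑ l, ∑ m, L a l * L c m * S.leviCivita i k m l x := by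
      intro k
      rw [Finset.sum_comm]
      simp only [← Finset.sum_neg_distrib]
      refine Finset.sum_congr rfl fun l _ => Finset.sum_congr rfl fun m _ => ?_
      rw [leviCivita_skew]
      ring
    have e3 : ∀ k, ∑ l, L c l * dL k a l = - ∑ l, L a l * dL k c l := by
      intro k
      have := hskewL k a c
      rw [Finset.sum_add_distrib] at this
      linarith
    simp only [e1]
    simp only [e2, e3, mul_neg, Finset.sum_neg_distrib]
    ring
  · intro d a c
    rw [torsion_change L dL (fun k m l => S.leviCivita i k m l x) D hD, hx, bracketCoeff_symm hj,
      lieBracket, coframeIn_eq_sum hi]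
    refine Finset.sum_congr rfl fun l _ => ?_
    rw [map_sub, hDj, hDj]

end InChart
variable (S) in
/-- The transition function `B` with values in the vector space of matrices. -/
def matB (i j : S.ι) (x : X) : Fin 2 → Fin 2 → ℂ := fun r s =>
  (S.B i j x : Matrix (Fin 2) (Fin 2) ℂ) r s

variable (S) in
/-- The transition function `A` with values in the vector space of matrices. -/
def matA (i j : S.ι) (x : X) : Fin 2 → Fin 2 → ℂ := fun r s =>
  (S.A i j x : Matrix (Fin 2) (Fin 2) ℂ) r s

theorem mdifferentiableAt_matB {i j : S.ι} {x : X} (hi : x ∈ S.U i) (hj : x ∈ S.U j) :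
    MDifferentiableAt (𝓡 4) 𝓘(ℝ, Fin 2 → Fin 2 → ℂ) (S.matB i j) x := by
  have h : ContMDiffOn (𝓡 4) 𝓘(ℝ, Fin 2 → Fin 2 → ℂ) ∞ (S.matB i j) (S.U i ∩ S.U j) :=
    contMDiffOn_pi_space.2 fun r => contMDiffOn_pi_space.2 fun s => S.B_smooth i j r s
  exact (h.contMDiffAt (((S.isOpen_U i).inter (S.isOpen_U j)).mem_nhds ⟨hi, hj⟩)).mdifferentiableAt
    (by simp)

theorem mdifferentiableAt_matA {i j : S.ι} {x : X} (hi : x ∈ S.U i) (hj : x ∈ S.U j) :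
    MDifferentiableAt (𝓡 4) 𝓘(ℝ, Fin 2 → Fin 2 → ℂ) (S.matA i j) x := by
  have h : ContMDiffOn (𝓡 4) 𝓘(ℝ, Fin 2 → Fin 2 → ℂ) ∞ (S.matA i j) (S.U i ∩ S.U j) :=
    contMDiffOn_pi_space.2 fun r => contMDiffOn_pi_space.2 fun s => S.A_smooth i j r s
  exact (h.contMDiffAt (((S.isOpen_U i).inter (S.isOpen_U j)).mem_nhds ⟨hi, hj⟩)).mdifferentiableAt
    (by simp)

/-- The derivative of a map to a vector space at a point of `X`, without the identifications of the
tangent spaces of the vector space. -/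
def vecDeriv {F : Type*} [NormedAddCommGroup F] [NormedSpace ℝ F] (f : X → F) (x : X) :
    TangentSpace (𝓡 4) x →L[ℝ] F := mfderiv (𝓡 4) 𝓘(ℝ, F) f x

theorem hasLineDerivAt_symm {F : Type*} [NormedAddCommGroup F] [NormedSpace ℝ F] {i : S.ι} {x₀ : X}
    {y : EuclideanSpace ℝ (Fin 4)} (hy : y ∈ S.domIn i x₀) {f : X → F}
    (hf : MDifferentiableAt (𝓡 4) 𝓘(ℝ, F) f ((extChartAt (𝓡 4) x₀).symm y)) (k : Fin 4) :
    HasLineDerivAt ℝ (fun y => f ((extChartAt (𝓡 4) x₀).symm y))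
      (vecDeriv f ((extChartAt (𝓡 4) x₀).symm y) (S.frame i k ((extChartAt (𝓡 4) x₀).symm y)))
      y (S.frameIn i x₀ k y) := by
  have hd : DifferentiableAt ℝ (fun y => f ((extChartAt (𝓡 4) x₀).symm y)) y :=
    (hf.comp y (mdifferentiableAt_extChartAt_symm (I := 𝓡 4) hy.1)).differentiableAt
  have := hd.hasFDerivAt.hasLineDerivAt (S.frameIn i x₀ k y)
  rwa [fderiv_symm_apply hy.1 hf, frameIn, mfderiv_mpullback hy.1] at this

/-- The transformation of the connection of `𝕊'` under a change of frame: the inhomogeneous term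
of the Levi-Civita connection lifts to the one of the representation `B̄`. -/
theorem spinConn_change {i j : S.ι} {x : X} (hi : x ∈ S.U i) (hj : x ∈ S.U j) (d : Fin 4) :
    S.spinConn j d x = ∑ k, S.transition i j x d k •
      ((S.B i j x : Matrix (Fin 2) (Fin 2) ℂ).map star * S.spinConn i k x
          - (Matrix.of (vecDeriv (S.matB i j) x (S.frame i k x))).map star) *
        (S.B i j x : Matrix (Fin 2) (Fin 2) ℂ)ᵀ := by
  set y := extChartAt (𝓡 4) x x with hy
  have hyi : y ∈ S.domIn i x := S.mem_domIn hi
  have hyj : y ∈ S.domIn j x := S.mem_domIn hj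
  have hxy : (extChartAt (𝓡 4) x).symm y = x := extChartAt_to_inv x
  set L := S.transition i j x with hL
  set A : Matrix (Fin 2) (Fin 2) ℂ := (S.A i j x : Matrix (Fin 2) (Fin 2) ℂ) with hA
  set B : Matrix (Fin 2) (Fin 2) ℂ := (S.B i j x : Matrix (Fin 2) (Fin 2) ℂ) with hB
  set dL := S.dTransition i j x y with hdL
  let dA : Fin 4 → Matrix (Fin 2) (Fin 2) ℂ := fun k =>
    Matrix.of (vecDeriv (S.matA i j) x (S.frame i k x))
  let dB : Fin 4 → Matrix (Fin 2) (Fin 2) ℂ := fun k =>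
    Matrix.of (vecDeriv (S.matB i j) x (S.frame i k x))
  have hAA : Aᴴ * A = 1 := conjTranspose_mul_self _
  have hLu : ∀ u, toM (L *ᵥ u) = A * toM u * Bᴴ := toM_transition hi hj
  -- the derivatives along `e_k`, as derivatives of curves
  have hline : ∀ k, spinLift (dL k * Lᵀ) = (dB k).map star * Bᵀ := by
    intro k
    let γ : ℝ → X := fun s => (extChartAt (𝓡 4) x).symm (y + s • S.frameIn i x k y)
    have hγ0 : γ 0 = x := by simp only [γ, zero_smul, add_zero, hxy]
    have hdom : ∀ᶠ s in 𝓝 (0 : ℝ), γ s ∈ S.U i ∩ S.U j := by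
      have hc : ContinuousAt (fun s : ℝ => y + s • S.frameIn i x k y) 0 := by fun_prop
      have hn : S.domIn i x ∩ S.domIn j x ∈ 𝓝 (y + (0 : ℝ) • S.frameIn i x k y) := by
        rw [zero_smul, add_zero]
        exact ((S.isOpen_domIn i x).inter (S.isOpen_domIn j x)).mem_nhds ⟨hyi, hyj⟩
      filter_upwards [hc.eventually hn] with s hs
      exact ⟨hs.1.2, hs.2.2⟩
    have hLd : ∀ a l, HasDerivAt (fun s => S.transition i j (γ s) a l) (dL k a l) 0 := fun a l =>
      ((contDiffAt_transition hyi hyj a l).differentiableAt (by simp)).hasFDerivAt.hasLineDerivAt _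
    have hAd : ∀ r q, HasDerivAt (fun s => (S.A i j (γ s) : Matrix (Fin 2) (Fin 2) ℂ) r q)
        (dA k r q) 0 := by
      intro r q
      have h : HasDerivAt (fun s => S.matA i j (γ s)) (dA k) 0 := by
        have := hasLineDerivAt_symm hyi (f := S.matA i j)
          (by rw [hxy]; exact mdifferentiableAt_matA hi hj) k
        rw [hxy] at this
        exact this
      exact hasDerivAt_pi.1 (hasDerivAt_pi.1 h r) q
    have hBd : ∀ r q, HasDerivAt (fun s => (S.B i j (γ s) : Matrix (Fin 2) (Fin 2) ℂ) r q)
        (dB k r q) 0 := by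
      intro r q
      have h : HasDerivAt (fun s => S.matB i j (γ s)) (dB k) 0 := by
        have := hasLineDerivAt_symm hyi (f := S.matB i j)
          (by rw [hxy]; exact mdifferentiableAt_matB hi hj) k
        rw [hxy] at this
        exact this
      exact hasDerivAt_pi.1 (hasDerivAt_pi.1 h r) q
    have h1 := toM_deriv hLd hAd hBd (by
      filter_upwards [hdom] with s hs
      exact toM_transition hs.1 hs.2)
    have h2 := trace_deriv_specialUnitary hAd (Eventually.of_forall fun s =>
      (Matrix.mem_specialUnitaryGroup_iff.1 (S.A i j (γ s)).2).2) (by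
        rw [hγ0]; exact hAA)
    simp only [hγ0] at h1 h2
    exact spinLift_deriv hAA hLu h1 h2
  have hW : (Matrix.of fun c a => S.leviCivita j d a c x) = ∑ k, L d k •
      (L * (Matrix.of fun c a => S.leviCivita i k a c x) * Lᵀ - dL k * Lᵀ) := by
    have hskew : ∀ k a c, (L * (dL k)ᵀ) c a = -(dL k * Lᵀ) c a := by
      intro k a c
      have := sum_transition_mul_dTransition hyi hyj k a c
      rw [hxy, Finset.sum_add_distrib] at this
      have e2 : (dL k * Lᵀ) c a = ∑ l, L a l * dL k c l := by
        simp only [Matrix.mul_apply, Matrix.transpose_apply, mul_comm]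
      have e1 : (L * (dL k)ᵀ) c a = ∑ l, L c l * dL k a l := by
        simp only [Matrix.mul_apply, Matrix.transpose_apply]
      rw [e1, e2]
      linarith
    ext c a
    have h := leviCivita_change hyi hyj d a c
    rw [hxy] at h
    have hM : ∀ k, (L * (Matrix.of fun c a => S.leviCivita i k a c x) * Lᵀ - dL k * Lᵀ) c a =
        ∑ l, L c l * (∑ m, L a m * S.leviCivita i k m l x + dL k a l) := by
      intro k
      have e1 : (L * (Matrix.of fun c a => S.leviCivita i k a c x) * Lᵀ) c a =
          ∑ l, L c l * ∑ m, L a m * S.leviCivita i k m l x := by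
        simp only [Matrix.mul_apply, Matrix.transpose_apply, Matrix.of_apply, Finset.mul_sum,
          Finset.sum_mul]
        rw [Finset.sum_comm]
        exact Finset.sum_congr rfl fun l _ => Finset.sum_congr rfl fun m _ => by ring
      have e2 : -(dL k * Lᵀ) c a = ∑ l, L c l * dL k a l := by
        rw [← hskew]
        simp only [Matrix.mul_apply, Matrix.transpose_apply]
      rw [Matrix.sub_apply, sub_eq_add_neg, e1, e2, ← Finset.sum_add_distrib]
      exact Finset.sum_congr rfl fun l _ => (mul_add _ _ _).symm
    rw [Matrix.of_apply, h, Matrix.sum_apply]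
    simp only [Matrix.smul_apply, smul_eq_mul, hM]
    simp only [Finset.mul_sum]
    rw [Finset.sum_comm]
    refine Finset.sum_congr rfl fun l _ => ?_
    rw [← Finset.sum_add_distrib, Finset.mul_sum]
    refine Finset.sum_congr rfl fun k _ => ?_
    simp only [mul_assoc, ← Finset.mul_sum]
    change L c l * (L d k * _ + L d k * dL k a l) = _
    ring
  rw [spinConn, hW, ← spinLiftL_apply, map_sum]
  refine Finset.sum_congr rfl fun k _ => ?_
  rw [map_smul, map_sub, spinLiftL_apply, spinLiftL_apply, hline, spinLift_conj hAA hLu,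
    ← Matrix.sub_mul, Matrix.smul_mul]
  rfl

end SpinStructure

/-! ### The vertical part of a tangent vector -/

/-- The product rule for a bilinear map on a manifold. -/
theorem hasMFDerivAt_bilinear {E H M : Type*} [NormedAddCommGroup E] [NormedSpace ℝ E]
    [TopologicalSpace H] {I : ModelWithCorners ℝ E H} [TopologicalSpace M] [ChartedSpace H M]
    {V P F : Type*} [NormedAddCommGroup V] [NormedSpace ℝ V] [NormedAddCommGroup P]
    [NormedSpace ℝ P] [NormedAddCommGroup F] [NormedSpace ℝ F] (φ : V →L[ℝ] P →L[ℝ] F)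
    {f : M → V} {h : M → P} {q : M} {f' : TangentSpace I q →L[ℝ] V} {h' : TangentSpace I q →L[ℝ] P}
    (hf : HasMFDerivAt I 𝓘(ℝ, V) f q f') (hh : HasMFDerivAt I 𝓘(ℝ, P) h q h') :
    HasMFDerivAt I 𝓘(ℝ, F) (fun q => φ (f q) (h q)) q
      ((φ (f q)).comp h' + (φ.flip (h q)).comp f') := by
  have h1 := φ.isBoundedBilinearMap.hasFDerivAt (f q, h q)
  have h2 : HasMFDerivAt I 𝓘(ℝ, V × P) (fun q => (f q, h q)) q (f'.prod h') :=
    ⟨hf.1.prodMk hh.1, hf.2.prodMk hh.2⟩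
  have h3 := h1.hasMFDerivAt.comp q h2
  exact h3

namespace SpinStructure

variable {g : Metric4 X} {S : SpinStructure g}

/-- The fibre coordinates in the frames `i` and `j` are related by `B̄`. -/
theorem fiberCoord_change {i j : S.ι} {q : S.Total} (hi : q.proj ∈ S.U i) (hj : q.proj ∈ S.U j) :
    S.fiberCoord j q = conjActionL (S.matB i j q.proj) (S.fiberCoord i q) :=
  (S.core.coordChange_comp (S.indexAt q.proj) i j q.proj ⟨⟨S.mem_U _, hi⟩, hj⟩ q.2).symm

theorem eventually_proj_mem {i : S.ι} {q : S.Total} (hi : q.proj ∈ S.U i) :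
    ∀ᶠ q' in 𝓝 q, q'.proj ∈ S.U i :=
  (S.core.continuous_proj.continuousAt (x := q)).eventually ((S.isOpen_U i).mem_nhds hi)

theorem mdifferentiableAt_proj (q : S.Total) :
    MDifferentiableAt modelTotal (𝓡 4) (fun q : S.Total => q.proj) q :=
  ((Bundle.contMDiff_proj (n := 1) (IB := 𝓡 4) S.core.Fiber) q).mdifferentiableAt one_ne_zero

theorem mdifferentiableAt_fiberCoord {i : S.ι} {q : S.Total} (hi : q.proj ∈ S.U i) :
    MDifferentiableAt modelTotal 𝓘(ℝ, Fin 2 → ℂ) (S.fiberCoord i) q := by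
  have hp : q ∈ (S.core.localTriv i).source := by rwa [S.core.mem_localTriv_source]
  have : MemTrivializationAtlas (S.core.localTriv i) := ⟨Set.mem_range_self _⟩
  have he := Bundle.Trivialization.mdifferentiable (I := 𝓡 4) S.core.Fiber (S.core.localTriv i)
  exact (mdifferentiableAt_snd (I := 𝓡 4) (I' := 𝓘(ℝ, Fin 2 → ℂ))).comp q
    (he.mdifferentiableAt hp)

variable (S) in
/-- The differentials `dπ^{A'}` of the fibre coordinates in the frame `i`. -/
def dFiberAt (i : S.ι) (q : S.Total) : TangentSpace modelTotal q →L[ℝ] (Fin 2 → ℂ) :=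
  mfderiv modelTotal 𝓘(ℝ, Fin 2 → ℂ) (S.fiberCoord i) q

variable (S) in
/-- The vertical part `δπ^{A'}` of a tangent vector in the frame `i`. -/
def deltaPiAt (i : S.ι) (q : S.Total) : TangentSpace modelTotal q →L[ℝ] (Fin 2 → ℂ) :=
  S.dFiberAt i q + ∑ c, ((g.inner q.proj (S.frame i c q.proj)).comp (S.dProj q)).smulRight
    (S.spinConn i c q.proj *ᵥ S.fiberCoord i q)

theorem deltaPiAt_indexAt (q : S.Total) : S.deltaPiAt (S.indexAt q.proj) q = S.deltaPi q := rfl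

theorem deltaPiAt_apply (i : S.ι) (q : S.Total) (V : TangentSpace modelTotal q) :
    S.deltaPiAt i q V = S.dFiberAt i q V + ∑ c, S.coords i q.proj (S.dProj q V) c •
      (S.spinConn i c q.proj *ᵥ S.fiberCoord i q) := by
  rw [deltaPiAt, add_apply, sum_apply]
  rfl

theorem dFiberAt_change {i j : S.ι} {q : S.Total} (hi : q.proj ∈ S.U i) (hj : q.proj ∈ S.U j)
    (V : TangentSpace modelTotal q) :
    S.dFiberAt j q V = conjActionL (S.matB i j q.proj) (S.dFiberAt i q V)
      + conjActionL (vecDeriv (S.matB i j) q.proj (S.dProj q V)) (S.fiberCoord i q) := by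
  have h1 : HasMFDerivAt modelTotal 𝓘(ℝ, Fin 2 → Fin 2 → ℂ) (fun q : S.Total => S.matB i j q.proj) q
      ((vecDeriv (S.matB i j) q.proj).comp (S.dProj q)) :=
    (mdifferentiableAt_matB hi hj).hasMFDerivAt.comp q (mdifferentiableAt_proj q).hasMFDerivAt
  have h2 : HasMFDerivAt modelTotal 𝓘(ℝ, Fin 2 → ℂ) (S.fiberCoord i) q (S.dFiberAt i q) :=
    (mdifferentiableAt_fiberCoord hi).hasMFDerivAt
  have h3 := hasMFDerivAt_bilinear conjActionL h1 h2
  have h4 : S.fiberCoord j =ᶠ[𝓝 q] fun q => conjActionL (S.matB i j q.proj) (S.fiberCoord i q) := by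
    filter_upwards [eventually_proj_mem hi, eventually_proj_mem hj] with q' h h'
    exact fiberCoord_change h h'
  have h5 := (h3.congr_of_eventuallyEq h4).mfderiv
  exact congrArg (fun T : TangentSpace modelTotal q →L[ℝ] (Fin 2 → ℂ) => T V) h5

/-- `δπ` does not depend on the frame in which it is computed. -/
theorem deltaPiAt_change {i j : S.ι} {q : S.Total} (hi : q.proj ∈ S.U i) (hj : q.proj ∈ S.U j)
    (V : TangentSpace modelTotal q) :
    S.deltaPiAt j q V = conjActionL (S.matB i j q.proj) (S.deltaPiAt i q V) := by
  set x := q.proj with hx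
  set v := S.dProj q V with hv
  set B : Matrix (Fin 2) (Fin 2) ℂ := (S.B i j x : Matrix (Fin 2) (Fin 2) ℂ) with hB
  set L := S.transition i j x with hL
  set η := S.fiberCoord i q with hη
  let dB : Fin 4 → Matrix (Fin 2) (Fin 2) ℂ := fun k =>
    Matrix.of (vecDeriv (S.matB i j) x (S.frame i k x))
  have hact : ∀ ξ, conjActionL (S.matB i j x) ξ = B.map star *ᵥ ξ := fun _ => rfl
  have hBB : Bᵀ * B.map star = 1 := by
    have := congrArg Matrix.transpose (conjTranspose_mul_self (S.B i j x))
    rwa [Matrix.transpose_mul, Matrix.transpose_one, Matrix.conjTranspose, ← Matrix.transpose_map,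
      Matrix.transpose_transpose] at this
  have hd : vecDeriv (S.matB i j) x v = ∑ k, S.coords i x v k •
      vecDeriv (S.matB i j) x (S.frame i k x) := by
    conv_lhs => rw [← S.sum_coords_smul_frame hi v]
    rw [map_sum]
    simp only [map_smul]
  have hterm : ∀ d, S.spinConn j d x *ᵥ (B.map star *ᵥ η) = ∑ k, L d k •
      ((B.map star *ᵥ (S.spinConn i k x *ᵥ η)) - (dB k).map star *ᵥ η) := by
    intro d
    rw [spinConn_change hi hj, Matrix.sum_mulVec]
    refine Finset.sum_congr rfl fun k _ => ?_
    rw [Matrix.smul_mul, Matrix.smul_mulVec, Matrix.mulVec_mulVec, Matrix.mul_assoc, ← hB, hBB,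
      Matrix.mul_one, Matrix.sub_mulVec, Matrix.mulVec_mulVec]
  rw [deltaPiAt_apply, deltaPiAt_apply, dFiberAt_change hi hj, fiberCoord_change hi hj, map_add,
    map_sum]
  simp only [← hx, ← hv, ← hη, hact, hterm]
  have hcL : ∀ k, ∑ d, S.coords j x v d * L d k = S.coords i x v k := by
    intro k
    have h1 : Lᵀ *ᵥ S.coords j x v = S.coords i x v := by
      rw [← transition_mulVec_coords j hi, Matrix.mulVec_mulVec, transition_transpose_mul hi hj,
        Matrix.one_mulVec]
    rw [← h1]
    simp only [Matrix.mulVec, dotProduct, Matrix.transpose_apply, mul_comm]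
  have hsum : ∀ f : Fin 4 → Fin 2 → ℂ, ∑ d, S.coords j x v d • ∑ k, L d k • f k =
      ∑ k, S.coords i x v k • f k := by
    intro f
    simp only [Finset.smul_sum, smul_smul]
    rw [Finset.sum_comm]
    refine Finset.sum_congr rfl fun k _ => ?_
    rw [← Finset.sum_smul, hcL]
  rw [hsum, hd, map_sum, sum_apply]
  simp only [map_smul, smul_apply, smul_sub, Finset.sum_sub_distrib]
  have : ∀ k, conjActionL (vecDeriv (S.matB i j) x (S.frame i k x)) η = (dB k).map star *ᵥ η :=
    fun _ => rfl
  simp only [this, Matrix.mulVec_smul]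
  abel

/-! ### The connection form in a chart of the total space -/

instance : IsManifold modelTotal ∞ S.Total :=
  Bundle.TotalSpace.isManifold (Fin 2 → ℂ) S.core.Fiber

theorem proj_extChartAt_symm (p : S.Total) (z : EuclideanSpace ℝ (Fin 4) × (Fin 2 → ℂ)) :
    ((extChartAt modelTotal p).symm z).proj = (extChartAt (𝓡 4) p.proj).symm z.1 := by
  rw [FiberBundle.extChartAt]
  rfl

theorem extChartAt_total (p q : S.Total) :
    extChartAt modelTotal p q =
      (extChartAt (𝓡 4) p.proj q.proj, S.fiberCoord (S.indexAt p.proj) q) := by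
  rw [FiberBundle.extChartAt]
  rfl

theorem mem_extChartAt_total_target {p : S.Total} {z : EuclideanSpace ℝ (Fin 4) × (Fin 2 → ℂ)}
    (hz : z ∈ (extChartAt modelTotal p).target) : z.1 ∈ S.domIn (S.indexAt p.proj) p.proj := by
  rw [FiberBundle.extChartAt_target] at hz
  exact hz.1

theorem fiberCoord_extChartAt_symm {p : S.Total} {z : EuclideanSpace ℝ (Fin 4) × (Fin 2 → ℂ)}
    (hz : z ∈ (extChartAt modelTotal p).target) :
    S.fiberCoord (S.indexAt p.proj) ((extChartAt modelTotal p).symm z) = z.2 := by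
  have h := (extChartAt modelTotal p).right_inv hz
  rw [extChartAt_total] at h
  exact congrArg Prod.snd h

theorem proj_mem_of_mem_target {p : S.Total} {z : EuclideanSpace ℝ (Fin 4) × (Fin 2 → ℂ)}
    (hz : z ∈ (extChartAt modelTotal p).target) :
    ((extChartAt modelTotal p).symm z).proj ∈ S.U (S.indexAt p.proj) := by
  rw [proj_extChartAt_symm]
  exact (mem_extChartAt_total_target hz).2

/-- The derivative of the inverse of the chart at `p`. -/
def dSymm (p : S.Total) (z : EuclideanSpace ℝ (Fin 4) × (Fin 2 → ℂ)) :
    (EuclideanSpace ℝ (Fin 4) × (Fin 2 → ℂ)) →L[ℝ]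
      TangentSpace modelTotal ((extChartAt modelTotal p).symm z) :=
  mfderiv 𝓘(ℝ, EuclideanSpace ℝ (Fin 4) × (Fin 2 → ℂ)) modelTotal (extChartAt modelTotal p).symm z

theorem hasMFDerivAt_extChartAt_symm {p : S.Total} {z : EuclideanSpace ℝ (Fin 4) × (Fin 2 → ℂ)}
    (hz : z ∈ (extChartAt modelTotal p).target) :
    HasMFDerivAt 𝓘(ℝ, EuclideanSpace ℝ (Fin 4) × (Fin 2 → ℂ)) modelTotal
      (extChartAt modelTotal p).symm z (dSymm p z) :=
  (mdifferentiableAt_extChartAt_symm (I := modelTotal) hz).hasMFDerivAt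

/-- In the chart at `p` the fibre coordinates are the second component. -/
theorem dFiberAt_dSymm {p : S.Total} {z : EuclideanSpace ℝ (Fin 4) × (Fin 2 → ℂ)}
    (hz : z ∈ (extChartAt modelTotal p).target) (V : EuclideanSpace ℝ (Fin 4) × (Fin 2 → ℂ)) :
    S.dFiberAt (S.indexAt p.proj) ((extChartAt modelTotal p).symm z) (dSymm p z V) = V.2 := by
  have h1 : HasMFDerivAt 𝓘(ℝ, EuclideanSpace ℝ (Fin 4) × (Fin 2 → ℂ)) 𝓘(ℝ, Fin 2 → ℂ)
      (S.fiberCoord (S.indexAt p.proj) ∘ (extChartAt modelTotal p).symm) z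
      ((S.dFiberAt (S.indexAt p.proj) ((extChartAt modelTotal p).symm z)).comp (dSymm p z)) :=
    (mdifferentiableAt_fiberCoord (proj_mem_of_mem_target hz)).hasMFDerivAt.comp z
      (hasMFDerivAt_extChartAt_symm hz)
  have h2 : (S.fiberCoord (S.indexAt p.proj) ∘ (extChartAt modelTotal p).symm) =ᶠ[𝓝 z]
      Prod.snd := by
    filter_upwards [(isOpen_extChartAt_target p).mem_nhds hz] with w hw
    exact fiberCoord_extChartAt_symm hw
  have h3 := hasMFDerivAt_unique (h1.congr_of_eventuallyEq h2.symm)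
    (hasFDerivAt_snd (𝕜 := ℝ) (E := EuclideanSpace ℝ (Fin 4)) (F := Fin 2 → ℂ)
      (p := z)).hasMFDerivAt
  exact congrArg (fun T : (EuclideanSpace ℝ (Fin 4) × (Fin 2 → ℂ)) →L[ℝ] (Fin 2 → ℂ) => T V) h3

theorem dProj_dSymm {p : S.Total} {z : EuclideanSpace ℝ (Fin 4) × (Fin 2 → ℂ)}
    (hz : z ∈ (extChartAt modelTotal p).target) (V : EuclideanSpace ℝ (Fin 4) × (Fin 2 → ℂ)) :
    (S.dProj ((extChartAt modelTotal p).symm z) (dSymm p z V) : EuclideanSpace ℝ (Fin 4)) =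
      mfderiv 𝓘(ℝ, EuclideanSpace ℝ (Fin 4)) (𝓡 4) (extChartAt (𝓡 4) p.proj).symm z.1 V.1 := by
  have h1 : HasMFDerivAt 𝓘(ℝ, EuclideanSpace ℝ (Fin 4) × (Fin 2 → ℂ)) (𝓡 4)
      ((fun q : S.Total => q.proj) ∘ (extChartAt modelTotal p).symm) z
      ((S.dProj ((extChartAt modelTotal p).symm z)).comp (dSymm p z)) :=
    (mdifferentiableAt_proj _).hasMFDerivAt.comp z (hasMFDerivAt_extChartAt_symm hz)
  have h4 : HasMFDerivAt 𝓘(ℝ, EuclideanSpace ℝ (Fin 4) × (Fin 2 → ℂ)) (𝓡 4)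
      ((extChartAt (𝓡 4) p.proj).symm ∘ Prod.fst) z _ :=
    (mdifferentiableAt_extChartAt_symm (I := 𝓡 4)
      (mem_extChartAt_total_target hz).1).hasMFDerivAt.comp z
    (hasFDerivAt_fst (𝕜 := ℝ) (E := EuclideanSpace ℝ (Fin 4)) (F := Fin 2 → ℂ)
      (p := z)).hasMFDerivAt
  have h5 := hasMFDerivAt_unique h1
    (h4.congr_of_eventuallyEq (Eventually.of_forall fun w => proj_extChartAt_symm p w))
  exact congrArg (fun T : (EuclideanSpace ℝ (Fin 4) × (Fin 2 → ℂ)) →L[ℝ]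
    EuclideanSpace ℝ (Fin 4) => T V) h5

theorem coords_dProj_dSymm {p : S.Total} {z : EuclideanSpace ℝ (Fin 4) × (Fin 2 → ℂ)}
    (hz : z ∈ (extChartAt modelTotal p).target) (V : EuclideanSpace ℝ (Fin 4) × (Fin 2 → ℂ))
    (i : S.ι) (c : Fin 4) :
    S.coords i _ (S.dProj ((extChartAt modelTotal p).symm z) (dSymm p z V)) c =
      S.coframeIn i p.proj c z.1 V.1 := by
  have key : ∀ a b : X, a = b → ∀ w : EuclideanSpace ℝ (Fin 4),
      S.coords i a w = S.coords i b w := by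
    rintro a _ rfl w; rfl
  exact congrFun ((congrArg (S.coords i ((extChartAt modelTotal p).symm z).proj)
    (dProj_dSymm hz V)).trans (key _ _ (proj_extChartAt_symm p z) _)) c

/-- In the chart at `p` the form `δπ` is the connection form `dη + Γ η` on `ℝ⁴ × ℂ²`. -/
theorem deltaPiAt_dSymm {p : S.Total} {z : EuclideanSpace ℝ (Fin 4) × (Fin 2 → ℂ)}
    (hz : z ∈ (extChartAt modelTotal p).target) (V : EuclideanSpace ℝ (Fin 4) × (Fin 2 → ℂ)) :
    S.deltaPiAt (S.indexAt p.proj) ((extChartAt modelTotal p).symm z) (dSymm p z V) =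
      V.2 + S.connIn (S.indexAt p.proj) p.proj z.1 V.1 z.2 := by
  rw [deltaPiAt_apply, dFiberAt_dSymm hz, fiberCoord_extChartAt_symm hz, connIn, sum_apply,
    sum_apply]
  congr 1
  refine Finset.sum_congr rfl fun c _ => ?_
  rw [coords_dProj_dSymm hz, proj_extChartAt_symm, ContinuousLinearMap.smulRight_apply, smul_apply,
    spinLiftCLM_apply]
  rfl

end SpinStructure

/-! ### The forms `m(π, δπ)` -/

/-- A real bilinear form on `ℂ²` which is invariant under `SU(2)`, acting by `η ↦ B̄ η`, and under
its Lie algebra. The second condition follows from the first one; it is kept as a field because it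
is just as easy to verify directly. -/
structure IsInvariant (m : (Fin 2 → ℂ) →L[ℝ] (Fin 2 → ℂ) →L[ℝ] ℂ) : Prop where
  group : ∀ (B : Matrix.specialUnitaryGroup (Fin 2) ℂ) (ξ η : Fin 2 → ℂ),
    m ((B : Matrix (Fin 2) (Fin 2) ℂ).map star *ᵥ ξ) ((B : Matrix (Fin 2) (Fin 2) ℂ).map star *ᵥ η)
      = m ξ η
  algebra : ∀ K : Matrix (Fin 2) (Fin 2) ℂ, Kᴴ = -K → K.trace = 0 →
    ∀ ξ η, m (K *ᵥ ξ) η = - m ξ (K *ᵥ η)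

namespace SpinStructure

variable {g : Metric4 X} {S : SpinStructure g}

variable (S) in
/-- The 1-form `m(π, δπ)`. -/
def pairForm (m : (Fin 2 → ℂ) →L[ℝ] (Fin 2 → ℂ) →L[ℝ] ℂ) : DiffForm modelTotal S.Total 1 :=
  fun p => ContinuousAlternatingMap.ofSubsingleton ℝ (TangentSpace modelTotal p) ℂ (0 : Fin 1)
    ((m (S.spinor p)).comp (S.deltaPi p))

/-- The form `m(π, δπ)` may be computed in every frame. -/
theorem pair_deltaPi {m : (Fin 2 → ℂ) →L[ℝ] (Fin 2 → ℂ) →L[ℝ] ℂ} (hm : IsInvariant m) {i : S.ι}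
    {q : S.Total} (hi : q.proj ∈ S.U i) (V : TangentSpace modelTotal q) :
    m (S.spinor q) (S.deltaPi q V) = m (S.fiberCoord i q) (S.deltaPiAt i q V) := by
  rw [spinor, ← deltaPiAt_indexAt, fiberCoord_change hi (S.mem_U _),
    deltaPiAt_change hi (S.mem_U _)]
  exact hm.group _ _ _

theorem inChart_pairForm {m : (Fin 2 → ℂ) →L[ℝ] (Fin 2 → ℂ) →L[ℝ] ℂ} (hm : IsInvariant m)
    {p : S.Total} {z : EuclideanSpace ℝ (Fin 4) × (Fin 2 → ℂ)}
    (hz : z ∈ (extChartAt modelTotal p).target) :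
    inChart (S.pairForm m) p z = ContinuousAlternatingMap.ofSubsingleton ℝ
      (EuclideanSpace ℝ (Fin 4) × (Fin 2 → ℂ)) ℂ (0 : Fin 1)
      (connForm m (S.connIn (S.indexAt p.proj) p.proj) z) := by
  ext v
  have h := pair_deltaPi hm (proj_mem_of_mem_target hz) (dSymm p z (v 0))
  rw [fiberCoord_extChartAt_symm hz, deltaPiAt_dSymm hz] at h
  exact h

theorem eventually_inChart_pairForm {m : (Fin 2 → ℂ) →L[ℝ] (Fin 2 → ℂ) →L[ℝ] ℂ}
    (hm : IsInvariant m) (p : S.Total) :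
    inChart (S.pairForm m) p =ᶠ[𝓝 (extChartAt modelTotal p p)] fun z =>
      ContinuousAlternatingMap.ofSubsingleton ℝ (EuclideanSpace ℝ (Fin 4) × (Fin 2 → ℂ)) ℂ
        (0 : Fin 1) (connForm m (S.connIn (S.indexAt p.proj) p.proj) z) := by
  filter_upwards [eventually_mem_target (I := modelTotal) p] with z hz
  exact inChart_pairForm hm hz

theorem smoothFormAt_pairForm {m : (Fin 2 → ℂ) →L[ℝ] (Fin 2 → ℂ) →L[ℝ] ℂ} (hm : IsInvariant m)
    (p : S.Total) : SmoothFormAt (S.pairForm m) p := by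
  refine ContDiffAt.congr_of_eventuallyEq ?_ (eventually_inChart_pairForm hm p)
  have h : ContDiffAt ℝ ∞ (connForm m (S.connIn (S.indexAt p.proj) p.proj))
      (extChartAt modelTotal p p) :=
    contDiffAt_connForm m
      (contDiffAt_connIn (mem_extChartAt_total_target (mem_extChartAt_target p)))
  exact (ContinuousAlternatingMap.ofSubsingletonLIE (𝕜 := ℝ)
    (E := EuclideanSpace ℝ (Fin 4) × (Fin 2 → ℂ)) (F := ℂ)
    (0 : Fin 1)).toContinuousLinearEquiv.contDiff.contDiffAt.comp _ h

theorem connIn_apply (i : S.ι) (x₀ : X) (y u : EuclideanSpace ℝ (Fin 4)) (η : Fin 2 → ℂ) :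
    S.connIn i x₀ y u η = ∑ c, S.coframeIn i x₀ c y u •
      (S.spinConn i c ((extChartAt (𝓡 4) x₀).symm y) *ᵥ η) := by
  rw [connIn, sum_apply, sum_apply]
  rfl

/-- The connection matrices of `𝕊'` are in the Lie algebra of `SU(2)`. -/
theorem spinConn_conjTranspose (i : S.ι) (c : Fin 4) (x : X) :
    (S.spinConn i c x)ᴴ = - S.spinConn i c x ∧ (S.spinConn i c x).trace = 0 := by
  obtain ⟨a, b, -, hb, -, ht, h, -⟩ := spinLift_spec (Matrix.of fun c' a => S.leviCivita i c a c' x)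
    (by ext r t; exact leviCivita_skew i c r t x)
  rw [spinConn, h]
  constructor
  · rw [Matrix.conjTranspose_neg, Matrix.conjTranspose, Matrix.transpose_transpose, neg_neg]
    have := congrArg Matrix.transpose hb
    rw [Matrix.conjTranspose, ← Matrix.transpose_map, Matrix.transpose_transpose,
      Matrix.transpose_neg] at this
    rw [this, neg_neg]
  · rw [Matrix.trace_neg, Matrix.trace_transpose, ht, neg_zero]

theorem connIn_invariant {m : (Fin 2 → ℂ) →L[ℝ] (Fin 2 → ℂ) →L[ℝ] ℂ} (hm : IsInvariant m)
    (i : S.ι) (x₀ : X) (y u : EuclideanSpace ℝ (Fin 4)) (ξ η : Fin 2 → ℂ) :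
    m (S.connIn i x₀ y u ξ) η = - m ξ (S.connIn i x₀ y u η) := by
  rw [connIn_apply, connIn_apply, map_sum, map_sum, sum_apply, ← Finset.sum_neg_distrib]
  refine Finset.sum_congr rfl fun c _ => ?_
  rw [map_smul, map_smul, smul_apply, hm.algebra _ (spinConn_conjTranspose i c _).1
    (spinConn_conjTranspose i c _).2, smul_neg]

/-- The exterior derivative of `m(π, δπ)` is `m(δπ ∧ δπ) + m(π, Fπ)`, where the curvature `F` of an
anti self-dual Einstein metric is `Λ` times the projection to the self dual forms. -/
theorem extD_pairForm (hE : S.IsEinstein) (hA : S.IsAntiSelfDual)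
    {m : (Fin 2 → ℂ) →L[ℝ] (Fin 2 → ℂ) →L[ℝ] ℂ} (hm : IsInvariant m) (p : S.Total)
    (v : Fin 2 → TangentSpace modelTotal p) :
    extD (S.pairForm m) p v = m (S.deltaPi p (v 0)) (S.deltaPi p (v 1))
      - m (S.deltaPi p (v 1)) (S.deltaPi p (v 0))
      + m (S.spinor p) ((S.Lam p.proj : ℂ) •
        (wedgeSD (toM (S.coords (S.indexAt p.proj) p.proj (S.dProj p (v 0))))
          (toM (S.coords (S.indexAt p.proj) p.proj (S.dProj p (v 1)))) *ᵥ S.spinor p)) := by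
  set i := S.indexAt p.proj with hi
  set z := extChartAt modelTotal p p with hz
  have hzt : z ∈ (extChartAt modelTotal p).target := mem_extChartAt_target p
  have hpz : (extChartAt modelTotal p).symm z = p := extChartAt_to_inv p
  have hz2 : z.2 = S.spinor p := by rw [hz, extChartAt_total]; rfl
  have hz1 : z.1 = extChartAt (𝓡 4) p.proj p.proj := by rw [hz, extChartAt_total]
  let D : TangentSpace modelTotal p →L[ℝ] (EuclideanSpace ℝ (Fin 4) × (Fin 2 → ℂ)) :=
    mfderiv modelTotal 𝓘(ℝ, EuclideanSpace ℝ (Fin 4) × (Fin 2 → ℂ)) (extChartAt modelTotal p) p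
  have hD : ∀ V : TangentSpace modelTotal p,
      (dSymm p z (D V) : EuclideanSpace ℝ (Fin 4) × (Fin 2 → ℂ)) = V := by
    intro V
    have h1 := (hasMFDerivAt_extChartAt_symm hzt).comp p
      (mdifferentiableAt_extChartAt (I := modelTotal) (mem_chart_source _ p)).hasMFDerivAt
    have h2 := hasMFDerivAt_unique (h1.congr_of_eventuallyEq (f₁ := id) (by
      filter_upwards [extChartAt_source_mem_nhds (I := modelTotal) p] with q hq
      exact ((extChartAt modelTotal p).left_inv hq).symm)) (hasMFDerivAt_id p)
    exact congrArg (fun T : (EuclideanSpace ℝ (Fin 4) × (Fin 2 → ℂ)) →L[ℝ]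
      (EuclideanSpace ℝ (Fin 4) × (Fin 2 → ℂ)) => T V) h2
  -- transport along `(extChartAt modelTotal p).symm z = p`
  have key : ∀ q : S.Total, q = p → ∀ W : EuclideanSpace ℝ (Fin 4) × (Fin 2 → ℂ),
      S.deltaPiAt i q W = S.deltaPi p W ∧
      S.coords i q.proj (S.dProj q W) = S.coords i p.proj (S.dProj p W) := by
    rintro q rfl W
    exact ⟨rfl, rfl⟩
  have hδ : ∀ V : TangentSpace modelTotal p,
      (D V).2 + S.connIn i p.proj z.1 (D V).1 z.2 = S.deltaPi p V := by
    intro V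
    rw [← deltaPiAt_dSymm hzt]
    refine ((key _ hpz _).1.trans ?_)
    exact congrArg (S.deltaPi p) (hD V)
  have hc : ∀ V : TangentSpace modelTotal p,
      (fun a => S.coframeIn i p.proj a z.1 (D V).1) = S.coords i p.proj (S.dProj p V) := by
    intro V
    have h1 : (fun a => S.coframeIn i p.proj a z.1 (D V).1) =
        S.coords i _ (S.dProj ((extChartAt modelTotal p).symm z) (dSymm p z (D V))) := by
      funext a
      exact (coords_dProj_dSymm hzt (D V) i a).symm
    rw [h1]
    refine ((key _ hpz _).2.trans ?_)
    exact congrArg (fun W => S.coords i p.proj (S.dProj p W)) (hD V)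
  have hdom : z.1 ∈ S.domIn i p.proj := mem_extChartAt_total_target hzt
  have h := extDeriv_connForm m (G := S.connIn i p.proj) (z := z)
    ((contDiffAt_connIn hdom).differentiableAt (by simp))
    (fun u ξ η => connIn_invariant hm i p.proj z.1 u ξ η) (fun k => D (v k))
  rw [← (eventually_inChart_pairForm hm p).extDeriv_eq] at h
  rw [hδ, hδ, curvature_connIn hE hA hdom, hc, hc, hz2, hz1, extChartAt_to_inv] at h
  exact h

end SpinStructure

/-! ### The form `∂̄‖π‖²` and the potential -/

/-- The skew form `ε` as a real bilinear map. -/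
def epsB : (Fin 2 → ℂ) →L[ℝ] (Fin 2 → ℂ) →L[ℝ] ℂ :=
  LinearMap.toContinuousLinearMap
    { toFun := epsL
      map_add' := fun x y => ContinuousLinearMap.ext fun η => by
        change eps (x + y) η = eps x η + eps y η
        simp [eps]; ring
      map_smul' := fun c x => ContinuousLinearMap.ext fun η => by
        change eps (c • x) η = c • eps x η
        simp [eps]; ring }

theorem epsB_apply (ξ η : Fin 2 → ℂ) : epsB ξ η = eps ξ η := rfl

/-- The Hermitian form `(ξ, η) ↦ ε(ση, ξ) = ξ⁰ η̄⁰ + ξ¹ η̄¹` as a real bilinear map. -/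
def hermB : (Fin 2 → ℂ) →L[ℝ] (Fin 2 → ℂ) →L[ℝ] ℂ := (epsB.comp sigmaL).flip

theorem hermB_apply (ξ η : Fin 2 → ℂ) : hermB ξ η = eps (sigma η) ξ := rfl

theorem hermB_eq_dotProduct (ξ η : Fin 2 → ℂ) : hermB ξ η = star η ⬝ᵥ ξ := by
  simp [hermB_apply, eps, sigma, dotProduct]
  ring

theorem isInvariant_epsB : IsInvariant epsB where
  group B ξ η := by
    have h : star ((B : Matrix (Fin 2) (Fin 2) ℂ).det) = 1 := by
      rw [(Matrix.mem_specialUnitaryGroup_iff.1 B.2).2, star_one]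
    rw [Matrix.det_fin_two] at h
    simp only [star_sub, star_mul'] at h
    simp only [epsB_apply, eps, Matrix.mulVec, dotProduct, Fin.sum_univ_two, Matrix.map_apply]
    linear_combination (ξ 0 * η 1 - ξ 1 * η 0) * h
  algebra K _ hK ξ η := by
    rw [Matrix.trace_fin_two] at hK
    simp only [epsB_apply, eps, Matrix.mulVec, dotProduct, Fin.sum_univ_two]
    linear_combination (ξ 0 * η 1 - ξ 1 * η 0) * hK

theorem isInvariant_hermB : IsInvariant hermB where
  group B ξ η := by
    have h : ((B : Matrix (Fin 2) (Fin 2) ℂ).map star)ᴴ * (B : Matrix (Fin 2) (Fin 2) ℂ).map star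
        = 1 := by
      have h1 := congrArg (fun M => M.map star) (SpinStructure.conjTranspose_mul_self B)
      simp only [map_star_mul] at h1
      rw [Matrix.map_one _ (star_zero ℂ) (star_one ℂ)] at h1
      exact h1
    rw [hermB_eq_dotProduct, hermB_eq_dotProduct, Matrix.star_mulVec, ← Matrix.dotProduct_mulVec,
      Matrix.mulVec_mulVec, h, Matrix.one_mulVec]
  algebra K hK _ ξ η := by
    rw [hermB_eq_dotProduct, hermB_eq_dotProduct, Matrix.star_mulVec, ← Matrix.dotProduct_mulVec,
      hK, Matrix.neg_mulVec, dotProduct_neg, neg_neg]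

theorem spinorNormSq_eq_hermB (π : Fin 2 → ℂ) : spinorNormSq π = hermB π π := rfl

theorem sigma_I_smul (ξ : Fin 2 → ℂ) : sigma (Complex.I • ξ) = -(Complex.I • sigma ξ) := by
  ext i; fin_cases i <;> simp [sigma]

theorem eps_smul_right (c : ℂ) (ξ η : Fin 2 → ℂ) : eps ξ (c • η) = c * eps ξ η := by
  simp [eps]; ring

theorem eps_smul_left (c : ℂ) (ξ η : Fin 2 → ℂ) : eps (c • ξ) η = c * eps ξ η := by
  simp [eps]; ring

theorem eps_neg_left (ξ η : Fin 2 → ℂ) : eps (-ξ) η = - eps ξ η := by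
  simp [eps]; ring

theorem eps_swap (ξ η : Fin 2 → ℂ) : eps ξ η = - eps η ξ := by
  simp [eps]; ring

theorem sigma_ofReal_smul (r : ℝ) (ξ : Fin 2 → ℂ) : sigma ((r : ℂ) • ξ) = (r : ℂ) • sigma ξ := by
  ext i; fin_cases i <;> simp [sigma]

theorem star_hermB (ξ η : Fin 2 → ℂ) : star (hermB ξ η) = hermB η ξ := by
  simp [hermB_apply, eps, sigma]
  ring

theorem hermB_I_smul (ξ η : Fin 2 → ℂ) :
    hermB (Complex.I • ξ) η = Complex.I * hermB ξ η ∧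
    hermB ξ (Complex.I • η) = -(Complex.I * hermB ξ η) := by
  simp only [hermB_apply, sigma_I_smul, eps_neg_left, eps_smul_left, eps_smul_right, and_self]

namespace SpinStructure

variable {g : Metric4 X} {S : SpinStructure g}

theorem split_complexI (p : S.Total) (V : TangentSpace modelTotal p) :
    S.split p (S.complexI p V) = (S.baseEnd (S.indexAt p.proj) p.proj (matI (S.spinor p))
      (S.dProj p V), Complex.I • S.deltaPi p V) :=
  (S.split_isInvertible p).self_apply_inverse _

theorem split_complexJ (p : S.Total) (V : TangentSpace modelTotal p) :
    S.split p (S.complexJ p V) = (S.baseEnd (S.indexAt p.proj) p.proj (matJ (S.spinor p))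
      (S.dProj p V), sigma (S.deltaPi p V)) :=
  (S.split_isInvertible p).self_apply_inverse _

theorem deltaPi_complexI (p : S.Total) (V : TangentSpace modelTotal p) :
    S.deltaPi p (S.complexI p V) = Complex.I • S.deltaPi p V :=
  congrArg Prod.snd (split_complexI p V)

theorem deltaPi_complexJ (p : S.Total) (V : TangentSpace modelTotal p) :
    S.deltaPi p (S.complexJ p V) = sigma (S.deltaPi p V) :=
  congrArg Prod.snd (split_complexJ p V)

variable (S) in
/-- The horizontal part of a tangent vector as an element `v^{AA'}` of `𝕄`. -/
def horizontalM (p : S.Total) (V : TangentSpace modelTotal p) : Matrix (Fin 2) (Fin 2) ℂ :=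
  toM (S.coords (S.indexAt p.proj) p.proj (S.dProj p V))

/-- `baseEnd` is right multiplication by `K` on `𝕄`, provided that this is a real operator. -/
theorem toM_coords_baseEnd {i : S.ι} {x : X} (hx : x ∈ S.U i) {K : Matrix (Fin 2) (Fin 2) ℂ}
    (hK : ∀ a b, (coordM (basisM b * K) a).im = 0) (u : TangentSpace (𝓡 4) x) :
    toM (S.coords i x (S.baseEnd i x K u)) = toM (S.coords i x u) * K := by
  rw [← toM_coordM_re _ K hK]
  congr 1
  ext a
  have h : S.baseEnd i x K u = ∑ a, ∑ b, ((coordM (basisM b * K) a).re * S.coords i x u b) •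
      S.frame i a x := by
    rw [baseEnd, sum_apply]
    refine Finset.sum_congr rfl fun a _ => ?_
    rw [sum_apply]
    refine Finset.sum_congr rfl fun b _ => ?_
    rw [mul_smul]
    rfl
  have ho : ∀ c, g.inner x (S.frame i a x) (S.frame i c x) = if a = c then 1 else 0 := fun c =>
    S.frame_orthonormal i x hx a c
  rw [h, coords, map_sum]
  simp only [map_sum, map_smul, ho, smul_eq_mul, mul_ite, mul_one, mul_zero]
  rw [Finset.sum_eq_single a]
  · simp
  · intro b _ hb; simp [hb.symm]
  · simp

theorem horizontalM_complexI (p : S.Total) (V : TangentSpace modelTotal p) :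
    S.horizontalM p (S.complexI p V) = S.horizontalM p V * matI (S.spinor p) := by
  have h : S.dProj p (S.complexI p V) = S.baseEnd (S.indexAt p.proj) p.proj (matI (S.spinor p))
      (S.dProj p V) := congrArg Prod.fst (split_complexI p V)
  rw [horizontalM, h, toM_coords_baseEnd (S.mem_U _) (matI_real _)]
  rfl

theorem horizontalM_complexJ (p : S.Total) (V : TangentSpace modelTotal p) :
    S.horizontalM p (S.complexJ p V) = S.horizontalM p V * matJ (S.spinor p) := by
  have h : S.dProj p (S.complexJ p V) = S.baseEnd (S.indexAt p.proj) p.proj (matJ (S.spinor p))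
      (S.dProj p V) := congrArg Prod.fst (split_complexJ p V)
  rw [horizontalM, h, toM_coords_baseEnd (S.mem_U _) (matJ_real _)]
  rfl

theorem normSq_eq {i : S.ι} {q : S.Total} (hi : q.proj ∈ S.U i) :
    S.normSq q = hermB (S.fiberCoord i q) (S.fiberCoord i q) := by
  rw [normSq, spinorNormSq_eq_hermB, spinor, fiberCoord_change hi (S.mem_U _)]
  exact isInvariant_hermB.group _ _ _

/-- `d‖π‖² = h(π, δπ) + h(δπ, π)`, because the connection is Hermitian. -/
theorem differential_normSq (p : S.Total) (V : TangentSpace modelTotal p) :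
    differential S.normSq p V =
      hermB (S.spinor p) (S.deltaPi p V) + hermB (S.deltaPi p V) (S.spinor p) := by
  have h2 : HasMFDerivAt modelTotal 𝓘(ℝ, Fin 2 → ℂ) (S.fiberCoord (S.indexAt p.proj)) p
      (S.dFiber p) := (mdifferentiableAt_fiberCoord (S.mem_U _)).hasMFDerivAt
  have h3 := hasMFDerivAt_bilinear hermB h2 h2
  have h4 : S.normSq =ᶠ[𝓝 p] fun q => hermB (S.fiberCoord (S.indexAt p.proj) q)
      (S.fiberCoord (S.indexAt p.proj) q) := by
    filter_upwards [eventually_proj_mem (S.mem_U p.proj)] with q hq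
    exact normSq_eq hq
  have h5 : differential S.normSq p V =
      hermB (S.spinor p) (S.dFiber p V) + hermB (S.dFiber p V) (S.spinor p) :=
    congrArg (fun T : TangentSpace modelTotal p →L[ℝ] ℂ => T V)
      (h3.congr_of_eventuallyEq h4).mfderiv
  have h6 := deltaPiAt_apply (S.indexAt p.proj) p V
  change S.deltaPi p V = S.dFiber p V + ∑ c, S.coords (S.indexAt p.proj) p.proj (S.dProj p V) c •
      (S.spinConn (S.indexAt p.proj) c p.proj *ᵥ S.spinor p) at h6
  rw [h5, h6, map_add, map_add, add_apply, map_sum, map_sum, sum_apply]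
  have h7 : ∀ c, hermB (S.coords (S.indexAt p.proj) p.proj (S.dProj p V) c •
      (S.spinConn (S.indexAt p.proj) c p.proj *ᵥ S.spinor p)) (S.spinor p) =
      - hermB (S.spinor p) (S.coords (S.indexAt p.proj) p.proj (S.dProj p V) c •
      (S.spinConn (S.indexAt p.proj) c p.proj *ᵥ S.spinor p)) := by
    intro c
    rw [map_smul, map_smul, smul_apply, isInvariant_hermB.algebra _
      (spinConn_conjTranspose _ c _).1 (spinConn_conjTranspose _ c _).2, smul_neg]
  simp only [h7, Finset.sum_neg_distrib]
  ring

/-- `∂̄‖π‖² = ε(σδπ, π)`: as `δπ` is of type `(1, 0)`, only one of the two terms of `d‖π‖²` is left.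
On the zero section this holds as well, for the values which `𝕀` takes there. -/
theorem dbar_normSq : dbar S.complexI S.normSq = S.pairForm hermB := by
  funext p
  ext v
  change (1 / 2 : ℂ) * (differential S.normSq p (v 0) +
    Complex.I * differential S.normSq p (S.complexI p (v 0))) =
      hermB (S.spinor p) (S.deltaPi p (v 0))
  rw [differential_normSq, differential_normSq, deltaPi_complexI, (hermB_I_smul _ _).1,
    (hermB_I_smul _ _).2]
  linear_combination (1 / 2) * (hermB (S.deltaPi p (v 0)) (S.spinor p)
    - hermB (S.spinor p) (S.deltaPi p (v 0))) * Complex.I_mul_I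

theorem eventually_spinor_ne_zero {p : S.Total} (hp : S.spinor p ≠ 0) :
    ∀ᶠ q in 𝓝 p, S.spinor q ≠ 0 := by
  have hc : ContinuousAt (S.fiberCoord (S.indexAt p.proj)) p :=
    (mdifferentiableAt_fiberCoord (S.mem_U _)).continuousAt
  filter_upwards [hc.eventually_ne hp, eventually_proj_mem (S.mem_U p.proj)] with q hq hq'
  intro h
  apply hq
  rw [fiberCoord_change (S.mem_U q.proj) hq']
  exact (congrArg _ h).trans (map_zero _)

theorem extD_pairForm_hermB (hE : S.IsEinstein) (hA : S.IsAntiSelfDual) (p : S.Total)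
    (v : Fin 2 → TangentSpace modelTotal p) :
    extD (S.pairForm hermB) p v = hermB (S.deltaPi p (v 0)) (S.deltaPi p (v 1))
      - hermB (S.deltaPi p (v 1)) (S.deltaPi p (v 0))
      + S.Lam p.proj * eps (sigma (wedgeSD (S.horizontalM p (v 0)) (S.horizontalM p (v 1)) *ᵥ
        S.spinor p)) (S.spinor p) := by
  rw [extD_pairForm hE hA isInvariant_hermB, hermB_apply (S.spinor p), sigma_ofReal_smul,
    eps_smul_left]
  rfl

theorem omega_apply (hE : S.IsEinstein) (hA : S.IsAntiSelfDual) (p : S.Total)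
    (v : Fin 2 → TangentSpace modelTotal p) :
    S.omega p v = 2 * eps (S.deltaPi p (v 0)) (S.deltaPi p (v 1))
      + S.Lam p.proj * eps (S.spinor p) (wedgeSD (S.horizontalM p (v 0))
        (S.horizontalM p (v 1)) *ᵥ S.spinor p) := by
  have h := extD_pairForm hE hA isInvariant_epsB p v
  simp only [epsB_apply, eps_smul_right] at h
  rw [eps_swap (S.deltaPi p (v 1))] at h
  refine Eq.trans h ?_
  simp only [horizontalM]
  ring

/-- `ω̃_𝕁 = i d∂̄‖π‖²`, before the part of type `(1, 1)` is taken. -/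
theorem omegaJ_eq (hE : S.IsEinstein) (hA : S.IsAntiSelfDual) {p : S.Total} (hp : S.spinor p ≠ 0) :
    S.omegaJ p = Complex.I • extD (S.pairForm hermB) p := by
  ext v
  change (-Complex.I / 2) * (S.omega p ![v 0, S.complexJ p (v 1)]
    - S.omega p ![v 1, S.complexJ p (v 0)]) = Complex.I * extD (S.pairForm hermB) p v
  rw [omega_apply hE hA, omega_apply hE hA, extD_pairForm_hermB hE hA]
  simp only [Matrix.cons_val_zero, Matrix.cons_val_one, deltaPi_complexJ, horizontalM_complexJ]
  have h := eps_wedgeSD_matJ (S.coords (S.indexAt p.proj) p.proj (S.dProj p (v 0)))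
    (S.coords (S.indexAt p.proj) p.proj (S.dProj p (v 1))) hp
  change eps (S.spinor p) (wedgeSD (S.horizontalM p (v 0))
      (S.horizontalM p (v 1) * matJ (S.spinor p)) *ᵥ S.spinor p)
    - eps (S.spinor p) (wedgeSD (S.horizontalM p (v 1))
      (S.horizontalM p (v 0) * matJ (S.spinor p)) *ᵥ S.spinor p) = -2 * eps (sigma (wedgeSD
        (S.horizontalM p (v 0)) (S.horizontalM p (v 1)) *ᵥ S.spinor p)) (S.spinor p) at h
  rw [eps_swap _ (sigma (S.deltaPi p (v 1))), eps_swap _ (sigma (S.deltaPi p (v 0)))]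
  simp only [hermB_apply]
  linear_combination (-Complex.I / 2) * S.Lam p.proj * h

/-- `d∂̄‖π‖²` is of type `(1, 1)`. -/
theorem typeOneOne_extD (hE : S.IsEinstein) (hA : S.IsAntiSelfDual) {p : S.Total}
    (hp : S.spinor p ≠ 0) :
    typeOneOne S.complexI (extD (S.pairForm hermB)) p = extD (S.pairForm hermB) p := by
  ext v
  change (1 / 2 : ℂ) * (extD (S.pairForm hermB) p v + extD (S.pairForm hermB) p
    fun k => S.complexI p (v k)) = _
  rw [extD_pairForm_hermB hE hA, extD_pairForm_hermB hE hA]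
  simp only [deltaPi_complexI, horizontalM_complexI, (hermB_I_smul _ _).1, (hermB_I_smul _ _).2]
  have h : eps (sigma (wedgeSD (S.horizontalM p (v 0) * matI (S.spinor p))
      (S.horizontalM p (v 1) * matI (S.spinor p)) *ᵥ S.spinor p)) (S.spinor p) =
      eps (sigma (wedgeSD (S.horizontalM p (v 0)) (S.horizontalM p (v 1)) *ᵥ S.spinor p))
        (S.spinor p) := eps_wedgeSD_matI _ _ hp
  rw [h]
  linear_combination (-1 / 2) * (hermB (S.deltaPi p (v 0)) (S.deltaPi p (v 1))
      - hermB (S.deltaPi p (v 1)) (S.deltaPi p (v 0))) * Complex.I_mul_I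

/-- `ω̃_𝕁` is real because `d∂̄‖π‖²` has imaginary values. -/
theorem realFormAt_omegaJ (hE : S.IsEinstein) (hA : S.IsAntiSelfDual) {p : S.Total}
    (hp : S.spinor p ≠ 0) : RealFormAt S.omegaJ p := by
  intro v
  rw [omegaJ_eq hE hA hp]
  change (Complex.I * extD (S.pairForm hermB) p v).im = 0
  rw [← Complex.conj_eq_iff_im, map_mul, Complex.conj_I]
  have h : star (extD (S.pairForm hermB) p v) = - extD (S.pairForm hermB) p v := by
    rw [extD_pairForm_hermB hE hA, star_add, star_sub, star_mul', star_hermB, star_hermB]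
    have h1 : star (eps (sigma (wedgeSD (S.horizontalM p (v 0)) (S.horizontalM p (v 1)) *ᵥ
        S.spinor p)) (S.spinor p)) = _ := star_eps_wedgeSD _ _ _
    rw [h1, Complex.star_def, Complex.conj_ofReal]
    simp only [horizontalM]
    ring
  rw [← Complex.star_def, h]
  ring

theorem eventually_omegaJ_eq (hE : S.IsEinstein) (hA : S.IsAntiSelfDual) {p : S.Total}
    (hp : S.spinor p ≠ 0) : ∀ᶠ q in 𝓝 p, Complex.I • extD (S.pairForm hermB) q = S.omegaJ q := by
  filter_upwards [eventually_spinor_ne_zero hp] with q hq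
  exact (omegaJ_eq hE hA hq).symm

theorem smoothFormAt_extD_pairForm (p : S.Total) : SmoothFormAt (extD (S.pairForm hermB)) p :=
  smoothFormAt_extD (Eventually.of_forall (smoothFormAt_pairForm isInvariant_hermB))

theorem smoothFormAt_omegaJ (hE : S.IsEinstein) (hA : S.IsAntiSelfDual) {p : S.Total}
    (hp : S.spinor p ≠ 0) : SmoothFormAt S.omegaJ p :=
  smoothFormAt_congr (eventually_omegaJ_eq hE hA hp)
    (smoothFormAt_const_smul Complex.I (smoothFormAt_extD_pairForm p))

theorem extD_omegaJ (hE : S.IsEinstein) (hA : S.IsAntiSelfDual) {p : S.Total}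
    (hp : S.spinor p ≠ 0) : extD S.omegaJ p = 0 := by
  rw [← extD_congr (eventually_omegaJ_eq hE hA hp),
    extD_const_smul Complex.I (smoothFormAt_extD_pairForm p),
    extD_extD (Eventually.of_forall (smoothFormAt_pairForm isInvariant_hermB))]
  ext v
  exact mul_zero Complex.I

theorem oneOneFormAt_omegaJ (hE : S.IsEinstein) (hA : S.IsAntiSelfDual) {p : S.Total}
    (hp : S.spinor p ≠ 0) : OneOneFormAt S.complexI S.omegaJ p := by
  rw [OneOneFormAt, typeOneOne, omegaJ_eq hE hA hp]
  conv_rhs => rw [← typeOneOne_extD hE hA hp, typeOneOne]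
  ext v
  simp only [ContinuousAlternatingMap.smul_apply, ContinuousAlternatingMap.add_apply,
    ContinuousAlternatingMap.compContinuousLinearMap_apply, smul_eq_mul]
  ring

end SpinStructure

end SpinorPotential

end

theorem theorem3p4 {X : Type*} [TopologicalSpace X]
    [ChartedSpace (EuclideanSpace ℝ (Fin 4)) X] [IsManifold (𝓡 4) ∞ X]
    (g : SpinorPotential.Metric4 X) (S : SpinorPotential.SpinStructure g)
    (hEinstein : S.IsEinstein) (hASD : S.IsAntiSelfDual) (hLam : ∀ x : X, S.Lam x ≠ 0)
    (p : S.Total) (hp : S.spinor p ≠ 0) :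
    Complex.I • SpinorPotential.ddbar S.complexI S.normSq p = S.omegaJ p ∧
      SpinorPotential.SmoothFormAt S.omegaJ p ∧
      SpinorPotential.extD S.omegaJ p = 0 ∧
      SpinorPotential.RealFormAt S.omegaJ p ∧
      SpinorPotential.OneOneFormAt S.complexI S.omegaJ p :=
  ⟨by
    rw [SpinorPotential.ddbar, SpinorPotential.delZeroOne,
      SpinorPotential.SpinStructure.dbar_normSq,
      SpinorPotential.SpinStructure.typeOneOne_extD hEinstein hASD hp,
      SpinorPotential.SpinStructure.omegaJ_eq hEinstein hASD hp],
    SpinorPotential.SpinStructure.smoothFormAt_omegaJ hEinstein hASD hp,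
    SpinorPotential.SpinStructure.extD_omegaJ hEinstein hASD hp,
    SpinorPotential.SpinStructure.realFormAt_omegaJ hEinstein hASD hp,
    SpinorPotential.SpinStructure.oneOneFormAt_omegaJ hEinstein hASD hp⟩
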